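/- Let $1<p<\infty$, let $q$ be given by $pq=p+q$, and let $\alpha>-1$. On the unit disc $\mathbb D\subset\mathbb C$ let $\nu$ be the area measure normalized by $\nu(\mathbb D)=1$, let $d\nu_\alpha(z)=(\alpha+1)(1-|z|^2)^\alpha d\nu(z)$, and write $\|\cdot\|_{s,\alpha}$ for the norm of $L^s(\mathbb D,d\nu_\alpha)$. The Bergman space $A^s_\alpha(\mathbb D)$ consists of the holomorphic functions on $\mathbb D$ that lie in $L^s(\mathbb D,d\nu_\alpha)$. Put $$K^\alpha_w(z)=\frac1{(1-z\overline w)^{2+\alpha}},\qquad k^\alpha_w=\frac{K^\alpha_w}{\|K^\alpha_w\|_{2,\alpha}},\qquad P_\alpha h(z)=\int_{\mathbb D}\frac{h(w)}{(1-z\overline w)^{2+\alpha}}\,d\nu_\alpha(w),\qquad P^+_\alpha h(z)=\int_{\mathbb D}\frac{h(w)}{|1-z\overline w|^{2+\alpha}}\,d\nu_\alpha(w),$$ and let $T_u h=P_\alpha(uh)$ be the Toeplitz operator with symbol $u$. The product $T_uT_v$ is considered on the set of those $h\in A^p_\alpha(\mathbb D)$ for which $vh$ and $u\,T_vh$ are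 $\nu_\alpha$-integrable; it is called bounded on $A^p_\alpha(\mathbb D)$ if this domain is dense in $A^p_\alpha(\mathbb D)$ and there is a constant $C$ such that $T_uT_vh\in A^p_\alpha(\mathbb D)$ and $\|T_uT_vh\|_{p,\alpha}\le C\|h\|_{p,\alpha}$ for all $h$ in the domain. For an arc $I$ of the unit circle with normalized length $|I|\in(0,1]$ let $Q_I=\{re^{i\theta}: 1-|I|<r<1,\ e^{i\theta}\in I\}$ be its Carleson box, and for a weight $\omega$ put $|Q_I|_{\omega,\alpha}=\int_{Q_I}\omega\,d\nu_\alpha$ and $|Q_I|_\alpha=|Q_I|_{1,\alpha}$. **Proposition.** Let $f\in A^p_\alpha(\mathbb D)$ have no zeros in $\mathbb D$ and suppose that $1/f\in A^q_\alpha(\mathbb D)$. Then the following are equivalent. (i) $T_fT_{1/\overline f}$ is bounded on $A^p_\alpha(\mathbb D)$. (ii) $\displaystyle\sup_{w\in\mathbb D}\|fk^\alpha_w\|_{p,\alpha}\,\|f^{-1}k^\alpha_w\|_{q,\alpha}<\infty$. (iii) With $\omega=|f|^p$ and $\sigma=\omega^{1-q}=|f|^{-q}$, $$\sup_I\frac{|Q_I|_{\omega,\alpha}\,|Q_I|_{\sigma,\alpha}^{p-1}}{|Q_I|_\alpha^{p}}<\infty,$$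 the supremum being over all arcs $I$ of the unit circle. (iv) $P^+_\alpha$ is bounded from $L^p(\mathbb D,|f|^{p}d\nu_\alpha)$ to $L^p(\mathbb D,|f|^{p}d\nu_\alpha)$: there is a constant $C$ such that for every $h\in L^p(\mathbb D,|f|^pd\nu_\alpha)$ the integral defining $P_\alpha^+h$ converges absolutely almost everywhere, and $\|P_\alpha^+h\|_{L^p(|f|^pd\nu_\alpha)}\le C\|h\|_{L^p(|f|^pd\nu_\alpha)}$. -/

import Mathlib

open scoped ENNReal ComplexConjugate

noncomputable section

namespace BergmanDisc

open MeasureTheory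

/-- The open unit disc of the complex plane. -/
def disc : Set ℂ := Metric.ball 0 1

/-- Lebesgue area measure on the unit disc, normalized so that the disc has measure `1`. -/
def nu : Measure ℂ := ENNReal.ofReal (1 / Real.pi) • volume.restrict disc

/-- The probability measure `(α + 1) (1 - |z| ^ 2) ^ α dν(z)` on the unit disc, for `α > -1`. -/
def nuA (α : ℝ) : Measure ℂ :=
  nu.withDensity fun z => ENNReal.ofReal ((α + 1) * (1 - ‖z‖ ^ 2) ^ α)

/-- The norm of `L^p(dν_α)`, with values in `[0, ∞]`. -/
def normA (p α : ℝ) (f : ℂ → ℂ) : ℝ≥0∞ := eLpNorm f (ENNReal.ofReal p) (nuA α)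

/-- Membership in the weighted Bergman space `A^p_α` of the disc. Only the values of `f` on the
disc matter. -/
def MemBergman (p α : ℝ) (f : ℂ → ℂ) : Prop :=
  DifferentiableOn ℂ f disc ∧ MemLp f (ENNReal.ofReal p) (nuA α)

/-- The reproducing kernel `K^α(z, w) = (1 - z \bar w) ^ (-(2 + α))` of `A^2_α`. For `z`, `w` in the
disc the base has positive real part, and the power is the principal one. -/
def kernel (α : ℝ) (z w : ℂ) : ℂ := 1 / (1 - z * conj w) ^ ((2 + α : ℝ) : ℂ)

/-- The normalized reproducing kernel `k_w^α = K_w^α / ‖K_w^α‖_{2,α}`, as a function of `z`. -/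
def normKernel (α : ℝ) (w z : ℂ) : ℂ :=
  kernel α z w / ((normA 2 α fun ζ => kernel α ζ w).toReal : ℂ)

/-- The Bergman projection `P_α h(z) = ∫ K^α(z, w) h(w) dν_α(w)`; the integral converges at every
point of the disc as soon as `h` is `ν_α`-integrable. -/
def proj (α : ℝ) (h : ℂ → ℂ) (z : ℂ) : ℂ := ∫ w, h w * kernel α z w ∂(nuA α)

/-- The Toeplitz operator with symbol `u`: `T_u h = P_α(u h)`. -/
def toeplitz (α : ℝ) (u h : ℂ → ℂ) : ℂ → ℂ := proj α fun w => u w * h w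

/-- The natural domain in `A^p_α` of the product `T_u T_v`: the functions `h ∈ A^p_α` for which both
`T_v h = P_α(v h)` and `T_u (T_v h) = P_α(u T_v h)` are projections of integrable functions. -/
def InProductDomain (p α : ℝ) (u v h : ℂ → ℂ) : Prop :=
  MemBergman p α h ∧ Integrable (fun z => v z * h z) (nuA α) ∧
    Integrable (fun z => u z * toeplitz α v h z) (nuA α)

/-- `T_u T_v` is bounded on `A^p_α`: it is densely defined on `A^p_α`, maps its natural domain into
`A^p_α`, and its norm there is finite (so it extends uniquely to a bounded operator of `A^p_α`). -/
def ToeplitzProductBounded (p α : ℝ) (u v : ℂ → ℂ) : Prop :=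
  (∀ h, MemBergman p α h → ∀ ε : ℝ≥0∞, 0 < ε →
    ∃ h₀, InProductDomain p α u v h₀ ∧ normA p α (fun z => h z - h₀ z) < ε) ∧
  ∃ C : ℝ, ∀ h, InProductDomain p α u v h →
    MemBergman p α (toeplitz α u (toeplitz α v h)) ∧
      normA p α (toeplitz α u (toeplitz α v h)) ≤ ENNReal.ofReal C * normA p α h

/-- The Carleson box over the arc `I = {e^{iθ} : a ≤ θ ≤ b}` of the unit circle, whose normalized
length is `|I| = (b - a) / (2π)`: the points `r e^{iθ}` with `1 - |I| < r < 1` and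
`e^{iθ} ∈ I`. -/
def carlesonBox (a b : ℝ) : Set ℂ :=
  {z | ∃ r θ : ℝ, 1 - (b - a) / (2 * Real.pi) < r ∧ r < 1 ∧ a ≤ θ ∧ θ ≤ b ∧
    z = r * Complex.exp (θ * Complex.I)}

/-- `|Q|_{ω,α} = ∫_Q ω dν_α`. -/
def mass (α : ℝ) (ω : ℂ → ℝ) (Q : Set ℂ) : ℝ≥0∞ := ∫⁻ z in Q, ENNReal.ofReal (ω z) ∂(nuA α)

/-- The joint Békollé–Bonami constant of the weights `σ` and `ω`: the supremum over all arcs `I` of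
the circle, the whole circle included. -/
def jointBB (p α : ℝ) (σ ω : ℂ → ℝ) : ℝ≥0∞ :=
  ⨆ (a : ℝ) (b : ℝ) (_ : a < b) (_ : b ≤ a + 2 * Real.pi),
    mass α ω (carlesonBox a b) * mass α σ (carlesonBox a b) ^ (p - 1) /
      mass α (fun _ => 1) (carlesonBox a b) ^ p

/-- The integrand of the positive Bergman operator at `z`. -/
def posIntegrand (α : ℝ) (h : ℂ → ℂ) (z w : ℂ) : ℂ :=
  h w / ((‖1 - z * conj w‖ ^ (2 + α) : ℝ) : ℂ)

/-- The positive Bergman operator `P_α^+ h(z) = ∫ h(w) / |1 - z \bar w| ^ (2 + α) dν_α(w)`. -/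
def posProj (α : ℝ) (h : ℂ → ℂ) (z : ℂ) : ℂ := ∫ w, posIntegrand α h z w ∂(nuA α)

/-- The measure `ω dν_α`. -/
def weighted (α : ℝ) (ω : ℂ → ℝ) : Measure ℂ :=
  (nuA α).withDensity fun z => ENNReal.ofReal (ω z)

/-- `P_α^+` is bounded from `L^p(μ dν_α)` to `L^p(ω dν_α)`: for every `h ∈ L^p(μ dν_α)` the
integral that defines `P_α^+ h` converges absolutely almost everywhere, and
`‖P_α^+ h‖ ≤ C ‖h‖` with `C` independent of `h`. -/
def PosProjBounded (p α : ℝ) (μ ω : ℂ → ℝ) : Prop :=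
  ∃ C : ℝ, ∀ h : ℂ → ℂ, MemLp h (ENNReal.ofReal p) (weighted α μ) →
    (∀ᵐ z ∂(nuA α), Integrable (posIntegrand α h z) (nuA α)) ∧
    MemLp (posProj α h) (ENNReal.ofReal p) (weighted α ω) ∧
    eLpNorm (posProj α h) (ENNReal.ofReal p) (weighted α ω) ≤
      ENNReal.ofReal C * eLpNorm h (ENNReal.ofReal p) (weighted α μ)

end BergmanDisc

end

noncomputable section

namespace BergmanDisc

open MeasureTheory

/-! The implications are proved in a circle, (i) ⇒ (ii) ⇒ (iii) ⇒ (iv) ⇒ (i). Throughout, ω = |f|^p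
and σ = |f|^(-q).

The core is (iii) ⇒ (iv), a Békollé–Bonami theorem obtained without a maximal function. Up to a
constant, the positive kernel is dominated by a sum of 2^(n(2+α)) 1_Q(z) 1_Q(w) over
half-overlapping dyadic Carleson boxes Q of size 2^(-n) (`exists_common_dbox`, `posKernel_le_tsum`).
In duality with L^q(ω) the operator thus becomes a sum of products of box integrals. Condition (iii)
bounds the coefficient by σ(Q)^(-1/q) ω(Q)^(-1/p), and Hölder over the boxes leaves one Carleson
embedding for σ and one for ω (`TopHeavy.carleson`). These embeddings hold because both weights put
a fixed fraction of every box Q into its top half T: Hölder for 1 = |f| |1/f| gives ν_α(T)^p ≤ ω(T)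
σ(T)^(p-1), the measures ν_α(T) and ν_α(Q) are comparable, and (iii) is the reverse inequality on Q
(`topHeavy_of_jointBB`). Mass then decays geometrically towards the circle, and a weight that grows
slightly more slowly makes the box estimates summable over the generations.

(iv) ⇒ (i): |f T_{1/f̄} h| is at most |f| P⁺(|h|/|f|), hence in L^p. As f T_{1/f̄} h is holomorphic,
P_α reproduces it (`proj_eq_self`), so the outer Toeplitz operator is multiplication by f.

(i) ⇒ (ii): density and Fatou carry the bound to all of A^p_α, and then to L^p, since P_α may be
dropped inside T_{1/f̄} (`toeplitz_proj`) and is bounded on L^p (the case f = 1 of (iii) ⇒ (iv)).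
The rank one kernel (1-|w|²)^(2+α) K(z,w) K(w,ζ) is the sum of c_j (φ_w(z) conj φ_w(ζ))^j K(z,ζ),
where the c_j are the Taylor coefficients of (1-x)^(2+α). They are absolutely summable and |φ_w| <
1, so the rank one operators attached to f and 1/f̄ are bounded uniformly in w; their norms are the
products in (ii).

(ii) ⇒ (iii): for w at distance |I| from the circle, on the radius to an endpoint of I, |k_w| is at
least a constant times |I|^(-(2+α)/2) on Q_I. -/

lemma measurableSet_disc : MeasurableSet disc := Metric.isOpen_ball.measurableSet

lemma mem_disc {z : ℂ} : z ∈ disc ↔ ‖z‖ < 1 := by simp [disc]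

/-! ### The measure ν_α in polar coordinates -/

lemma measurable_density (α : ℝ) :
    Measurable fun z : ℂ => ENNReal.ofReal ((α + 1) * (1 - ‖z‖ ^ 2) ^ α) := by
  fun_prop

lemma nuA_eq (α : ℝ) : nuA α = (volume.restrict disc).withDensity fun z =>
    ENNReal.ofReal (1 / Real.pi) * ENNReal.ofReal ((α + 1) * (1 - ‖z‖ ^ 2) ^ α) := by
  unfold nuA nu
  rw [withDensity_smul_measure]
  symm
  exact withDensity_smul _ (measurable_density α)

lemma lintegral_nuA (α : ℝ) {F : ℂ → ℝ≥0∞} (hF : Measurable F) :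
    ∫⁻ z, F z ∂(nuA α) = ∫⁻ z in disc, ENNReal.ofReal (1 / Real.pi) *
      ENNReal.ofReal ((α + 1) * (1 - ‖z‖ ^ 2) ^ α) * F z := by
  rw [nuA_eq, lintegral_withDensity_eq_lintegral_mul _ (by fun_prop) hF]
  rfl

lemma nuA_absolutelyContinuous (α : ℝ) : nuA α ≪ volume.restrict disc := by
  rw [nuA_eq]
  exact withDensity_absolutelyContinuous _ _

lemma ae_mem_disc (α : ℝ) : ∀ᵐ z ∂(nuA α), z ∈ disc :=
  (nuA_absolutelyContinuous α).ae_le (ae_restrict_mem measurableSet_disc)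

lemma ae_ne_zero (α : ℝ) : ∀ᵐ z ∂(nuA α), z ≠ 0 :=
  (nuA_absolutelyContinuous α).ae_le (ae_restrict_of_ae (Measure.ae_ne volume 0))

lemma lintegral_radial {α : ℝ} (hα : -1 < α) {r₀ : ℝ} (h0 : 0 ≤ r₀) (h1 : r₀ ≤ 1) :
    ∫⁻ r in Set.Ioo r₀ 1, ENNReal.ofReal (2 * (α + 1) * r * (1 - r ^ 2) ^ α) =
      ENNReal.ofReal ((1 - r₀ ^ 2) ^ (α + 1)) := by
  have hcont : ContinuousOn (fun r : ℝ => -(1 - r ^ 2) ^ (α + 1)) (Set.Icc r₀ 1) := by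
    apply ContinuousOn.neg
    apply ContinuousOn.rpow_const (by fun_prop)
    intro x _
    right; linarith
  have hder : ∀ r ∈ Set.Ioo r₀ 1, HasDerivAt (fun r : ℝ => -(1 - r ^ 2) ^ (α + 1))
      (2 * (α + 1) * r * (1 - r ^ 2) ^ α) r := by
    intro r hr
    have hpos : 0 < 1 - r ^ 2 := by nlinarith [hr.1, hr.2]
    have h := ((((hasDerivAt_id r).pow 2).const_sub 1).rpow_const (p := α + 1)
      (Or.inl (by simpa using hpos.ne'))).neg
    refine h.congr_deriv ?_
    rw [add_sub_cancel_right]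
    change -(-(2 * r ^ (2 - 1) * 1) * (α + 1) * (1 - r ^ 2) ^ α) = _
    ring
  have hnn : ∀ r ∈ Set.Ioo r₀ 1, 0 ≤ 2 * (α + 1) * r * (1 - r ^ 2) ^ α := by
    intro r hr
    have hpos : 0 < 1 - r ^ 2 := by nlinarith [hr.1, hr.2]
    have := hr.1
    have : 0 ≤ (1 - r ^ 2) ^ α := Real.rpow_nonneg hpos.le _
    have h3 : 0 ≤ α + 1 := by linarith
    have h4 : 0 ≤ r := by linarith [hr.1]
    positivity
  -- For α < 0 the integrand is unbounded near 1; its sign and the continuity of the antiderivative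
  -- up to 1, which uses α + 1 > 0, give integrability.
  have hint := intervalIntegral.integrableOn_deriv_of_nonneg hcont hder hnn
  have heq := intervalIntegral.integral_eq_sub_of_hasDerivAt_of_le h1 hcont hder
    ((intervalIntegrable_iff_integrableOn_Ioc_of_le h1).2 hint)
  rw [intervalIntegral.integral_of_le h1, integral_Ioc_eq_integral_Ioo] at heq
  rw [← ofReal_integral_eq_lintegral_ofReal (hint.mono_set Set.Ioo_subset_Ioc_self)
    ((ae_restrict_iff' measurableSet_Ioo).2 (Filter.Eventually.of_forall hnn)), heq]
  congr 1
  rw [one_pow, sub_self, Real.zero_rpow (by linarith)]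
  ring

/-- The measure `ν_α` of a polar rectangle. -/
lemma nuA_polar {α : ℝ} (hα : -1 < α) {r₀ : ℝ} (h0 : 0 ≤ r₀) (h1 : r₀ ≤ 1) {S : Set ℝ}
    (hS : MeasurableSet S) :
    nuA α {z | r₀ < ‖z‖ ∧ ‖z‖ < 1 ∧ z.arg ∈ S} =
      ENNReal.ofReal ((1 - r₀ ^ 2) ^ (α + 1)) *
        (volume (S ∩ Set.Ioo (-Real.pi) Real.pi) * ENNReal.ofReal (1 / (2 * Real.pi))) := by
  have hE : MeasurableSet {z : ℂ | r₀ < ‖z‖ ∧ ‖z‖ < 1 ∧ z.arg ∈ S} :=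
    (measurableSet_lt measurable_const measurable_norm).inter
      ((measurableSet_lt measurable_norm measurable_const).inter (Complex.measurable_arg hS))
  rw [← lintegral_indicator_one hE, lintegral_nuA α (measurable_one.indicator hE),
    ← lintegral_indicator measurableSet_disc, ← Complex.lintegral_comp_polarCoord_symm]
  have hg : ∀ p ∈ polarCoord.target, ENNReal.ofReal p.1 • disc.indicator (fun z =>
      ENNReal.ofReal (1 / Real.pi) * ENNReal.ofReal ((α + 1) * (1 - ‖z‖ ^ 2) ^ α) *
      {z : ℂ | r₀ < ‖z‖ ∧ ‖z‖ < 1 ∧ z.arg ∈ S}.indicator 1 z) (Complex.polarCoord.symm p) =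
      (Set.Ioo r₀ 1).indicator (fun r => ENNReal.ofReal (2 * (α + 1) * r * (1 - r ^ 2) ^ α)) p.1 *
      S.indicator (fun _ => ENNReal.ofReal (1 / (2 * Real.pi))) p.2 := by
    rintro ⟨r, θ⟩ hp
    have hr : 0 < r := hp.1
    have hθ : θ ∈ Set.Ioo (-Real.pi) Real.pi := hp.2
    have hn : ‖Complex.polarCoord.symm (r, θ)‖ = r := by
      rw [Complex.norm_polarCoord_symm, abs_of_pos hr]
    have ha : (Complex.polarCoord.symm (r, θ)).arg = θ := by
      rw [Complex.polarCoord_symm_apply]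
      simpa using Complex.arg_mul_cos_add_sin_mul_I hr ⟨hθ.1, hθ.2.le⟩
    change ENNReal.ofReal r • _ = _
    generalize (Complex.polarCoord.symm (r, θ)) = z at hn ha ⊢
    by_cases hr1 : r < 1
    · rw [Set.indicator_of_mem (by rw [mem_disc, hn]; exact hr1)]
      by_cases hr0 : r₀ < r
      · rw [Set.indicator_of_mem (show r ∈ Set.Ioo r₀ 1 from ⟨hr0, hr1⟩)]
        by_cases hs : θ ∈ S
        · rw [Set.indicator_of_mem (by simpa [hn, ha] using ⟨hr0, hr1, hs⟩), Set.indicator_of_mem hs, hn]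
          simp only [Pi.one_apply, mul_one, smul_eq_mul]
          have hpos : 0 ≤ (1 - r ^ 2) ^ α := Real.rpow_nonneg (by nlinarith) _
          have h3 : 0 ≤ α + 1 := by linarith
          rw [← ENNReal.ofReal_mul (by positivity), ← ENNReal.ofReal_mul (by positivity),
            ← ENNReal.ofReal_mul (by positivity)]
          congr 1
          field_simp
        · rw [Set.indicator_of_notMem (by simp [ha, hs]), Set.indicator_of_notMem hs]
          simp
      · rw [Set.indicator_of_notMem (by simp [hn, hr0]), Set.indicator_of_notMem (s := Set.Ioo r₀ 1)
          (by simp [hr0])]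
        simp
    · rw [Set.indicator_of_notMem (by rw [mem_disc, hn]; exact hr1),
        Set.indicator_of_notMem (s := Set.Ioo r₀ 1) (by simp [hr1])]
      simp
  rw [setLIntegral_congr_fun polarCoord.open_target.measurableSet hg]
  have : polarCoord.target = Set.Ioi (0 : ℝ) ×ˢ Set.Ioo (-Real.pi) Real.pi := rfl
  rw [this, Measure.volume_eq_prod, ← Measure.prod_restrict, lintegral_prod_mul]
  · rw [lintegral_indicator measurableSet_Ioo, Measure.restrict_restrict measurableSet_Ioo,
      Set.inter_eq_left.2 (fun x (hx : x ∈ Set.Ioo r₀ 1) => Set.mem_Ioi.2 (lt_of_le_of_lt h0 hx.1)), lintegral_radial hα h0 h1,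
      lintegral_indicator hS, lintegral_const, Measure.restrict_restrict hS,
      Measure.restrict_apply_univ, mul_comm (volume _)]
  · exact Measurable.aemeasurable (Measurable.indicator (by fun_prop) measurableSet_Ioo)
  · exact Measurable.aemeasurable (Measurable.indicator (by fun_prop) hS)

/-- The condition on θ is 2π-periodic, so the window (-π, π) may be moved to start at 2πa, where the
fractional part is the identity and the set is an interval. -/
lemma volume_fract_lt {a δ : ℝ} (hδ0 : 0 ≤ δ) (hδ1 : δ ≤ 1) :
    volume ({θ : ℝ | Int.fract (θ / (2 * Real.pi) - a) < δ} ∩ Set.Ioo (-Real.pi) Real.pi) =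
      ENNReal.ofReal (2 * Real.pi * δ) := by
  set S : Set ℝ := {θ : ℝ | Int.fract (θ / (2 * Real.pi) - a) < δ} with hSdef
  have hpi := Real.pi_pos
  have hS : MeasurableSet S :=
    measurableSet_lt (Measurable.fract (by fun_prop)) measurable_const
  have hper : Function.Periodic (S.indicator fun _ => (1 : ℝ)) (2 * Real.pi) := by
    intro x
    have : x + 2 * Real.pi ∈ S ↔ x ∈ S := by
      simp only [hSdef, Set.mem_ofPred_eq]
      have : (x + 2 * Real.pi) / (2 * Real.pi) - a = (x / (2 * Real.pi) - a) + 1 := by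
        field_simp; ring
      rw [this, Int.fract_add_one]
    by_cases h : x ∈ S
    · rw [Set.indicator_of_mem h, Set.indicator_of_mem (this.2 h)]
    · rw [Set.indicator_of_notMem h, Set.indicator_of_notMem (fun h' => h (this.1 h'))]
  have h1 := hper.intervalIntegral_add_eq (-Real.pi) (2 * Real.pi * a)
  have e1 : (-Real.pi) + 2 * Real.pi = Real.pi := by ring
  rw [e1, intervalIntegral.integral_of_le (by linarith), intervalIntegral.integral_of_le
    (by linarith), integral_Ioc_eq_integral_Ioo, integral_Ioc_eq_integral_Ioo,
    setIntegral_indicator hS, setIntegral_indicator hS, setIntegral_const, setIntegral_const] at h1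
  simp only [smul_eq_mul, mul_one] at h1
  have h2 : Set.Ioo (2 * Real.pi * a) (2 * Real.pi * a + 2 * Real.pi) ∩ S =
      Set.Ioo (2 * Real.pi * a) (2 * Real.pi * a + 2 * Real.pi * δ) := by
    ext x
    have key : x ∈ Set.Ioo (2 * Real.pi * a) (2 * Real.pi * a + 2 * Real.pi) →
        Int.fract (x / (2 * Real.pi) - a) = x / (2 * Real.pi) - a := by
      intro hx
      rw [Int.fract_eq_self]
      constructor
      · rw [sub_nonneg, le_div_iff₀ (by positivity)]; linarith [hx.1]
      · rw [sub_lt_iff_lt_add, div_lt_iff₀ (by positivity)]; linarith [hx.2]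
    have key2 : x / (2 * Real.pi) - a < δ ↔ x < 2 * Real.pi * a + 2 * Real.pi * δ := by
      rw [sub_lt_iff_lt_add, div_lt_iff₀ (by positivity)]
      constructor <;> intro h <;> linarith
    constructor
    · rintro ⟨hx, hxs⟩
      refine ⟨hx.1, key2.1 ?_⟩
      rw [← key hx]; exact hxs
    · intro hx
      have hx' : x ∈ Set.Ioo (2 * Real.pi * a) (2 * Real.pi * a + 2 * Real.pi) :=
        ⟨hx.1, by nlinarith [hx.2]⟩
      refine ⟨hx', ?_⟩
      change Int.fract _ < δ
      rw [key hx']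
      exact key2.2 hx.2
  rw [h2, measureReal_def, measureReal_def, Real.volume_Ioo] at h1
  rw [Set.inter_comm, ← ENNReal.ofReal_toReal (a := volume (_ ∩ S)), h1]
  · rw [ENNReal.toReal_ofReal (by nlinarith)]
    congr 1; ring
  · exact ((measure_mono Set.inter_subset_left).trans_lt (by simp)).ne

/-! ### Polar rectangles and their halving -/

/-- The position of a point on the circle, in turns. -/
def turn (z : ℂ) : ℝ := z.arg / (2 * Real.pi)

/-- The polar rectangle of height `ε` over the half-open arc of normalized length `δ` that starts at
the turn `a`. -/
def box (a δ ε : ℝ) : Set ℂ := {z | 1 - ε < ‖z‖ ∧ ‖z‖ < 1 ∧ Int.fract (turn z - a) < δ}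

lemma measurable_turn : Measurable turn := Complex.measurable_arg.div_const _

lemma measurableSet_box (a δ ε : ℝ) : MeasurableSet (box a δ ε) :=
  (measurableSet_lt measurable_const measurable_norm).inter
    ((measurableSet_lt measurable_norm measurable_const).inter
      (measurableSet_lt ((measurable_turn.sub_const a).fract) measurable_const))

lemma nuA_box {α : ℝ} (hα : -1 < α) (a : ℝ) {δ ε : ℝ} (hδ0 : 0 ≤ δ) (hδ1 : δ ≤ 1)
    (hε0 : 0 ≤ ε) (hε1 : ε ≤ 1) :
    nuA α (box a δ ε) = ENNReal.ofReal ((2 * ε - ε ^ 2) ^ (α + 1) * δ) := by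
  have h := nuA_polar hα (r₀ := 1 - ε) (by linarith) (by linarith)
    (S := {θ : ℝ | Int.fract (θ / (2 * Real.pi) - a) < δ})
    (measurableSet_lt (Measurable.fract (by fun_prop)) measurable_const)
  rw [volume_fract_lt hδ0 hδ1] at h
  have hpi := Real.pi_pos
  have h0 : 0 ≤ (2 * ε - ε ^ 2) := by nlinarith
  have e : (1 - (1 - ε) ^ 2) = 2 * ε - ε ^ 2 := by ring
  rw [e, ← ENNReal.ofReal_mul (by positivity), ← ENNReal.ofReal_mul (Real.rpow_nonneg h0 _)] at h
  refine Eq.trans h ?_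
  congr 1
  field_simp

instance isProbabilityMeasure_nuA {α : ℝ} [h : Fact (-1 < α)] : IsProbabilityMeasure (nuA α) := by
  constructor
  have h1 := nuA_box h.out 0 zero_le_one le_rfl zero_le_one le_rfl
  -- `box 0 1 1` is the disc without its centre.
  have h2 : nuA α Set.univ = nuA α (box 0 1 1) := by
    apply measure_congr
    filter_upwards [ae_mem_disc α, ae_ne_zero α] with z hz hz0
    apply propext
    refine ⟨fun _ => ⟨by simpa using hz0, mem_disc.1 hz, Int.fract_lt_one _⟩, fun _ => trivial⟩
  rw [h2, h1]
  norm_num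

lemma fract_lt_split (x : ℝ) {δ : ℝ} (h0 : 0 ≤ δ) :
    Int.fract x < δ ↔ Int.fract x < δ / 2 ∨ Int.fract (x - δ / 2) < δ / 2 := by
  by_cases h : Int.fract x < δ / 2
  · simp only [h, true_or, iff_true]; linarith
  · have e : Int.fract (x - δ / 2) = Int.fract x - δ / 2 := by
      rw [Int.fract_eq_iff]
      refine ⟨by linarith, by linarith [Int.fract_lt_one x], ⌊x⌋, ?_⟩
      linarith [Int.floor_add_fract x]
    rw [e]
    simp only [h, false_or]
    constructor <;> intro h' <;> linarith

lemma fract_lt_disjoint (x : ℝ) {δ : ℝ} (h1 : δ ≤ 1) (h : Int.fract x < δ / 2) :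
    ¬ Int.fract (x - δ / 2) < δ / 2 := by
  have e : Int.fract (x - δ / 2) = Int.fract x - δ / 2 + 1 := by
    rw [Int.fract_eq_iff]
    refine ⟨by linarith [Int.fract_nonneg x], by linarith [Int.fract_lt_one x], ⌊x⌋ - 1, ?_⟩
    push_cast
    linarith [Int.floor_add_fract x]
  rw [e]
  linarith [Int.fract_nonneg x]

lemma box_split (a : ℝ) {δ : ℝ} (ε : ℝ) (h0 : 0 ≤ δ) :
    box a δ ε = box a (δ / 2) ε ∪ box (a + δ / 2) (δ / 2) ε := by
  ext z
  have := fract_lt_split (turn z - a) h0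
  rw [sub_sub] at this
  simp only [box, Set.mem_ofPred_eq, Set.mem_union, this]
  tauto

lemma box_disjoint (a : ℝ) {δ : ℝ} (ε : ℝ) (h1 : δ ≤ 1) :
    Disjoint (box a (δ / 2) ε) (box (a + δ / 2) (δ / 2) ε) := by
  rw [Set.disjoint_left]
  intro z hz hz'
  have := fract_lt_disjoint (turn z - a) h1 hz.2.2
  rw [sub_sub] at this
  exact this hz'.2.2

lemma box_mono_height (a δ : ℝ) {ε ε' : ℝ} (h : ε ≤ ε') : box a δ ε ⊆ box a δ ε' :=
  fun _ hz => ⟨by linarith [hz.1], hz.2⟩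

/-- The part of the box over an arc at distance at least half its height from the circle. -/
def topHalf (a δ ε : ℝ) : Set ℂ := box a δ ε \ box a δ (ε / 2)

lemma measurableSet_topHalf (a δ ε : ℝ) : MeasurableSet (topHalf a δ ε) :=
  (measurableSet_box _ _ _).diff (measurableSet_box _ _ _)

lemma topHalf_split (a : ℝ) {δ : ℝ} (ε : ℝ) (h0 : 0 ≤ δ) (h1 : δ ≤ 1) :
    topHalf a (δ / 2) ε ∪ topHalf (a + δ / 2) (δ / 2) ε ⊆ topHalf a δ ε := by
  have hd := box_disjoint a (ε := ε) h1
  have hs : ∀ {b c : ℝ}, box b c (ε / 2) ⊆ box b c ε ∨ ε < 0 := by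
    intro b c
    by_cases hε : ε < 0
    · exact Or.inr hε
    · exact Or.inl (box_mono_height _ _ (by linarith))
  -- For negative ε halving increases the height, so monotonicity fails, but then the boxes of
  -- height ε are empty.
  have hneg : ε < 0 → ∀ b c, box b c ε = ∅ := by
    intro hε b c
    ext z
    simp only [Set.mem_empty_iff_false, iff_false]
    intro hz
    linarith [hz.1, hz.2.1]
  rw [Set.disjoint_left] at hd
  unfold topHalf
  rw [box_split a ε h0, box_split a (ε / 2) h0]
  rintro z (⟨hz, hz'⟩ | ⟨hz, hz'⟩)
  · refine ⟨Or.inl hz, ?_⟩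
    rintro (h | h)
    · exact hz' h
    · rcases hs (b := a + δ / 2) (c := δ / 2) with h'' | h''
      · exact hd hz (h'' h)
      · rw [hneg h''] at hz; exact hz
  · refine ⟨Or.inr hz, ?_⟩
    rintro (h | h)
    · rcases hs (b := a) (c := δ / 2) with h'' | h''
      · exact hd (h'' h) hz
      · rw [hneg h''] at hz; exact hz
    · exact hz' h

/-! ### Carleson boxes as polar rectangles, and their measure -/

lemma turn_angle {r θ : ℝ} (hr : 0 < r) :
    ∃ n : ℤ, turn (r * Complex.exp (θ * Complex.I)) = θ / (2 * Real.pi) + n := by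
  unfold turn
  rw [Complex.arg_real_mul _ hr, Complex.arg_exp_mul_I]
  refine ⟨-toIocDiv Real.two_pi_pos (-Real.pi) θ, ?_⟩
  have := toIocMod_add_toIocDiv_zsmul Real.two_pi_pos (-Real.pi) θ
  have hpi := Real.pi_pos
  rw [zsmul_eq_mul] at this
  field_simp
  push_cast
  linarith

lemma eq_norm_mul_exp_turn (z : ℂ) (a : ℝ) :
    z = ‖z‖ * Complex.exp ((2 * Real.pi * (a + Int.fract (turn z - a)) : ℝ) * Complex.I) := by
  have h1 : 2 * Real.pi * (a + Int.fract (turn z - a)) =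
      z.arg - ⌊turn z - a⌋ * (2 * Real.pi) := by
    have := Int.floor_add_fract (turn z - a)
    have h2 : turn z * (2 * Real.pi) = z.arg := by
      unfold turn
      field_simp
    rw [← h2]
    have h3 : Int.fract (turn z - a) = turn z - a - ⌊turn z - a⌋ := by linarith
    rw [h3]; ring
  rw [h1]
  push_cast
  rw [sub_mul, Complex.exp_sub]
  have : Complex.exp ((⌊turn z - a⌋ : ℂ) * (2 * Real.pi) * Complex.I) = 1 := by
    rw [mul_assoc]
    exact Complex.exp_int_mul_two_pi_mul_I _
  rw [this, div_one]
  exact (Complex.norm_mul_exp_arg_mul_I z).symm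

/-- For θ in [a, b] the number (θ - a)/(2π) is nonnegative, so taking its fractional part can only
decrease it; this also covers the full circle. The arc is closed, hence the non-strict inequality,
in contrast to `box`. -/
lemma carlesonBox_eq {a b : ℝ} (hab : a < b) (hb : b ≤ a + 2 * Real.pi) :
    carlesonBox a b = {z | 1 - (b - a) / (2 * Real.pi) < ‖z‖ ∧ ‖z‖ < 1 ∧
      Int.fract (turn z - a / (2 * Real.pi)) ≤ (b - a) / (2 * Real.pi)} := by
  have hpi := Real.pi_pos
  have hδ0 : 0 < (b - a) / (2 * Real.pi) := div_pos (by linarith) (by positivity)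
  have hδ1 : (b - a) / (2 * Real.pi) ≤ 1 := by
    rw [div_le_one (by positivity)]; linarith
  ext z
  constructor
  · rintro ⟨r, θ, hr0, hr1, hθ0, hθ1, rfl⟩
    have hr : 0 < r := by linarith
    have hn : ‖(r : ℂ) * Complex.exp (θ * Complex.I)‖ = r := by
      rw [norm_mul, Complex.norm_exp_ofReal_mul_I, mul_one, Complex.norm_real, Real.norm_eq_abs,
        abs_of_pos hr]
    refine ⟨by rw [hn]; exact hr0, by rw [hn]; exact hr1, ?_⟩
    obtain ⟨n, hn⟩ := turn_angle (θ := θ) hr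
    have e : θ / (2 * Real.pi) + n - a / (2 * Real.pi) = (θ - a) / (2 * Real.pi) + n := by ring
    rw [hn, e, Int.fract_add_intCast]
    have h0 : 0 ≤ (θ - a) / (2 * Real.pi) := div_nonneg (by linarith) (by positivity)
    have h1 : (θ - a) / (2 * Real.pi) ≤ (b - a) / (2 * Real.pi) := by gcongr
    refine le_trans ?_ h1
    have := Int.floor_nonneg.2 h0
    have h3 : (0 : ℝ) ≤ ⌊(θ - a) / (2 * Real.pi)⌋ := by exact_mod_cast this
    linarith [Int.floor_add_fract ((θ - a) / (2 * Real.pi))]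
  · rintro ⟨h1, h2, h3⟩
    refine ⟨‖z‖, 2 * Real.pi * (a / (2 * Real.pi) + Int.fract (turn z - a / (2 * Real.pi))), h1, h2,
      ?_, ?_, eq_norm_mul_exp_turn z _⟩
    · have := Int.fract_nonneg (turn z - a / (2 * Real.pi))
      have e : a = 2 * Real.pi * (a / (2 * Real.pi)) := by field_simp
      calc a = 2 * Real.pi * (a / (2 * Real.pi)) := e
        _ ≤ _ := by gcongr; linarith
    · calc 2 * Real.pi * (a / (2 * Real.pi) + Int.fract (turn z - a / (2 * Real.pi))) ≤
          2 * Real.pi * (a / (2 * Real.pi) + (b - a) / (2 * Real.pi)) := by gcongr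
        _ = b := by field_simp; ring

lemma measurableSet_carlesonBox {a b : ℝ} (hab : a < b) (hb : b ≤ a + 2 * Real.pi) :
    MeasurableSet (carlesonBox a b) := by
  rw [carlesonBox_eq hab hb]
  exact (measurableSet_lt measurable_const measurable_norm).inter
    ((measurableSet_lt measurable_norm measurable_const).inter
      (measurableSet_le ((measurable_turn.sub_const _).fract) measurable_const))

lemma box_subset_carlesonBox (a : ℝ) {δ : ℝ} (h0 : 0 < δ) (h1 : δ ≤ 1) :
    box a δ δ ⊆ carlesonBox (2 * Real.pi * a) (2 * Real.pi * (a + δ)) := by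
  have hpi := Real.pi_pos
  rw [carlesonBox_eq (by nlinarith) (by nlinarith)]
  intro z hz
  have e1 : (2 * Real.pi * (a + δ) - 2 * Real.pi * a) / (2 * Real.pi) = δ := by field_simp; ring
  have e2 : 2 * Real.pi * a / (2 * Real.pi) = a := by field_simp
  simp only [Set.mem_ofPred_eq, e1, e2]
  exact ⟨hz.1, hz.2.1, hz.2.2.le⟩

lemma box_subset_carlesonBox' {a b : ℝ} (hab : a < b) (hb : b ≤ a + 2 * Real.pi) :
    box (a / (2 * Real.pi)) ((b - a) / (2 * Real.pi)) ((b - a) / (2 * Real.pi)) ⊆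
      carlesonBox a b := by
  rw [carlesonBox_eq hab hb]
  exact fun z hz => ⟨hz.1, hz.2.1, hz.2.2.le⟩

/-- The closed arc lies in every longer half-open arc, whose box has a known measure; the length
then decreases to δ. The power comes from 2δ - δ² ≤ 2δ. -/
lemma nuA_carlesonBox_le {α : ℝ} (hα : -1 < α) (a : ℝ) {δ : ℝ} (h0 : 0 < δ) (h1 : δ ≤ 1) :
    nuA α (carlesonBox (2 * Real.pi * a) (2 * Real.pi * (a + δ))) ≤
      ENNReal.ofReal (2 ^ (α + 1) * δ ^ (α + 2)) := by
  have hpi := Real.pi_pos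
  have hp : 0 ≤ α + 1 := by linarith
  have key : ∀ η ∈ Set.Ioc δ 1, nuA α (carlesonBox (2 * Real.pi * a) (2 * Real.pi * (a + δ))) ≤
      ENNReal.ofReal ((2 * δ - δ ^ 2) ^ (α + 1) * η) := by
    intro η hη
    rw [← nuA_box hα a (by linarith [hη.1]) hη.2 h0.le h1]
    apply measure_mono
    rw [carlesonBox_eq (by nlinarith) (by nlinarith)]
    have e1 : (2 * Real.pi * (a + δ) - 2 * Real.pi * a) / (2 * Real.pi) = δ := by field_simp; ring
    have e2 : 2 * Real.pi * a / (2 * Real.pi) = a := by field_simp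
    rw [e1, e2]
    exact fun z hz => ⟨hz.1, hz.2.1, hz.2.2.trans_lt hη.1⟩
  have hb : (2 * δ - δ ^ 2) ^ (α + 1) ≤ 2 ^ (α + 1) * δ ^ (α + 1) := by
    rw [← Real.mul_rpow (by norm_num) h0.le]
    exact Real.rpow_le_rpow (by nlinarith) (by nlinarith) hp
  have e3 : δ ^ (α + 2) = δ ^ (α + 1) * δ := by
    rw [← Real.rpow_add_one h0.ne']; ring_nf
  have hfin : ENNReal.ofReal ((2 * δ - δ ^ 2) ^ (α + 1) * δ) ≤
      ENNReal.ofReal (2 ^ (α + 1) * δ ^ (α + 2)) := by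
    apply ENNReal.ofReal_le_ofReal
    rw [e3, ← mul_assoc]
    gcongr
  refine le_trans ?_ hfin
  -- At δ = 1 no longer arc is available, but the half-open arc of length 1 is already the whole
  -- circle.
  rcases h1.eq_or_lt with rfl | h1
  · rw [← nuA_box hα a zero_le_one le_rfl zero_le_one le_rfl]
    apply measure_mono
    rw [carlesonBox_eq (by nlinarith) (by nlinarith)]
    have e1 : (2 * Real.pi * (a + 1) - 2 * Real.pi * a) / (2 * Real.pi) = 1 := by field_simp; ring
    rw [e1]
    exact fun z hz => ⟨hz.1, hz.2.1, Int.fract_lt_one _⟩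
  · have ht : Filter.Tendsto (fun η : ℝ => ENNReal.ofReal ((2 * δ - δ ^ 2) ^ (α + 1) * η))
        (nhdsWithin δ (Set.Ioi δ)) (nhds (ENNReal.ofReal ((2 * δ - δ ^ 2) ^ (α + 1) * δ))) := by
      apply Filter.Tendsto.mono_left _ nhdsWithin_le_nhds
      exact (ENNReal.continuous_ofReal.comp (by fun_prop)).tendsto δ
    exact ge_of_tendsto ht (Filter.mem_of_superset (Ioc_mem_nhdsGT h1) key)

/-- The factor 3/4 comes from δ - δ²/4 ≤ (3/4)(2δ - δ²) for δ ≤ 1: halving the height multiplies the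
radial part by at most (3/4)^(α+1). -/
lemma nuA_topHalf_ge {α : ℝ} (hα : -1 < α) (a : ℝ) {δ : ℝ} (h0 : 0 < δ) (h1 : δ ≤ 1) :
    ENNReal.ofReal ((1 - (3 / 4) ^ (α + 1)) * δ ^ (α + 2)) ≤ nuA α (topHalf a δ δ) := by
  have : Fact (-1 < α) := ⟨hα⟩
  have hp : 0 < α + 1 := by linarith
  unfold topHalf
  rw [measure_sdiff (box_mono_height _ _ (by linarith)) (measurableSet_box _ _ _).nullMeasurableSet
    (measure_ne_top _ _), nuA_box hα a h0.le h1 h0.le h1,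
    nuA_box hα a h0.le h1 (by linarith) (by linarith), ← ENNReal.ofReal_sub _
    (mul_nonneg (Real.rpow_nonneg (by nlinarith) _) h0.le)]
  apply ENNReal.ofReal_le_ofReal
  have e3 : δ ^ (α + 2) = δ ^ (α + 1) * δ := by
    rw [← Real.rpow_add_one h0.ne']; ring_nf
  have hb : (2 * (δ / 2) - (δ / 2) ^ 2) ^ (α + 1) ≤
      (3 / 4) ^ (α + 1) * (2 * δ - δ ^ 2) ^ (α + 1) := by
    rw [← Real.mul_rpow (by norm_num) (by nlinarith)]
    exact Real.rpow_le_rpow (by nlinarith) (by nlinarith) hp.le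
  have hc : δ ^ (α + 1) ≤ (2 * δ - δ ^ 2) ^ (α + 1) :=
    Real.rpow_le_rpow h0.le (by nlinarith) hp.le
  have hd : (3 / 4 : ℝ) ^ (α + 1) ≤ 1 := Real.rpow_le_one (by norm_num) (by norm_num) hp.le
  rw [e3, ← sub_mul, ← mul_assoc]
  gcongr
  nlinarith [mul_le_mul_of_nonneg_left hc (sub_nonneg.2 hd)]

/-! ### Top-heavy measures and their decay towards the circle -/

/-- `s` gives a fixed portion of every box to the top half of the box. -/
def TopHeavy (s : Measure ℂ) (K : ℝ) : Prop :=
  ∀ a δ : ℝ, 0 < δ → δ ≤ 1 → s (box a δ δ) ≤ ENNReal.ofReal K * s (topHalf a δ δ)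

/-- Halving the arc k times cuts the flat box into boxes as high as they are long, to which the
hypothesis applies; the top halves of the pieces are disjoint and lie in the top half of the whole.
-/
lemma TopHeavy.flat {s : Measure ℂ} {K : ℝ} (h : TopHeavy s K) (k : ℕ) :
    ∀ a δ : ℝ, 0 < δ → δ ≤ 1 →
      s (box a δ (δ / 2 ^ k)) ≤ ENNReal.ofReal K * s (topHalf a δ (δ / 2 ^ k)) := by
  induction k with
  | zero => simpa [TopHeavy] using h
  | succ k ih =>
    intro a δ h0 h1
    have e : δ / 2 ^ (k + 1) = δ / 2 / 2 ^ k := by rw [pow_succ]; field_simp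
    have hd : Disjoint (topHalf a (δ / 2) (δ / 2 ^ (k + 1)))
        (topHalf (a + δ / 2) (δ / 2) (δ / 2 ^ (k + 1))) :=
      (box_disjoint a _ h1).mono Set.sdiff_subset Set.sdiff_subset
    calc s (box a δ (δ / 2 ^ (k + 1)))
        ≤ s (box a (δ / 2) (δ / 2 ^ (k + 1))) + s (box (a + δ / 2) (δ / 2) (δ / 2 ^ (k + 1))) := by
          rw [box_split a _ h0.le]; exact measure_union_le _ _
      _ ≤ ENNReal.ofReal K * s (topHalf a (δ / 2) (δ / 2 ^ (k + 1))) +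
          ENNReal.ofReal K * s (topHalf (a + δ / 2) (δ / 2) (δ / 2 ^ (k + 1))) := by
          rw [e]
          exact add_le_add (ih _ _ (by linarith) (by linarith)) (ih _ _ (by linarith) (by linarith))
      _ = ENNReal.ofReal K * s (topHalf a (δ / 2) (δ / 2 ^ (k + 1)) ∪
          topHalf (a + δ / 2) (δ / 2) (δ / 2 ^ (k + 1))) := by
          rw [measure_union hd (measurableSet_topHalf _ _ _), mul_add]
      _ ≤ _ := by gcongr; exact topHalf_split a _ h0.le h1

/-- By `TopHeavy.flat`, each halving of the height removes a top half that carries at least the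
fraction 1/K of the current mass. -/
lemma TopHeavy.decay {s : Measure ℂ} [IsFiniteMeasure s] {K : ℝ} (hK : 1 ≤ K) (h : TopHeavy s K)
    {a δ : ℝ} (h0 : 0 < δ) (h1 : δ ≤ 1) (k : ℕ) :
    s (box a δ (δ / 2 ^ k)) ≤ ENNReal.ofReal ((1 - 1 / K) ^ k) * s (box a δ δ) := by
  have hK0 : 0 < K := by linarith
  have hr : 0 ≤ 1 - 1 / K := by rw [sub_nonneg, div_le_one hK0]; exact hK
  induction k with
  | zero => simp
  | succ k ih =>
    have hf := h.flat k a δ h0 h1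
    have hpos : 0 < δ / 2 ^ k := by positivity
    have e : δ / 2 ^ (k + 1) = δ / 2 ^ k / 2 := by rw [pow_succ]; field_simp
    unfold topHalf at hf
    rw [measure_sdiff (box_mono_height _ _ (by linarith)) (measurableSet_box _ _ _).nullMeasurableSet
      (measure_ne_top _ _), ← e] at hf
    have hle : s (box a δ (δ / 2 ^ (k + 1))) ≤ s (box a δ (δ / 2 ^ k)) :=
      measure_mono (box_mono_height _ _ (by rw [e]; linarith))
    have hstep : s (box a δ (δ / 2 ^ (k + 1))) ≤
        ENNReal.ofReal (1 - 1 / K) * s (box a δ (δ / 2 ^ k)) := by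
      have f1 : s (box a δ (δ / 2 ^ (k + 1))) ≠ ⊤ := measure_ne_top _ _
      have f2 : s (box a δ (δ / 2 ^ k)) ≠ ⊤ := measure_ne_top _ _
      generalize s (box a δ (δ / 2 ^ (k + 1))) = x at *
      generalize s (box a δ (δ / 2 ^ k)) = y at *
      lift x to NNReal using f1
      lift y to NNReal using f2
      have hxy : x ≤ y := by exact_mod_cast hle
      rw [← ENNReal.coe_sub, ENNReal.ofReal, ← ENNReal.coe_mul, ENNReal.coe_le_coe,
        ← NNReal.coe_le_coe, NNReal.coe_mul, NNReal.coe_sub hxy, Real.coe_toNNReal _ hK0.le] at hf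
      rw [ENNReal.ofReal, ← ENNReal.coe_mul, ENNReal.coe_le_coe,
        ← NNReal.coe_le_coe, NNReal.coe_mul, Real.coe_toNNReal _ hr]
      have : (y : ℝ) / K ≤ y - x := by rw [div_le_iff₀ hK0]; linarith
      have e2 : (1 - 1 / K) * (y : ℝ) = y - y / K := by ring
      rw [e2]; linarith
    calc _ ≤ _ := hstep
      _ ≤ ENNReal.ofReal (1 - 1 / K) * (ENNReal.ofReal ((1 - 1 / K) ^ k) * s (box a δ δ)) := by
        gcongr
      _ = _ := by rw [← mul_assoc, ← ENNReal.ofReal_mul hr, pow_succ, mul_comm (1 - 1 / K)]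

/-! ### Half-overlapping dyadic boxes -/

/-- Indices of the boxes over half-overlapping dyadic arcs. -/
abbrev Index := Σ n : ℕ, Fin (2 ^ (n + 1))

/-- The box with a given index. -/
def dbox (i : Index) : Set ℂ := box ((i.2 : ℕ) / 2 ^ (i.1 + 1)) (1 / 2 ^ i.1) (1 / 2 ^ i.1)

lemma measurableSet_dbox (i : Index) : MeasurableSet (dbox i) := measurableSet_box _ _ _

/-- The annulus containing the boxes of a given generation. -/
def annulus (n : ℕ) : Set ℂ := {z | 1 - 1 / 2 ^ n < ‖z‖ ∧ ‖z‖ < 1}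

lemma measurableSet_annulus (n : ℕ) : MeasurableSet (annulus n) :=
  (measurableSet_lt measurable_const measurable_norm).inter
      (measurableSet_lt measurable_norm measurable_const)

/-- With M = 2^(n+1), the arcs have length 2/M and start at multiples of 1/M, so one that contains x
has index congruent to ⌊xM⌋ or ⌊xM⌋ - 1 modulo M. -/
lemma card_fract_le_two (x : ℝ) (n : ℕ) :
    (Finset.univ.filter fun j : Fin (2 ^ (n + 1)) =>
      Int.fract (x - (j : ℕ) / 2 ^ (n + 1)) < 1 / 2 ^ n).card ≤ 2 := by
  classical
  set M : ℤ := 2 ^ (n + 1) with hM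
  have hM0 : 0 < M := by positivity
  have hMr : (M : ℝ) = 2 ^ (n + 1) := by rw [hM]; push_cast; rfl
  set u : ℤ := ⌊x * M⌋ with hu
  have hsub : ∀ j ∈ (Finset.univ.filter fun j : Fin (2 ^ (n + 1)) =>
      Int.fract (x - (j : ℕ) / 2 ^ (n + 1)) < 1 / 2 ^ n),
      (((j : ℕ) : ℤ)) ∈ ({u % M, (u - 1) % M} : Finset ℤ) := by
    intro j hj
    have hj' := (Finset.mem_filter.1 hj).2
    rw [← hMr] at hj'
    set l := ⌊x - (j : ℕ) / (M : ℝ)⌋ with hl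
    have h1 := Int.floor_add_fract (x - (j : ℕ) / (M : ℝ))
    have h2 := Int.fract_nonneg (x - (j : ℕ) / (M : ℝ))
    have hMp : (0 : ℝ) < M := by exact_mod_cast hM0
    rw [← hl] at h1
    set t := Int.fract (x - (j : ℕ) / (M : ℝ))
    have h3 : t * M < 2 := by
      have : (1 : ℝ) / 2 ^ n = 2 / M := by rw [hMr, pow_succ]; field_simp
      rw [this, lt_div_iff₀ hMp] at hj'
      exact hj'
    have h4 : x * M = ((j : ℕ) + l * M : ℤ) + t * M := by
      push_cast
      have : x = (j : ℕ) / (M : ℝ) + l + t := by linarith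
      rw [this]; field_simp
    have h5 : 0 ≤ t * M := by positivity
    have hjM : ((j : ℕ) : ℤ) < M := by
      rw [hM]; exact_mod_cast j.2
    have hfl : u = (j : ℕ) + l * M ∨ u = (j : ℕ) + l * M + 1 := by
      by_cases h6 : t * M < 1
      · left
        rw [hu, Int.floor_eq_iff]; constructor <;> linarith
      · right
        rw [hu, Int.floor_eq_iff]; push_cast at h4 ⊢; constructor <;> linarith
    simp only [Finset.mem_insert, Finset.mem_singleton]
    rcases hfl with h | h
    · left
      rw [h, Int.add_mul_emod_self_right, Int.emod_eq_of_lt (by positivity) hjM]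
    · right
      rw [h, add_sub_cancel_right, Int.add_mul_emod_self_right,
        Int.emod_eq_of_lt (by positivity) hjM]
  refine (Finset.card_le_card_of_injOn (t := {u % M, (u - 1) % M})
    (fun j : Fin (2 ^ (n + 1)) => ((j : ℕ) : ℤ)) (fun j hj => Finset.mem_coe.2 (hsub j (Finset.mem_coe.1 hj))) ?_).trans Finset.card_le_two
  intro a _ b _ hab
  have hab' : ((a : ℕ) : ℤ) = ((b : ℕ) : ℤ) := hab
  exact Fin.ext (by exact_mod_cast hab')

lemma sum_indicator_dbox_le (n : ℕ) (z : ℂ) :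
    ∑ j : Fin (2 ^ (n + 1)), (dbox ⟨n, j⟩).indicator (1 : ℂ → ℝ≥0∞) z ≤
      2 * (annulus n).indicator 1 z := by
  classical
  by_cases hz : z ∈ annulus n
  · rw [Set.indicator_of_mem hz]
    simp only [Set.indicator_apply, Pi.one_apply, mul_one]
    rw [Finset.sum_boole]
    have : (Finset.univ.filter fun j : Fin (2 ^ (n + 1)) => z ∈ dbox ⟨n, j⟩).card ≤ 2 := by
      refine le_trans (Finset.card_le_card ?_) (card_fract_le_two (turn z) n)
      intro j hj
      exact Finset.mem_filter.2 ⟨Finset.mem_univ _, (Finset.mem_filter.1 hj).2.2.2⟩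
    exact_mod_cast this
  · rw [Finset.sum_eq_zero]
    · exact zero_le
    · intro j _
      exact Set.indicator_of_notMem (fun h => hz ⟨h.1, h.2.1⟩) _

/-- The arc starts at the last grid point not after x. Then x lies in its first half, and a further
advance by at most half the arc length stays inside. This is why the arcs have to overlap by halves.
-/
lemma exists_common_arc {x y D : ℝ} {n : ℕ} (hD0 : 0 ≤ D) (hD : D ≤ 1 / 2 ^ (n + 1)) {k : ℤ}
    (hy : y = x + D + k) : ∃ j : Fin (2 ^ (n + 1)),
      Int.fract (x - (j : ℕ) / 2 ^ (n + 1)) < 1 / 2 ^ n ∧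
      Int.fract (y - (j : ℕ) / 2 ^ (n + 1)) < 1 / 2 ^ n := by
  set M : ℝ := 2 ^ (n + 1) with hM
  have hMp : 0 < M := by positivity
  have h2M : (1 : ℝ) / 2 ^ n = 1 / M + 1 / M := by rw [hM, pow_succ]; field_simp; norm_num
  have h1n : (1 : ℝ) / 2 ^ n ≤ 1 := by
    rw [div_le_one (by positivity)]; exact one_le_pow₀ (by norm_num)
  set t := Int.fract x
  have ht0 : 0 ≤ t := Int.fract_nonneg x
  have ht1 : t < 1 := Int.fract_lt_one x
  have hx := Int.floor_add_fract x
  set j := ⌊t * M⌋₊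
  have hj1 : (j : ℝ) ≤ t * M := Nat.floor_le (by positivity)
  have hj2 : t * M < j + 1 := Nat.lt_floor_add_one _
  have hjM : j < 2 ^ (n + 1) := by
    have : (j : ℝ) < (2 : ℝ) ^ (n + 1) := lt_of_le_of_lt hj1 (by rw [← hM]; nlinarith)
    exact_mod_cast this
  have h3 : 0 ≤ t - j / M := by rw [sub_nonneg, div_le_iff₀ hMp]; exact hj1
  have h4 : t - j / M < 1 / M := by
    rw [sub_lt_iff_lt_add, ← add_div, lt_div_iff₀ hMp]; linarith
  have hMi : 0 < 1 / M := by positivity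
  refine ⟨⟨j, hjM⟩, ?_, ?_⟩
  · have : Int.fract (x - j / M) = t - j / M := by
      rw [Int.fract_eq_iff]
      exact ⟨h3, by linarith, ⌊x⌋, by linarith⟩
    simp only
    rw [this]; linarith
  · have : Int.fract (y - j / M) = t - j / M + D := by
      rw [Int.fract_eq_iff]
      exact ⟨by linarith, by linarith, ⌊x⌋ + k, by push_cast; linarith⟩
    simp only
    rw [this]; linarith

/-- Radial projection of u to the circle moves it by 1 - |u| ≤ |1 - u|, so the projected point is
within 2|1 - u| of 1; Jordan's inequality for the sine compares that chord with the angle. -/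
lemma norm_one_sub_ge_arg (u : ℂ) (hu : ‖u‖ < 1) : |u.arg| / Real.pi ≤ ‖1 - u‖ := by
  have hpi := Real.pi_pos
  have h1 : ‖1 - Complex.exp (u.arg * Complex.I)‖ ≤ 2 * ‖1 - u‖ := by
    have e : Complex.exp (u.arg * Complex.I) - u = ((1 - ‖u‖ : ℝ) : ℂ) *
        Complex.exp (u.arg * Complex.I) := by
      conv_lhs => rw [← Complex.norm_mul_exp_arg_mul_I u]
      have : (((‖u‖ : ℂ) * Complex.exp (u.arg * Complex.I)).arg : ℂ) = u.arg := by
        rw [Complex.norm_mul_exp_arg_mul_I]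
      rw [this]
      push_cast; ring
    have h2 : ‖Complex.exp (u.arg * Complex.I) - u‖ ≤ ‖1 - u‖ := by
      rw [e, norm_mul, Complex.norm_exp_ofReal_mul_I, mul_one, Complex.norm_real, Real.norm_eq_abs,
        abs_of_nonneg (by linarith)]
      have := norm_sub_norm_le (1 : ℂ) u
      rwa [norm_one] at this
    calc ‖1 - Complex.exp (u.arg * Complex.I)‖
        = ‖(1 - u) - (Complex.exp (u.arg * Complex.I) - u)‖ := by ring_nf
      _ ≤ ‖1 - u‖ + ‖Complex.exp (u.arg * Complex.I) - u‖ := norm_sub_le _ _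
      _ ≤ _ := by linarith
  have h3 : 2 / Real.pi * |u.arg| ≤ ‖1 - Complex.exp (u.arg * Complex.I)‖ := by
    have h4 := Complex.norm_exp_I_mul_ofReal_sub_one u.arg
    rw [mul_comm, norm_sub_rev] at h4
    rw [h4, Real.norm_eq_abs, abs_mul, abs_two]
    have h5 := Real.mul_abs_le_abs_sin (x := u.arg / 2)
      (by rw [abs_div, abs_two]; linarith [Complex.abs_arg_le_pi u])
    rw [abs_div, abs_two] at h5
    calc _ = 2 * (2 / Real.pi * (|u.arg| / 2)) := by ring
      _ ≤ _ := by gcongr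
  calc |u.arg| / Real.pi = (2 / Real.pi * |u.arg|) / 2 := by ring
    _ ≤ _ := by linarith

lemma exists_turn_mul_conj {z w : ℂ} (hz : z ≠ 0) (hw : w ≠ 0) :
    ∃ k : ℤ, turn (z * conj w) = turn z - turn w + k := by
  have hpi := Real.pi_pos
  have e : z * conj w = ((‖z‖ * ‖w‖ : ℝ) : ℂ) *
      Complex.exp ((z.arg - w.arg : ℝ) * Complex.I) := by
    conv_lhs => rw [← Complex.norm_mul_exp_arg_mul_I z, ← Complex.norm_mul_exp_arg_mul_I w]
    rw [map_mul, Complex.conj_ofReal, ← Complex.exp_conj, map_mul, Complex.conj_ofReal,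
      Complex.conj_I]
    push_cast
    rw [sub_mul, sub_eq_add_neg, Complex.exp_add]
    ring_nf
  obtain ⟨k, hk⟩ := turn_angle (r := ‖z‖ * ‖w‖) (θ := z.arg - w.arg)
    (mul_pos (norm_pos_iff.2 hz) (norm_pos_iff.2 hw))
  refine ⟨k, ?_⟩
  rw [e, hk]
  unfold turn
  ring

/-- Two points of the disc lie in a common dyadic box of size comparable to `|1 - z \bar w|`. -/
lemma exists_common_dbox {z w : ℂ} (hz : ‖z‖ < 1) (hw : ‖w‖ < 1) (hz0 : z ≠ 0) (hw0 : w ≠ 0) :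
    ∃ i : Index, z ∈ dbox i ∧ w ∈ dbox i ∧ (1 : ℝ) / 2 ^ i.1 ≤ 2 * ‖1 - z * conj w‖ := by
  classical
  have hpi := Real.pi_pos
  set u := z * conj w with hu
  have hun : ‖u‖ = ‖z‖ * ‖w‖ := by rw [hu, norm_mul, Complex.norm_conj]
  have hzp : 0 < ‖z‖ := norm_pos_iff.2 hz0
  have hwp : 0 < ‖w‖ := norm_pos_iff.2 hw0
  have hu1 : ‖u‖ < 1 := by rw [hun]; nlinarith
  have hge : 1 - ‖u‖ ≤ ‖1 - u‖ := by
    have := norm_sub_norm_le (1 : ℂ) u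
    rwa [norm_one] at this
  -- Q n holds when generation n is coarse enough: both points are in its annulus, and they differ
  -- in angle by at most half an arc. The box comes from the generation just before the first
  -- failure.
  let Q : ℕ → Prop := fun n =>
    1 - 1 / 2 ^ n < ‖z‖ ∧ 1 - 1 / 2 ^ n < ‖w‖ ∧ |turn u| ≤ 1 / 2 ^ (n + 1)
  have hQ0 : Q 0 := by
    refine ⟨by simpa using hz0, by simpa using hw0, ?_⟩
    unfold turn
    rw [abs_div, abs_of_pos (show 0 < 2 * Real.pi by positivity), div_le_iff₀ (by positivity)]
    have := Complex.abs_arg_le_pi u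
    norm_num
    linarith
  have hex : ∃ n, ¬ Q n := by
    obtain ⟨n, hn⟩ := exists_pow_lt_of_lt_one (show 0 < 1 - ‖z‖ by linarith)
      (show (1 / 2 : ℝ) < 1 by norm_num)
    refine ⟨n, fun h => ?_⟩
    have := h.1
    rw [one_div_pow] at hn
    linarith
  set N := Nat.find hex with hN
  have hNQ : ¬ Q N := Nat.find_spec hex
  have hN0 : N ≠ 0 := fun h => hNQ (h ▸ hQ0)
  obtain ⟨n, hn⟩ := Nat.exists_eq_succ_of_ne_zero hN0
  have hQn : Q n := by
    have := Nat.find_min hex (m := n) (by omega)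
    simpa using this
  -- If |1 - u| were below 2^(-(n+1)), all three conditions would hold at n + 1: the radial ones
  -- because |u| ≤ |z|, |w|, the angular one by `norm_one_sub_ge_arg`.
  have hsize : (1 : ℝ) / 2 ^ n ≤ 2 * ‖1 - u‖ := by
    rw [hn] at hNQ
    have e1 : (1 : ℝ) / 2 ^ n = 2 * (1 / 2 ^ (n + 1)) := by rw [pow_succ]; field_simp
    have e2 : (1 : ℝ) / 2 ^ (n + 1) = 2 * (1 / 2 ^ (n + 1 + 1)) := by
      rw [pow_succ _ (n + 1)]; field_simp
    rw [e1]
    refine mul_le_mul_of_nonneg_left ?_ (by norm_num)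
    by_contra hlt
    push Not at hlt
    apply hNQ
    refine ⟨?_, ?_, ?_⟩
    · have : ‖u‖ ≤ ‖z‖ := by rw [hun]; nlinarith
      change 1 - 1 / 2 ^ (n + 1) < _
      linarith
    · have : ‖u‖ ≤ ‖w‖ := by rw [hun]; nlinarith
      change 1 - 1 / 2 ^ (n + 1) < _
      linarith
    · have h1 := norm_one_sub_ge_arg u hu1
      change |turn u| ≤ 1 / 2 ^ (n + 1 + 1)
      have h2 : |turn u| = |u.arg| / Real.pi / 2 := by
        unfold turn
        rw [abs_div, abs_of_pos (show 0 < 2 * Real.pi by positivity)]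
        field_simp
      rw [h2]
      linarith
  obtain ⟨k, hk⟩ := exists_turn_mul_conj hz0 hw0
  rw [← hu] at hk
  obtain ⟨h1, h2, h3⟩ := hQn
  rcases le_total 0 (turn u) with h | h
  · rw [abs_of_nonneg h] at h3
    obtain ⟨j, hj1, hj2⟩ := exists_common_arc (x := turn w) (y := turn z) (k := -k) h h3
      (by push_cast; linarith)
    exact ⟨⟨n, j⟩, ⟨h1, hz, hj2⟩, ⟨h2, hw, hj1⟩, hsize⟩
  · rw [abs_of_nonpos h] at h3
    obtain ⟨j, hj1, hj2⟩ := exists_common_arc (x := turn z) (y := turn w) (k := k)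
      (neg_nonneg.2 h) h3 (by linarith)
    exact ⟨⟨n, j⟩, ⟨h1, hz, hj1⟩, ⟨h2, hw, hj2⟩, hsize⟩

/-! ### The Carleson embedding -/

/-- A weight on the `n`-th annulus that grows geometrically towards the circle. -/
def growth (l : ℝ) (n : ℕ) (z : ℂ) : ℝ≥0∞ :=
  ∑' k : ℕ, ENNReal.ofReal (l ^ k) * (annulus (n + k)).indicator 1 z

lemma measurable_growth (l : ℝ) (n : ℕ) : Measurable (growth l n) := by
  unfold growth
  exact Measurable.tsum fun k =>
    (measurable_one.indicator (measurableSet_annulus _)).const_mul _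

lemma tsum_ofReal_pow {r : ℝ} (h0 : 0 ≤ r) :
    ∑' k : ℕ, ENNReal.ofReal (r ^ k) = (1 - ENNReal.ofReal r)⁻¹ := by
  rw [← ENNReal.tsum_geometric]
  congr 1; ext k
  rw [ENNReal.ofReal_pow h0]

lemma one_sub_ofReal_inv_ne_top {r : ℝ} (h1 : r < 1) : (1 - ENNReal.ofReal r)⁻¹ ≠ ⊤ := by
  rw [ENNReal.inv_ne_top]
  rw [← pos_iff_ne_zero, tsub_pos_iff_lt]
  simpa using h1

/-- The weight gains the factor 1 + 1/K per generation while the measure loses 1 - 1/K; the product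
1 - 1/K² is less than 1, so the series is geometric. -/
lemma TopHeavy.setLIntegral_growth_le {s : Measure ℂ} [IsFiniteMeasure s] {K : ℝ} (hK : 1 ≤ K)
    (hs : TopHeavy s K) (i : Index) :
    ∫⁻ z in dbox i, growth (1 + 1 / K) i.1 z ∂s ≤
      (1 - ENNReal.ofReal ((1 + 1 / K) * (1 - 1 / K)))⁻¹ * s (dbox i) := by
  have hK0 : 0 < K := by linarith
  have hr : 0 ≤ 1 - 1 / K := by rw [sub_nonneg, div_le_one hK0]; exact hK
  have hl : 0 ≤ 1 + 1 / K := by positivity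
  have h1n : (1 : ℝ) / 2 ^ i.1 ≤ 1 := by
    rw [div_le_one (by positivity)]; exact one_le_pow₀ (by norm_num)
  unfold growth
  rw [lintegral_tsum fun k =>
    ((measurable_one.indicator (measurableSet_annulus _)).const_mul _).aemeasurable,
    ← tsum_ofReal_pow (mul_nonneg hl hr), ← ENNReal.tsum_mul_right]
  refine ENNReal.tsum_le_tsum fun k => ?_
  rw [lintegral_const_mul _ (measurable_one.indicator (measurableSet_annulus _)),
    lintegral_indicator_one (measurableSet_annulus _),
    Measure.restrict_apply (measurableSet_annulus _)]
  have hsub : annulus (i.1 + k) ∩ dbox i ⊆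
      box ((i.2 : ℕ) / 2 ^ (i.1 + 1)) (1 / 2 ^ i.1) (1 / 2 ^ i.1 / 2 ^ k) := by
    rintro z ⟨hz1, hz2⟩
    refine ⟨?_, hz2.2⟩
    have : (1 : ℝ) / 2 ^ i.1 / 2 ^ k = 1 / 2 ^ (i.1 + k) := by rw [pow_add]; field_simp
    rw [this]
    exact hz1.1
  calc ENNReal.ofReal ((1 + 1 / K) ^ k) * s (annulus (i.1 + k) ∩ dbox i)
      ≤ ENNReal.ofReal ((1 + 1 / K) ^ k) *
        (ENNReal.ofReal ((1 - 1 / K) ^ k) * s (dbox i)) := by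
        gcongr
        exact (measure_mono hsub).trans (hs.decay hK (by positivity) h1n k)
    _ = _ := by
        rw [← mul_assoc, ← ENNReal.ofReal_mul (by positivity), mul_pow]

lemma one_le_growth {l : ℝ} (n : ℕ) {z : ℂ} (hz : z ∈ annulus n) : 1 ≤ growth l n z := by
  refine le_trans ?_ (ENNReal.le_tsum 0)
  rw [add_zero, Set.indicator_of_mem hz]
  simp

lemma annulus_anti {m n : ℕ} (h : m ≤ n) : annulus n ⊆ annulus m := by
  intro z hz
  refine ⟨lt_of_le_of_lt ?_ hz.1, hz.2⟩
  have : (1 : ℝ) / 2 ^ n ≤ 1 / 2 ^ m := by gcongr; norm_num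
  linarith

lemma exists_max_annulus {z : ℂ} (hz : z ∈ annulus 0) : ∃ N, ∀ n, z ∈ annulus n ↔ n ≤ N := by
  classical
  have hex : ∃ n, z ∉ annulus n := by
    obtain ⟨n, hn⟩ := exists_pow_lt_of_lt_one (show 0 < 1 - ‖z‖ by linarith [hz.2])
      (show (1 / 2 : ℝ) < 1 by norm_num)
    refine ⟨n, fun h => ?_⟩
    have := h.1
    rw [one_div_pow] at hn
    linarith
  have hN0 : Nat.find hex ≠ 0 := fun h => by
    have := Nat.find_spec hex
    rw [h] at this
    exact this hz
  obtain ⟨N, hN⟩ := Nat.exists_eq_succ_of_ne_zero hN0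
  refine ⟨N, fun n => ⟨fun h => ?_, fun h => ?_⟩⟩
  · by_contra hlt
    exact Nat.find_spec hex (annulus_anti (by omega) h)
  · have := Nat.find_min hex (m := n) (by omega)
    simpa using this

/-- If N is the last generation whose annulus contains z, then `growth l n z` is at least l^(N-n)
for n ≤ N, so the sum is a geometric series read backwards from N. This makes the sum over
generations bounded at each point. -/
lemma tsum_growth_rpow_le {l e : ℝ} (hl : 1 < l) (he : 0 < e) (z : ℂ) :
    ∑' n : ℕ, (annulus n).indicator 1 z * growth l n z ^ (-e) ≤
      (1 - ENNReal.ofReal (l ^ (-e)))⁻¹ := by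
  classical
  have hl0 : 0 < l := by linarith
  by_cases hz : z ∈ annulus 0
  · obtain ⟨N, hN⟩ := exists_max_annulus hz
    rw [tsum_eq_sum (s := Finset.range (N + 1))]
    · rw [← tsum_ofReal_pow (by positivity)]
      calc ∑ n ∈ Finset.range (N + 1), (annulus n).indicator 1 z * growth l n z ^ (-e)
          ≤ ∑ n ∈ Finset.range (N + 1), ENNReal.ofReal ((l ^ (-e)) ^ (N - n)) := by
            refine Finset.sum_le_sum fun n hn => ?_
            have hn' : n ≤ N := by simpa [Nat.lt_succ_iff] using hn
            rw [Set.indicator_of_mem ((hN n).2 hn'), Pi.one_apply, one_mul]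
            have h1 : ENNReal.ofReal (l ^ (N - n)) ≤ growth l n z := by
              refine le_trans ?_ (ENNReal.le_tsum (N - n))
              rw [Set.indicator_of_mem ((hN _).2 (by omega))]
              simp
            have h2 : ENNReal.ofReal ((l ^ (-e)) ^ (N - n)) =
                (ENNReal.ofReal (l ^ (N - n)) ^ e)⁻¹ := by
              rw [← ENNReal.rpow_neg, ENNReal.ofReal_rpow_of_pos (by positivity)]
              congr 1
              rw [← Real.rpow_natCast, ← Real.rpow_natCast, ← Real.rpow_mul hl0.le,
                ← Real.rpow_mul hl0.le, mul_comm]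
            rw [h2, ENNReal.rpow_neg]
            gcongr
        _ = ∑ k ∈ Finset.range (N + 1), ENNReal.ofReal ((l ^ (-e)) ^ k) := by
            rw [← Finset.sum_range_reflect]
            refine Finset.sum_congr rfl fun n hn => ?_
            have hn' : n ≤ N := by simpa [Nat.lt_succ_iff] using hn
            congr 2
            omega
        _ ≤ _ := ENNReal.sum_le_tsum _
    · intro n hn
      have : z ∉ annulus n := by
        rw [hN]
        simpa [Nat.lt_succ_iff] using hn
      rw [Set.indicator_of_notMem this, zero_mul]
  · have : ∀ n, (annulus n).indicator (1 : ℂ → ℝ≥0∞) z * growth l n z ^ (-e) = 0 := fun n => by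
      rw [Set.indicator_of_notMem (fun h => hz (annulus_anti (Nat.zero_le n) h)), zero_mul]
    simp [this]

lemma dbox_subset_annulus (i : Index) : dbox i ⊆ annulus i.1 := fun _ h => ⟨h.1, h.2.1⟩

/-- Hölder for h = (h G^(-1/q)) G^(1/q), with G the growth weight: the integral of G over the box is
at most A times the box mass, and the resulting power of the mass cancels against s(Q)^(1-p). The
gain is the decaying factor G^(-(p-1)) beside h^p. -/
lemma TopHeavy.term_le {p q : ℝ} (hpq : p.HolderConjugate q) {s : Measure ℂ} [IsFiniteMeasure s]
    {K : ℝ} (hK : 1 ≤ K) (hs : TopHeavy s K) {h : ℂ → ℝ≥0∞} (hh : Measurable h) (i : Index) :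
    s (dbox i) ^ (1 - p) * (∫⁻ z in dbox i, h z ∂s) ^ p ≤
      ((1 - ENNReal.ofReal ((1 + 1 / K) * (1 - 1 / K)))⁻¹) ^ (p - 1) *
      ∫⁻ z in dbox i, h z ^ p * growth (1 + 1 / K) i.1 z ^ (-(p - 1)) ∂s := by
  set G := growth (1 + 1 / K) i.1
  set A := (1 - ENNReal.ofReal ((1 + 1 / K) * (1 - 1 / K)))⁻¹ with hA
  have hK0 : 0 < K := by linarith
  have hA_top : A ≠ ⊤ := one_sub_ofReal_inv_ne_top (by
    have : (1 + 1 / K) * (1 - 1 / K) = 1 - (1 / K) ^ 2 := by ring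
    rw [this]
    have : 0 < (1 / K) ^ 2 := by positivity
    linarith)
  have hGm : Measurable G := measurable_growth _ _
  have hGint : ∫⁻ z in dbox i, G z ∂s ≤ A * s (dbox i) := hs.setLIntegral_growth_le hK i
  -- Finiteness of G, with G ≥ 1, is what lets its opposite powers cancel in [0, ∞].
  have hGtop : ∀ᵐ z ∂(s.restrict (dbox i)), G z < ⊤ :=
    ae_lt_top hGm (ne_top_of_le_ne_top (ENNReal.mul_ne_top hA_top (measure_ne_top _ _)) hGint)
  have hp0 := hpq.pos
  have hq0 := hpq.symm.pos
  have h1 : ∫⁻ z in dbox i, h z ∂s ≤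
      (∫⁻ z in dbox i, h z ^ p * G z ^ (-(p - 1)) ∂s) ^ (1 / p) *
        (∫⁻ z in dbox i, G z ∂s) ^ (1 / q) := by
    have hold := ENNReal.lintegral_mul_le_Lp_mul_Lq (s.restrict (dbox i)) hpq
      (f := fun z => h z * G z ^ (-(1 / q))) (g := fun z => G z ^ (1 / q))
      (hh.mul (hGm.pow_const _)).aemeasurable (hGm.pow_const _).aemeasurable
    refine le_trans (lintegral_mono_ae ?_) (hold.trans (le_of_eq ?_))
    · filter_upwards [hGtop, ae_restrict_mem (measurableSet_dbox i)] with z hz hzi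
      have hG1 : 1 ≤ G z := one_le_growth _ (dbox_subset_annulus i hzi)
      have hG0 : G z ≠ 0 := (lt_of_lt_of_le one_pos hG1).ne'
      simp only [Pi.mul_apply]
      rw [mul_assoc, ← ENNReal.rpow_add _ _ hG0 hz.ne, neg_add_cancel, ENNReal.rpow_zero, mul_one]
    · congr 2
      · refine lintegral_congr fun z => ?_
        rw [ENNReal.mul_rpow_of_nonneg _ _ hp0.le, ← ENNReal.rpow_mul, neg_mul, one_div_mul_eq_div,
          hpq.div_conj_eq_sub_one]
      · refine lintegral_congr fun z => ?_
        rw [← ENNReal.rpow_mul, one_div_mul_cancel hq0.ne', ENNReal.rpow_one]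
  have h2 : (∫⁻ z in dbox i, h z ∂s) ^ p ≤
      (∫⁻ z in dbox i, h z ^ p * G z ^ (-(p - 1)) ∂s) * (A ^ (p - 1) * s (dbox i) ^ (p - 1)) := by
    calc _ ≤ ((∫⁻ z in dbox i, h z ^ p * G z ^ (-(p - 1)) ∂s) ^ (1 / p) *
        (∫⁻ z in dbox i, G z ∂s) ^ (1 / q)) ^ p := by gcongr
      _ = (∫⁻ z in dbox i, h z ^ p * G z ^ (-(p - 1)) ∂s) *
        (∫⁻ z in dbox i, G z ∂s) ^ (p - 1) := by
        rw [ENNReal.mul_rpow_of_nonneg _ _ hp0.le, ← ENNReal.rpow_mul, ← ENNReal.rpow_mul,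
          one_div_mul_cancel hp0.ne', ENNReal.rpow_one, one_div_mul_eq_div, hpq.div_conj_eq_sub_one]
      _ ≤ _ := by
        rw [← ENNReal.mul_rpow_of_nonneg _ _ hpq.sub_one_pos.le]
        gcongr
        exact hpq.sub_one_pos.le
  calc s (dbox i) ^ (1 - p) * (∫⁻ z in dbox i, h z ∂s) ^ p
      ≤ s (dbox i) ^ (1 - p) * ((∫⁻ z in dbox i, h z ^ p * G z ^ (-(p - 1)) ∂s) *
        (A ^ (p - 1) * s (dbox i) ^ (p - 1))) := by gcongr
    _ = (A ^ (p - 1) * ∫⁻ z in dbox i, h z ^ p * G z ^ (-(p - 1)) ∂s) *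
        (s (dbox i) ^ (1 - p) * s (dbox i) ^ (p - 1)) := by ring
    _ ≤ _ := by
        refine mul_le_of_le_one_right zero_le ?_
        have : 1 - p = -(p - 1) := by ring
        rw [this, ENNReal.rpow_neg]
        exact ENNReal.inv_mul_le_one _

/-- A Carleson embedding for the averages over dyadic boxes. -/
theorem TopHeavy.carleson {p q : ℝ} (hpq : p.HolderConjugate q) {s : Measure ℂ} [IsFiniteMeasure s]
    {K : ℝ} (hK : 1 ≤ K) (hs : TopHeavy s K) : ∃ C : ℝ≥0∞, C ≠ ⊤ ∧
      ∀ h : ℂ → ℝ≥0∞, Measurable h →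
        ∑' i : Index, s (dbox i) ^ (1 - p) * (∫⁻ z in dbox i, h z ∂s) ^ p ≤
          C * ∫⁻ z, h z ^ p ∂s := by
  have hK0 : 0 < K := by linarith
  set l := 1 + 1 / K with hl
  have hl1 : 1 < l := by rw [hl]; linarith [show 0 < 1 / K by positivity]
  set A := ((1 - ENNReal.ofReal ((1 + 1 / K) * (1 - 1 / K)))⁻¹) with hA
  have hA_top : A ≠ ⊤ := one_sub_ofReal_inv_ne_top (by
    have : (1 + 1 / K) * (1 - 1 / K) = 1 - (1 / K) ^ 2 := by ring
    rw [this]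
    have : 0 < (1 / K) ^ 2 := by positivity
    linarith)
  set D := (1 - ENNReal.ofReal (l ^ (-(p - 1))))⁻¹ with hD
  have hD_top : D ≠ ⊤ := one_sub_ofReal_inv_ne_top
    (Real.rpow_lt_one_of_one_lt_of_neg hl1 (by linarith [hpq.sub_one_pos]))
  refine ⟨A ^ (p - 1) * (2 * D), ENNReal.mul_ne_top
    (ENNReal.rpow_ne_top_of_nonneg hpq.sub_one_pos.le hA_top)
    (ENNReal.mul_ne_top (by simp) hD_top), fun h hh => ?_⟩
  have hm : ∀ n, Measurable fun z => h z ^ p * growth l n z ^ (-(p - 1)) := fun n =>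
    (hh.pow_const _).mul ((measurable_growth _ _).pow_const _)
  have hind : ∀ S : Set ℂ, ∀ z, ∀ a : ℝ≥0∞, S.indicator (fun _ => a) z =
      S.indicator 1 z * a := by
    intro S z a
    by_cases hz : z ∈ S <;> simp [hz]
  calc ∑' i : Index, s (dbox i) ^ (1 - p) * (∫⁻ z in dbox i, h z ∂s) ^ p
      ≤ ∑' i : Index, A ^ (p - 1) *
          ∫⁻ z in dbox i, h z ^ p * growth l i.1 z ^ (-(p - 1)) ∂s :=
        ENNReal.tsum_le_tsum fun i => hs.term_le hpq hK hh i
    _ = A ^ (p - 1) * ∑' n : ℕ, ∑ j : Fin (2 ^ (n + 1)),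
          ∫⁻ z in dbox ⟨n, j⟩, h z ^ p * growth l n z ^ (-(p - 1)) ∂s := by
        rw [ENNReal.tsum_mul_left, ENNReal.tsum_sigma']
        congr 1
        refine tsum_congr fun n => ?_
        rw [tsum_fintype]
    _ ≤ A ^ (p - 1) * ∑' n : ℕ, ∫⁻ z, 2 * (annulus n).indicator 1 z *
          (h z ^ p * growth l n z ^ (-(p - 1))) ∂s := by
        gcongr with n
        have : ∀ j : Fin (2 ^ (n + 1)), ∫⁻ z in dbox ⟨n, j⟩, h z ^ p * growth l n z ^ (-(p - 1)) ∂s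
            = ∫⁻ z, (dbox ⟨n, j⟩).indicator 1 z * (h z ^ p * growth l n z ^ (-(p - 1))) ∂s := by
          intro j
          rw [← lintegral_indicator (measurableSet_dbox _)]
          refine lintegral_congr fun z => ?_
          rw [← hind]
          rfl
        simp_rw [this]
        rw [← lintegral_finsetSum]
        swap
        · exact fun j _ => (measurable_one.indicator (measurableSet_dbox _)).mul (hm n)
        refine lintegral_mono fun z => ?_
        rw [← Finset.sum_mul]
        gcongr
        exact sum_indicator_dbox_le n z
    _ = A ^ (p - 1) * ∫⁻ z, ∑' n : ℕ, 2 * (annulus n).indicator 1 z *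
          (h z ^ p * growth l n z ^ (-(p - 1))) ∂s := by
        rw [lintegral_tsum]
        exact fun n => Measurable.aemeasurable
          (((measurable_one.indicator (measurableSet_annulus _)).const_mul _).mul (hm n))
    _ ≤ A ^ (p - 1) * ∫⁻ z, 2 * D * h z ^ p ∂s := by
        gcongr with z
        calc ∑' n : ℕ, 2 * (annulus n).indicator 1 z * (h z ^ p * growth l n z ^ (-(p - 1)))
            = 2 * (∑' n : ℕ, (annulus n).indicator 1 z * growth l n z ^ (-(p - 1))) * h z ^ p := by
              rw [← ENNReal.tsum_mul_left, ← ENNReal.tsum_mul_right]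
              refine tsum_congr fun n => ?_
              ring
          _ ≤ _ := by
              gcongr
              exact tsum_growth_rpow_le hl1 hpq.sub_one_pos z
    _ = _ := by
        rw [lintegral_const_mul _ (hh.pow_const _), mul_assoc, mul_assoc, mul_assoc]

/-! ### The positive operator between two weights -/

/-- The kernel of the positive Bergman operator. -/
def posKernel (β : ℝ) (z w : ℂ) : ℝ≥0∞ := ENNReal.ofReal ((‖1 - z * conj w‖ ^ β)⁻¹)

lemma measurable_posKernel (β : ℝ) : Measurable fun x : ℂ × ℂ => posKernel β x.1 x.2 := by
  unfold posKernel
  have h1 : Measurable fun x : ℂ × ℂ => ‖1 - x.1 * conj x.2‖ :=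
    (measurable_const.sub (measurable_fst.mul
      (Complex.continuous_conj.measurable.comp measurable_snd))).norm
  exact ENNReal.measurable_ofReal.comp (h1.pow_const β).inv

lemma measurable_posKernel_right (β : ℝ) (z : ℂ) : Measurable fun w => posKernel β z w :=
  Measurable.of_uncurry_left (f := posKernel β) (measurable_posKernel β)

lemma measurable_lintegral_posKernel (β : ℝ) (s : Measure ℂ) [SFinite s] {h : ℂ → ℝ≥0∞}
    (hh : Measurable h) : Measurable fun z => ∫⁻ w, posKernel β z w * h w ∂s :=
  Measurable.lintegral_prod_right' (f := fun x : ℂ × ℂ => posKernel β x.1 x.2 * h x.2)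
    ((measurable_posKernel β).mul (hh.comp measurable_snd))

/-- The single term of the common box of `exists_common_dbox` already dominates the kernel, because
the size of that box is at most 2|1 - z w̄|. -/
lemma posKernel_le_tsum {β : ℝ} (hβ : 0 ≤ β) {z w : ℂ} (hz : z ∈ annulus 0) (hw : w ∈ annulus 0) :
    posKernel β z w ≤ ENNReal.ofReal (2 ^ β) * ∑' i : Index,
      ENNReal.ofReal ((2 ^ i.1) ^ β) * (dbox i).indicator 1 z * (dbox i).indicator 1 w := by
  have hz0 : z ≠ 0 := fun h => by have := hz.1; simp [h] at this
  have hw0 : w ≠ 0 := fun h => by have := hw.1; simp [h] at this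
  obtain ⟨i, hi1, hi2, hi3⟩ := exists_common_dbox hz.2 hw.2 hz0 hw0
  refine le_trans ?_ (mul_le_mul_right (ENNReal.le_tsum i) _)
  rw [Set.indicator_of_mem hi1, Set.indicator_of_mem hi2]
  simp only [Pi.one_apply, mul_one]
  rw [← ENNReal.ofReal_mul (by positivity), ← Real.mul_rpow (by norm_num) (by positivity)]
  unfold posKernel
  apply ENNReal.ofReal_le_ofReal
  have hpos : 0 < ‖1 - z * conj w‖ := by
    have : (0 : ℝ) < 1 / 2 ^ i.1 := by positivity
    linarith
  rw [← Real.inv_rpow hpos.le]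
  refine Real.rpow_le_rpow (by positivity) ?_ hβ
  rw [inv_le_iff_one_le_mul₀ hpos]
  rw [div_le_iff₀ (by positivity)] at hi3
  linarith

/-- Once the kernel is replaced by the sum over boxes, z and w are separated in each term, and
Tonelli turns the form into products of box integrals. -/
lemma bilinear_le_tsum {β : ℝ} (hβ : 0 ≤ β) {s ω : Measure ℂ} [SFinite s] [SFinite ω]
    (hs : ∀ᵐ z ∂s, z ∈ annulus 0) (hω : ∀ᵐ z ∂ω, z ∈ annulus 0) {h G : ℂ → ℝ≥0∞}
    (hh : Measurable h) (hG : Measurable G) :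
    ∫⁻ z, (∫⁻ w, posKernel β z w * h w ∂s) * G z ∂ω ≤
      ENNReal.ofReal (2 ^ β) * ∑' i : Index, ENNReal.ofReal ((2 ^ i.1) ^ β) *
        (∫⁻ w in dbox i, h w ∂s) * ∫⁻ z in dbox i, G z ∂ω := by
  have hind : ∀ (i : Index) (μ : Measure ℂ) (F : ℂ → ℝ≥0∞),
      ∫⁻ z in dbox i, F z ∂μ = ∫⁻ z, (dbox i).indicator 1 z * F z ∂μ := by
    intro i μ F
    rw [← lintegral_indicator (measurableSet_dbox _)]
    refine lintegral_congr fun z => ?_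
    by_cases hz : z ∈ dbox i <;> simp [hz]
  have hmi : ∀ i : Index, Measurable ((dbox i).indicator (1 : ℂ → ℝ≥0∞)) := fun i =>
    measurable_one.indicator (measurableSet_dbox i)
  calc ∫⁻ z, (∫⁻ w, posKernel β z w * h w ∂s) * G z ∂ω
      ≤ ∫⁻ z, (ENNReal.ofReal (2 ^ β) * ∑' i : Index, ENNReal.ofReal ((2 ^ i.1) ^ β) *
          (∫⁻ w in dbox i, h w ∂s) * (dbox i).indicator 1 z) * G z ∂ω := by
        refine lintegral_mono_ae (hω.mono fun z hz => ?_)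
        refine mul_le_mul_left ?_ (G z)
        calc ∫⁻ w, posKernel β z w * h w ∂s
            ≤ ∫⁻ w, ENNReal.ofReal (2 ^ β) * ∑' i : Index, ENNReal.ofReal ((2 ^ i.1) ^ β) *
              (dbox i).indicator 1 z * ((dbox i).indicator 1 w * h w) ∂s := by
              refine lintegral_mono_ae (hs.mono fun w hw => ?_)
              refine (mul_le_mul_left (posKernel_le_tsum hβ hz hw) (h w)).trans (le_of_eq ?_)
              rw [mul_assoc, ← ENNReal.tsum_mul_right]
              simp only [mul_assoc]
          _ = _ := by
              rw [lintegral_const_mul, lintegral_tsum]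
              rotate_left
              · exact fun i => (((hmi i).mul hh).const_mul _).aemeasurable
              · exact Measurable.tsum fun i => ((hmi i).mul hh).const_mul _
              congr 1
              refine tsum_congr fun i => ?_
              rw [lintegral_const_mul, hind]
              · ring
              · exact (hmi i).mul hh
    _ = ∫⁻ z, ENNReal.ofReal (2 ^ β) * ∑' i : Index, ENNReal.ofReal ((2 ^ i.1) ^ β) *
          (∫⁻ w in dbox i, h w ∂s) * ((dbox i).indicator 1 z * G z) ∂ω := by
        refine lintegral_congr fun z => ?_
        rw [mul_assoc, ← ENNReal.tsum_mul_right]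
        simp only [mul_assoc]
    _ = _ := by
        rw [lintegral_const_mul, lintegral_tsum]
        rotate_left
        · exact fun i => (((hmi i).mul hG).const_mul _).aemeasurable
        · exact Measurable.tsum fun i => ((hmi i).mul hG).const_mul _
        congr 1
        refine tsum_congr fun i => ?_
        rw [lintegral_const_mul, hind i ω]
        exact (hmi i).mul hG

lemma tsum_mul_le_Lp_mul_Lq {ι : Type*} {p q : ℝ} (hpq : p.HolderConjugate q) (f g : ι → ℝ≥0∞) :
    ∑' i, f i * g i ≤ (∑' i, f i ^ p) ^ (1 / p) * (∑' i, g i ^ q) ^ (1 / q) := by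
  let _ : MeasurableSpace ι := ⊤
  have := ENNReal.lintegral_mul_le_Lp_mul_Lq Measure.count hpq
    (f := f) (g := g) measurable_from_top.aemeasurable measurable_from_top.aemeasurable
  simpa only [lintegral_count, Pi.mul_apply] using this

lemma le_rpow_of_le_mul_rpow {p q : ℝ} (hpq : p.HolderConjugate q) {X B : ℝ≥0∞} (hX : X ≠ ⊤)
    (h : X ≤ B * X ^ (1 / q)) : X ≤ B ^ p := by
  rcases eq_or_ne X 0 with rfl | h0
  · exact zero_le
  have hp := hpq.pos
  have h1 : X ^ (1 / q) ≠ 0 := by simp [h0, hX]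
  have h2 : X ^ (1 / q) ≠ ⊤ := ENNReal.rpow_ne_top_of_nonneg hpq.symm.one_div_nonneg hX
  have h3 : X ^ (1 / p) ≤ B := by
    have e : X = X ^ (1 / p) * X ^ (1 / q) := by
      rw [← ENNReal.rpow_add _ _ h0 hX, hpq.one_div_add_one_div, div_one, ENNReal.rpow_one]
    rw [← ENNReal.mul_le_mul_iff_left h1 h2]
    rwa [← e]
  calc X = (X ^ (1 / p)) ^ p := by
        rw [← ENNReal.rpow_mul, one_div_mul_cancel hp.ne', ENNReal.rpow_one]
    _ ≤ _ := by gcongr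

/-- With G = min(F, n)^(p-1) the hypothesis reads X ≤ B X^(1/q) for X the integral of min(F, n)^p.
Truncation and finiteness of ω make X finite, so the power can be cancelled; monotone convergence
removes n. -/
lemma lintegral_rpow_le_of_bilinear {p q : ℝ} (hpq : p.HolderConjugate q) {ω : Measure ℂ}
    [IsFiniteMeasure ω] {F : ℂ → ℝ≥0∞} (hF : Measurable F) {B : ℝ≥0∞}
    (h : ∀ G : ℂ → ℝ≥0∞, Measurable G →
      ∫⁻ z, F z * G z ∂ω ≤ B * (∫⁻ z, G z ^ q ∂ω) ^ (1 / q)) :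
    ∫⁻ z, F z ^ p ∂ω ≤ B ^ p := by
  have hp := hpq.pos
  have key : ∀ n : ℕ, ∫⁻ z, (min (F z) n) ^ p ∂ω ≤ B ^ p := by
    intro n
    have hm : Measurable fun z => min (F z) (n : ℝ≥0∞) := hF.min measurable_const
    apply le_rpow_of_le_mul_rpow hpq
    · refine ne_top_of_le_ne_top ?_ (lintegral_mono (g := fun _ => (n : ℝ≥0∞) ^ p) fun z => ?_)
      · rw [lintegral_const]
        exact ENNReal.mul_ne_top (ENNReal.rpow_ne_top_of_nonneg hp.le (by simp))
          (measure_ne_top _ _)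
      · dsimp only
        gcongr
        exact min_le_right _ _
    · refine le_trans ?_ ((h (fun z => (min (F z) n) ^ (p - 1)) (hm.pow_const _)).trans
        (le_of_eq ?_))
      · refine lintegral_mono fun z => ?_
        have e : (min (F z) (n : ℝ≥0∞)) ^ p =
            (min (F z) (n : ℝ≥0∞)) * (min (F z) (n : ℝ≥0∞)) ^ (p - 1) := by
          conv_lhs => rw [show p = 1 + (p - 1) by ring]
          rw [ENNReal.rpow_add_of_nonneg _ _ zero_le_one hpq.sub_one_pos.le, ENNReal.rpow_one]
        rw [e]
        gcongr
        exact min_le_left _ _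
      · congr 2
        refine lintegral_congr fun z => ?_
        rw [← ENNReal.rpow_mul, hpq.sub_one_mul_conj]
  have ht := lintegral_tendsto_of_tendsto_of_monotone (μ := ω)
    (f := fun (n : ℕ) z => (min (F z) (n : ℝ≥0∞)) ^ p) (F := fun z => F z ^ p)
    (fun n => ((hF.min measurable_const).pow_const _).aemeasurable)
    (Filter.Eventually.of_forall fun z m n hmn => by dsimp only; gcongr)
    (Filter.Eventually.of_forall fun z => by
      have h1 : Filter.Tendsto (fun n : ℕ => min (F z) (n : ℝ≥0∞)) Filter.atTop
          (nhds (min (F z) ⊤)) := tendsto_const_nhds.min ENNReal.tendsto_nat_nhds_top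
      rw [min_top_right] at h1
      exact (ENNReal.continuous_rpow_const.tendsto _).comp h1)
  exact le_of_tendsto' ht key

/-- The two-weight bound for the positive Bergman operator. -/
theorem exists_lintegral_posKernel_le {β p q : ℝ} (hβ : 0 ≤ β) (hpq : p.HolderConjugate q)
    {s ω : Measure ℂ} [IsFiniteMeasure s] [IsFiniteMeasure ω]
    (hs : ∀ᵐ z ∂s, z ∈ annulus 0) (hω : ∀ᵐ z ∂ω, z ∈ annulus 0) {K : ℝ} (hK : 1 ≤ K)
    (hsK : TopHeavy s K) (hωK : TopHeavy ω K) {A : ℝ≥0∞} (hA : A ≠ ⊤)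
    (hH : ∀ i : Index, ENNReal.ofReal ((2 ^ i.1) ^ β) ≤
      A * s (dbox i) ^ (-(1 / q)) * ω (dbox i) ^ (-(1 / p))) :
    ∃ C : ℝ≥0∞, C ≠ ⊤ ∧ ∀ h : ℂ → ℝ≥0∞, Measurable h →
      ∫⁻ z, (∫⁻ w, posKernel β z w * h w ∂s) ^ p ∂ω ≤ C * ∫⁻ w, h w ^ p ∂s := by
  obtain ⟨C₁, hC₁, h₁⟩ := hsK.carleson hpq hK
  obtain ⟨C₂, hC₂, h₂⟩ := hωK.carleson hpq.symm hK
  have hp := hpq.pos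
  have hq := hpq.symm.pos
  have h1p := hpq.one_div_nonneg
  have h1q := hpq.symm.one_div_nonneg
  set D := ENNReal.ofReal (2 ^ β) * (A * (C₁ ^ (1 / p) * C₂ ^ (1 / q))) with hD
  have hDtop : D ≠ ⊤ := ENNReal.mul_ne_top (by simp) (ENNReal.mul_ne_top hA (ENNReal.mul_ne_top
    (ENNReal.rpow_ne_top_of_nonneg h1p hC₁) (ENNReal.rpow_ne_top_of_nonneg h1q hC₂)))
  refine ⟨D ^ p, ENNReal.rpow_ne_top_of_nonneg hp.le hDtop, fun h hh => ?_⟩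
  have hexp : ∀ (μ : Measure ℂ) (i : Index) {a b : ℝ} (_ : a.HolderConjugate b) (x : ℝ≥0∞),
      (μ (dbox i) ^ (-(1 / b)) * x) ^ a = μ (dbox i) ^ (1 - a) * x ^ a := by
    intro μ i a b hab x
    rw [ENNReal.mul_rpow_of_nonneg _ _ hab.pos.le, ← ENNReal.rpow_mul, neg_mul,
      one_div_mul_eq_div, hab.div_conj_eq_sub_one, neg_sub]
  -- After duality, the size hypothesis hands σ(Q)^(-1/q) to one box integral and ω(Q)^(-1/p) to the
  -- other, with s in the role of σ. By `hexp` these are the normalizations of the two Carleson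
  -- embeddings.
  have := lintegral_rpow_le_of_bilinear hpq (measurable_lintegral_posKernel β s hh) (ω := ω)
    (B := D * (∫⁻ w, h w ^ p ∂s) ^ (1 / p)) (fun G hG => by
      calc ∫⁻ z, (∫⁻ w, posKernel β z w * h w ∂s) * G z ∂ω
          ≤ ENNReal.ofReal (2 ^ β) * ∑' i : Index, ENNReal.ofReal ((2 ^ i.1) ^ β) *
            (∫⁻ w in dbox i, h w ∂s) * ∫⁻ z in dbox i, G z ∂ω :=
            bilinear_le_tsum hβ hs hω hh hG
        _ ≤ ENNReal.ofReal (2 ^ β) * ∑' i : Index, A *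
            ((s (dbox i) ^ (-(1 / q)) * ∫⁻ w in dbox i, h w ∂s) *
            (ω (dbox i) ^ (-(1 / p)) * ∫⁻ z in dbox i, G z ∂ω)) := by
            refine mul_le_mul_right (ENNReal.tsum_le_tsum fun i => ?_) _
            calc _ ≤ (A * s (dbox i) ^ (-(1 / q)) * ω (dbox i) ^ (-(1 / p))) *
                  (∫⁻ w in dbox i, h w ∂s) * ∫⁻ z in dbox i, G z ∂ω := by
                  gcongr; exact hH i
              _ = _ := by ring
        _ ≤ ENNReal.ofReal (2 ^ β) * (A * ((C₁ * ∫⁻ w, h w ^ p ∂s) ^ (1 / p) *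
              (C₂ * ∫⁻ z, G z ^ q ∂ω) ^ (1 / q))) := by
            rw [ENNReal.tsum_mul_left]
            gcongr
            refine (tsum_mul_le_Lp_mul_Lq hpq _ _).trans ?_
            gcongr
            · refine le_trans (le_of_eq (tsum_congr fun i => hexp s i hpq _)) (h₁ h hh)
            · refine le_trans (le_of_eq (tsum_congr fun i => hexp ω i hpq.symm _)) (h₂ G hG)
        _ = _ := by
            rw [ENNReal.mul_rpow_of_nonneg _ _ h1p, ENNReal.mul_rpow_of_nonneg _ _ h1q, hD]
            ring)
  refine this.trans (le_of_eq ?_)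
  rw [ENNReal.mul_rpow_of_nonneg _ _ hp.le, ← ENNReal.rpow_mul (∫⁻ w, h w ^ p ∂s),
    one_div_mul_cancel hp.ne', ENNReal.rpow_one]

/-! ### The weights |f|^p and |f|^(-q) under the joint condition -/

lemma ofReal_norm_rpow {p : ℝ} (hp : 0 ≤ p) (x : ℂ) : ENNReal.ofReal (‖x‖ ^ p) = ‖x‖ₑ ^ p := by
  rw [← ENNReal.ofReal_rpow_of_nonneg (norm_nonneg _) hp, ofReal_norm]

lemma norm_rpow_neg (q : ℝ) (x : ℂ) : ‖x‖ ^ (-q) = ‖x⁻¹‖ ^ q := by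
  rw [Real.rpow_neg (norm_nonneg _), norm_inv, Real.inv_rpow (norm_nonneg _)]

lemma mass_eq (α : ℝ) (ω : ℂ → ℝ) {Q : Set ℂ} (hQ : MeasurableSet Q) :
    mass α ω Q = weighted α ω Q := by
  unfold mass weighted
  rw [withDensity_apply _ hQ]

lemma mass_one (α : ℝ) (Q : Set ℂ) : mass α (fun _ => 1) Q = nuA α Q := by
  simp [mass]

lemma ae_weighted {α : ℝ} {ω : ℂ → ℝ} {P : ℂ → Prop} (h : ∀ᵐ z ∂(nuA α), P z) :
    ∀ᵐ z ∂(weighted α ω), P z :=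
  (withDensity_absolutelyContinuous _ _).ae_le h

/-- `annulus 0` is the punctured disc; the dyadic boxes all omit the origin. -/
lemma ae_mem_annulus (α : ℝ) : ∀ᵐ z ∂(nuA α), z ∈ annulus 0 := by
  filter_upwards [ae_mem_disc α, ae_ne_zero α] with z hz hz0
  exact ⟨by simpa using hz0, mem_disc.1 hz⟩

lemma ofReal_ne_top_of_pos {p : ℝ} (hp : 0 < p) : ENNReal.ofReal p ≠ 0 ∧ ENNReal.ofReal p ≠ ⊤ :=
  ⟨by simpa using hp, ENNReal.ofReal_ne_top⟩

lemma eLpNorm_ofReal {p : ℝ} (hp : 0 < p) (h : ℂ → ℂ) (μ : Measure ℂ) :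
    eLpNorm h (ENNReal.ofReal p) μ = (∫⁻ z, ‖h z‖ₑ ^ p ∂μ) ^ (1 / p) := by
  rw [eLpNorm_eq_lintegral_rpow_enorm_toReal (ofReal_ne_top_of_pos hp).1 (ofReal_ne_top_of_pos hp).2,
    ENNReal.toReal_ofReal hp.le]

lemma MemLp.lintegral_ne_top {p : ℝ} (hp : 0 < p) {h : ℂ → ℂ} {μ : Measure ℂ}
    (hh : MemLp h (ENNReal.ofReal p) μ) : ∫⁻ z, ‖h z‖ₑ ^ p ∂μ ≠ ⊤ := by
  have := hh.eLpNorm_lt_top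
  rw [eLpNorm_ofReal hp, ENNReal.rpow_lt_top_iff_of_pos (by positivity)] at this
  exact this.ne

lemma isFiniteMeasure_weighted {α p : ℝ} (hp : 0 < p) {f : ℂ → ℂ}
    (hf : MemLp f (ENNReal.ofReal p) (nuA α)) :
    IsFiniteMeasure (weighted α fun z => ‖f z‖ ^ p) := by
  refine isFiniteMeasure_withDensity ?_
  simp_rw [ofReal_norm_rpow hp.le]
  exact MemLp.lintegral_ne_top hp hf

section Weights

variable {α p q : ℝ} {f : ℂ → ℂ}

/-- Hölder for the constant 1 = |f| |1/f|. -/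
lemma nuA_le_weighted (hpq : p.HolderConjugate q) (hf0 : ∀ z ∈ disc, f z ≠ 0)
    (hf : AEStronglyMeasurable f (nuA α)) {T : Set ℂ} (hT : MeasurableSet T) :
    nuA α T ≤ weighted α (fun z => ‖f z‖ ^ p) T ^ (1 / p) *
      weighted α (fun z => ‖f z‖ ^ (-q)) T ^ (1 / q) := by
  have hp := hpq.pos
  have hq := hpq.symm.pos
  unfold weighted
  rw [withDensity_apply _ hT, withDensity_apply _ hT]
  simp_rw [norm_rpow_neg, ofReal_norm_rpow hp.le, ofReal_norm_rpow hq.le]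
  refine le_trans ?_ (ENNReal.lintegral_mul_le_Lp_mul_Lq _ hpq hf.restrict.enorm
    (hf.restrict.aemeasurable.inv.enorm))
  rw [← setLIntegral_one]
  refine lintegral_mono_ae (ae_restrict_of_ae ?_)
  filter_upwards [ae_mem_disc α] with z hz
  simp only [Pi.mul_apply]
  rw [← enorm_mul, mul_inv_cancel₀ (hf0 z hz), enorm_one]

lemma le_of_mul_rpow_le {a b c x : ℝ≥0∞} (hc0 : c ≠ 0) (hc : c ≠ ⊤) (h : a * c ≤ x * (b * c)) :
    a ≤ x * b := by
  rw [← mul_assoc] at h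
  exact (ENNReal.mul_le_mul_iff_left hc0 hc).1 h

lemma exists_nuA_carlesonBox_le_topHalf (hα : -1 < α) : ∃ C : ℝ≥0∞, C ≠ ⊤ ∧
    ∀ a δ : ℝ, 0 < δ → δ ≤ 1 → 0 < nuA α (topHalf a δ δ) ∧
      nuA α (carlesonBox (2 * Real.pi * a) (2 * Real.pi * (a + δ))) ≤
        C * nuA α (topHalf a δ δ) := by
  have hc : 0 < 1 - (3 / 4 : ℝ) ^ (α + 1) := by
    rw [sub_pos]
    exact Real.rpow_lt_one (by norm_num) (by norm_num) (by linarith)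
  refine ⟨ENNReal.ofReal (2 ^ (α + 1) / (1 - (3 / 4) ^ (α + 1))), ENNReal.ofReal_ne_top,
    fun a δ h0 h1 => ⟨?_, ?_⟩⟩
  · refine lt_of_lt_of_le ?_ (nuA_topHalf_ge hα a h0 h1)
    rw [ENNReal.ofReal_pos]
    positivity
  · refine (nuA_carlesonBox_le hα a h0 h1).trans ?_
    refine le_trans (le_of_eq ?_) (mul_le_mul_right (nuA_topHalf_ge hα a h0 h1) _)
    rw [← ENNReal.ofReal_mul (by positivity)]
    congr 1
    field_simp

lemma mul_rpow_le_of_jointBB (σ ω : ℂ → ℝ) (hα : -1 < α) (hp : 0 < p) {a b : ℝ} (hab : a < b)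
    (hb : b ≤ a + 2 * Real.pi) :
    weighted α ω (carlesonBox a b) * weighted α σ (carlesonBox a b) ^ (p - 1) ≤
      jointBB p α σ ω * nuA α (carlesonBox a b) ^ p := by
  have : Fact (-1 < α) := ⟨hα⟩
  have hQ := measurableSet_carlesonBox hab hb
  have hpi := Real.pi_pos
  have h : mass α ω (carlesonBox a b) * mass α σ (carlesonBox a b) ^ (p - 1) /
      mass α (fun _ => 1) (carlesonBox a b) ^ p ≤ jointBB p α σ ω :=
    le_iSup₂_of_le a b (le_iSup₂_of_le hab hb le_rfl)
  rw [mass_eq _ _ hQ, mass_eq _ _ hQ, mass_one] at h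
  have hδ0 : 0 < (b - a) / (2 * Real.pi) := div_pos (by linarith) (by positivity)
  have hδ1 : (b - a) / (2 * Real.pi) ≤ 1 := by
    rw [div_le_one (by positivity)]; linarith
  have hpos : nuA α (carlesonBox a b) ≠ 0 := by
    obtain ⟨C, -, h⟩ := exists_nuA_carlesonBox_le_topHalf hα
    refine ((h (a / (2 * Real.pi)) _ hδ0 hδ1).1.trans_le (measure_mono ?_)).ne'
    exact Set.sdiff_subset.trans (box_subset_carlesonBox' hab hb)
  rwa [ENNReal.div_le_iff] at h
  · simpa [hp, hp.le] using hpos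
  · exact ENNReal.rpow_ne_top_of_nonneg hp.le (measure_ne_top _ _)

/-- On a box Q with top half T, the condition bounds ω(Q) σ(Q)^(p-1) by a multiple of ν_α(Q)^p,
hence of ν_α(T)^p, hence by `nuA_le_weighted` of ω(T) σ(T)^(p-1). Replacing one factor on T by the
larger one on Q and cancelling it leaves the claim for the other weight. -/
lemma topHeavy_of_jointBB (hα : -1 < α) (hpq : p.HolderConjugate q) (hf0 : ∀ z ∈ disc, f z ≠ 0)
    (hf : MemLp f (ENNReal.ofReal p) (nuA α))
    (hfi : MemLp (fun z => (f z)⁻¹) (ENNReal.ofReal q) (nuA α))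
    (hJ : jointBB p α (fun z => ‖f z‖ ^ (-q)) (fun z => ‖f z‖ ^ p) < ⊤) :
    ∃ K : ℝ, 1 ≤ K ∧ TopHeavy (weighted α fun z => ‖f z‖ ^ p) K ∧
      TopHeavy (weighted α fun z => ‖f z‖ ^ (-q)) K := by
  have hp := hpq.pos
  have hq := hpq.symm.pos
  have hp1 := hpq.sub_one_pos
  have hpi := Real.pi_pos
  set J := jointBB p α (fun z => ‖f z‖ ^ (-q)) (fun z => ‖f z‖ ^ p)
  have fin1 := isFiniteMeasure_weighted hp hf
  have fin2 := isFiniteMeasure_weighted hq hfi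
  simp_rw [← norm_rpow_neg] at fin2
  obtain ⟨C, hC, hCT⟩ := exists_nuA_carlesonBox_le_topHalf hα
  set L := J * C ^ p with hL
  have hLtop : L ≠ ⊤ := ENNReal.mul_ne_top hJ.ne (ENNReal.rpow_ne_top_of_nonneg hp.le hC)
  have hmul : ∀ a δ : ℝ, 0 < δ → δ ≤ 1 →
      weighted α (fun z => ‖f z‖ ^ p) (topHalf a δ δ) ≠ 0 ∧
      weighted α (fun z => ‖f z‖ ^ (-q)) (topHalf a δ δ) ≠ 0 ∧
      weighted α (fun z => ‖f z‖ ^ p) (box a δ δ) *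
        weighted α (fun z => ‖f z‖ ^ (-q)) (box a δ δ) ^ (p - 1) ≤
      L * (weighted α (fun z => ‖f z‖ ^ p) (topHalf a δ δ) *
        weighted α (fun z => ‖f z‖ ^ (-q)) (topHalf a δ δ) ^ (p - 1)) := by
    intro a δ h0 h1
    obtain ⟨hT0, hT⟩ := hCT a δ h0 h1
    have hh := nuA_le_weighted hpq hf0 hf.1 (measurableSet_topHalf a δ δ)
    have hsub := box_subset_carlesonBox a h0 h1
    have hbb := mul_rpow_le_of_jointBB (fun z => ‖f z‖ ^ (-q)) (fun z => ‖f z‖ ^ p) hα hp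
      (a := 2 * Real.pi * a) (b := 2 * Real.pi * (a + δ)) (by nlinarith) (by nlinarith)
    refine ⟨fun h => ?_, fun h => ?_, ?_⟩
    · rw [h, ENNReal.zero_rpow_of_pos (by positivity), zero_mul] at hh
      exact hT0.not_ge hh
    · rw [h, ENNReal.zero_rpow_of_pos (by positivity), mul_zero] at hh
      exact hT0.not_ge hh
    · refine (mul_le_mul' (measure_mono hsub)
        (ENNReal.rpow_le_rpow (measure_mono hsub) hp1.le)).trans (hbb.trans ?_)
      calc _ ≤ J * (C * nuA α (topHalf a δ δ)) ^ p := by gcongr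
        _ ≤ J * (C * (weighted α (fun z => ‖f z‖ ^ p) (topHalf a δ δ) ^ (1 / p) *
            weighted α (fun z => ‖f z‖ ^ (-q)) (topHalf a δ δ) ^ (1 / q))) ^ p := by gcongr
        _ = _ := by
          rw [ENNReal.mul_rpow_of_nonneg _ _ hp.le, ENNReal.mul_rpow_of_nonneg _ _ hp.le,
            ← ENNReal.rpow_mul, ← ENNReal.rpow_mul, one_div_mul_cancel hp.ne', ENNReal.rpow_one,
            one_div_mul_eq_div, hpq.div_conj_eq_sub_one, hL, mul_assoc]
  have hTB : ∀ (μ : Measure ℂ) (a δ : ℝ), μ (topHalf a δ δ) ≤ μ (box a δ δ) := fun μ a δ =>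
    measure_mono Set.sdiff_subset
  have hL2 : L ^ (1 / (p - 1)) ≠ ⊤ := ENNReal.rpow_ne_top_of_nonneg (by positivity) hLtop
  refine ⟨max 1 (max L.toReal (L ^ (1 / (p - 1))).toReal), le_max_left _ _, ?_, ?_⟩
  · intro a δ h0 h1
    obtain ⟨n1, n2, h⟩ := hmul a δ h0 h1
    have h3 : weighted α (fun z => ‖f z‖ ^ p) (box a δ δ) ≤
        L * weighted α (fun z => ‖f z‖ ^ p) (topHalf a δ δ) := by
      have hs0 : weighted α (fun z => ‖f z‖ ^ (-q)) (box a δ δ) ≠ 0 := fun h' =>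
        n2 (le_antisymm ((hTB _ a δ).trans h'.le) zero_le)
      refine le_of_mul_rpow_le (c := weighted α (fun z => ‖f z‖ ^ (-q)) (box a δ δ) ^ (p - 1))
        ?_ ?_ (h.trans ?_)
      · simp [hs0]
      · exact ENNReal.rpow_ne_top_of_nonneg hp1.le (measure_ne_top _ _)
      · gcongr
        exact Set.sdiff_subset
    refine h3.trans ?_
    gcongr
    refine (ENNReal.ofReal_toReal hLtop).ge.trans ?_
    exact ENNReal.ofReal_le_ofReal ((le_max_left _ _).trans (le_max_right _ _))
  · intro a δ h0 h1
    obtain ⟨n1, n2, h⟩ := hmul a δ h0 h1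
    have h3 : weighted α (fun z => ‖f z‖ ^ (-q)) (box a δ δ) ^ (p - 1) ≤
        L * weighted α (fun z => ‖f z‖ ^ (-q)) (topHalf a δ δ) ^ (p - 1) := by
      have hs0 : weighted α (fun z => ‖f z‖ ^ p) (box a δ δ) ≠ 0 := fun h' =>
        n1 (le_antisymm ((hTB _ a δ).trans h'.le) zero_le)
      refine le_of_mul_rpow_le (c := weighted α (fun z => ‖f z‖ ^ p) (box a δ δ))
        hs0 (measure_ne_top _ _) ?_
      rw [mul_comm]
      refine h.trans ?_
      rw [mul_comm (weighted α (fun z => ‖f z‖ ^ p) (topHalf a δ δ))]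
      gcongr
      exact Set.sdiff_subset
    have h4 : weighted α (fun z => ‖f z‖ ^ (-q)) (box a δ δ) ≤
        L ^ (1 / (p - 1)) * weighted α (fun z => ‖f z‖ ^ (-q)) (topHalf a δ δ) := by
      rw [← ENNReal.rpow_le_rpow_iff hp1]
      rw [ENNReal.mul_rpow_of_nonneg _ _ hp1.le, ← ENNReal.rpow_mul, one_div_mul_cancel hp1.ne',
        ENNReal.rpow_one]
      exact h3
    refine h4.trans ?_
    gcongr
    refine (ENNReal.ofReal_toReal hL2).ge.trans ?_
    exact ENNReal.ofReal_le_ofReal ((le_max_right _ _).trans (le_max_right _ _))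

lemma inv_le_mul_inv {A x y : ℝ≥0∞} (hA0 : A ≠ 0) (hA : A ≠ ⊤) (h : x ≤ A * y) :
    y⁻¹ ≤ A * x⁻¹ := by
  calc y⁻¹ = A * (A * y)⁻¹ := by
        rw [ENNReal.mul_inv (Or.inl hA0) (Or.inl hA), ← mul_assoc, ENNReal.mul_inv_cancel hA0 hA,
          one_mul]
    _ ≤ A * x⁻¹ := by gcongr

lemma exists_size_le_of_jointBB (hα : -1 < α) (hpq : p.HolderConjugate q)
    (hf : MemLp f (ENNReal.ofReal p) (nuA α))
    (hfi : MemLp (fun z => (f z)⁻¹) (ENNReal.ofReal q) (nuA α))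
    (hJ : jointBB p α (fun z => ‖f z‖ ^ (-q)) (fun z => ‖f z‖ ^ p) < ⊤) :
    ∃ A : ℝ≥0∞, A ≠ ⊤ ∧ ∀ i : Index, ENNReal.ofReal ((2 ^ i.1) ^ (2 + α)) ≤
      A * weighted α (fun z => ‖f z‖ ^ (-q)) (dbox i) ^ (-(1 / q)) *
        weighted α (fun z => ‖f z‖ ^ p) (dbox i) ^ (-(1 / p)) := by
  have hp := hpq.pos
  have hq := hpq.symm.pos
  have hp1 := hpq.sub_one_pos
  have hpi := Real.pi_pos
  set J := jointBB p α (fun z => ‖f z‖ ^ (-q)) (fun z => ‖f z‖ ^ p)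
  have fin1 := isFiniteMeasure_weighted hp hf
  have fin2 := isFiniteMeasure_weighted hq hfi
  simp_rw [← norm_rpow_neg] at fin2
  -- The added 1 only makes the constant nonzero, as `inv_le_mul_inv` requires.
  refine ⟨J ^ (1 / p) * ENNReal.ofReal (2 ^ (α + 1)) + 1, ENNReal.add_ne_top.2 ⟨ENNReal.mul_ne_top
    (ENNReal.rpow_ne_top_of_nonneg (by positivity) hJ.ne) ENNReal.ofReal_ne_top, by simp⟩,
    fun i => ?_⟩
  have h0 : (0 : ℝ) < 1 / 2 ^ i.1 := by positivity
  have h1 : (1 : ℝ) / 2 ^ i.1 ≤ 1 := by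
    rw [div_le_one (by positivity)]; exact one_le_pow₀ (by norm_num)
  set a : ℝ := (i.2 : ℕ) / 2 ^ (i.1 + 1)
  set δ : ℝ := 1 / 2 ^ i.1
  have hsub : dbox i ⊆ _ := box_subset_carlesonBox a h0 h1
  have hbb := mul_rpow_le_of_jointBB (fun z => ‖f z‖ ^ (-q)) (fun z => ‖f z‖ ^ p) hα hp
      (a := 2 * Real.pi * a) (b := 2 * Real.pi * (a + δ)) (by nlinarith) (by nlinarith)
  have h2 : weighted α (fun z => ‖f z‖ ^ p) (dbox i) *
      weighted α (fun z => ‖f z‖ ^ (-q)) (dbox i) ^ (p - 1) ≤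
      J * ENNReal.ofReal (2 ^ (α + 1) * δ ^ (α + 2)) ^ p := by
    refine (mul_le_mul' (measure_mono hsub)
        (ENNReal.rpow_le_rpow (measure_mono hsub) hp1.le)).trans (hbb.trans ?_)
    gcongr
    exact nuA_carlesonBox_le hα a h0 h1
  have h3 : weighted α (fun z => ‖f z‖ ^ (-q)) (dbox i) ^ (1 / q) *
      weighted α (fun z => ‖f z‖ ^ p) (dbox i) ^ (1 / p) ≤
      J ^ (1 / p) * ENNReal.ofReal (2 ^ (α + 1)) * ENNReal.ofReal (δ ^ (α + 2)) := by
    rw [← ENNReal.rpow_le_rpow_iff hp, mul_assoc, ← ENNReal.ofReal_mul (by positivity),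
      ENNReal.mul_rpow_of_nonneg _ _ hp.le, ENNReal.mul_rpow_of_nonneg _ _ hp.le,
      ← ENNReal.rpow_mul, ← ENNReal.rpow_mul, ← ENNReal.rpow_mul J, one_div_mul_cancel hp.ne',
      ENNReal.rpow_one, ENNReal.rpow_one, one_div_mul_eq_div, hpq.div_conj_eq_sub_one, mul_comm]
    exact h2
  have e : ENNReal.ofReal ((2 ^ i.1) ^ (2 + α)) = (ENNReal.ofReal (δ ^ (α + 2)))⁻¹ := by
    rw [← ENNReal.ofReal_inv_of_pos (by positivity), ← Real.inv_rpow h0.le, add_comm α]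
    simp [δ]
  rw [e, mul_assoc, ENNReal.rpow_neg, ENNReal.rpow_neg, ← ENNReal.mul_inv
    (Or.inr (ENNReal.rpow_ne_top_of_nonneg (by positivity) (measure_ne_top _ _)))
    (Or.inl (ENNReal.rpow_ne_top_of_nonneg (by positivity) (measure_ne_top _ _)))]
  refine inv_le_mul_inv (by simp) ?_ (h3.trans ?_)
  · exact ENNReal.add_ne_top.2 ⟨ENNReal.mul_ne_top
      (ENNReal.rpow_ne_top_of_nonneg (by positivity) hJ.ne) ENNReal.ofReal_ne_top, by simp⟩
  · gcongr
    exact le_self_add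

/-- The weighted bound for the positive Bergman operator under the Békollé–Bonami condition. -/
theorem exists_lintegral_posKernel_weighted_le (hα : -1 < α) (hpq : p.HolderConjugate q)
    (hf0 : ∀ z ∈ disc, f z ≠ 0) (hf : MemLp f (ENNReal.ofReal p) (nuA α))
    (hfi : MemLp (fun z => (f z)⁻¹) (ENNReal.ofReal q) (nuA α))
    (hJ : jointBB p α (fun z => ‖f z‖ ^ (-q)) (fun z => ‖f z‖ ^ p) < ⊤) :
    ∃ C : ℝ≥0∞, C ≠ ⊤ ∧ ∀ h : ℂ → ℝ≥0∞, AEMeasurable h (nuA α) →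
      ∫⁻ z, (∫⁻ w, posKernel (2 + α) z w * h w ∂(nuA α)) ^ p ∂(weighted α fun z => ‖f z‖ ^ p) ≤
        C * ∫⁻ w, h w ^ p ∂(weighted α fun z => ‖f z‖ ^ p) := by
  have hp := hpq.pos
  have hq := hpq.symm.pos
  have : Fact (-1 < α) := ⟨hα⟩
  obtain ⟨K, hK, hωK, hsK⟩ := topHeavy_of_jointBB hα hpq hf0 hf hfi hJ
  obtain ⟨A, hA, hH⟩ := exists_size_le_of_jointBB hα hpq hf hfi hJ
  have fin1 := isFiniteMeasure_weighted hp hf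
  have fin2 := isFiniteMeasure_weighted hq hfi
  simp_rw [← norm_rpow_neg] at fin2
  obtain ⟨C, hC, hCh⟩ := exists_lintegral_posKernel_le (β := 2 + α) (by linarith) hpq
    (ae_weighted (ae_mem_annulus α)) (ae_weighted (ae_mem_annulus α)) hK hsK hωK hA hH
  refine ⟨C, hC, fun h hh => ?_⟩
  -- f is measurable only up to a null set; the representative g makes both densities measurable.
  obtain ⟨g, hg, hfg⟩ := hf.1
  set S : ℂ → ℝ≥0∞ := fun z => ENNReal.ofReal (‖g z‖ ^ (-q)) with hS
  have hSm : Measurable S := ENNReal.measurable_ofReal.comp (hg.measurable.norm.pow_const _)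
  have hg0 : ∀ᵐ z ∂(nuA α), g z ≠ 0 := by
    filter_upwards [hfg, ae_mem_disc α] with z hz hzd
    rw [← hz]; exact hf0 z hzd
  have hs : weighted α (fun z => ‖f z‖ ^ (-q)) = (nuA α).withDensity S :=
    withDensity_congr_ae (hfg.mono fun z hz => by simp only [hS, hz])
  have hω : weighted α (fun z => ‖f z‖ ^ p) =
      (nuA α).withDensity fun z => ENNReal.ofReal (‖g z‖ ^ p) :=
    withDensity_congr_ae (hfg.mono fun z hz => by simp only [hz])
  have hWm : Measurable fun z => ENNReal.ofReal (‖g z‖ ^ p) :=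
    ENNReal.measurable_ofReal.comp (hg.measurable.norm.pow_const _)
  set k := hh.mk h with hk
  have hkm : Measurable k := hh.measurable_mk
  have hhk : h =ᵐ[nuA α] k := hh.ae_eq_mk
  -- Dividing by the density S of σ turns integration against σ back into integration against ν_α.
  -- On the right S · S^(-p) = |f|^p, because pq - q = p, so the two-weight bound becomes a
  -- one-weight bound.
  have hbound := hCh (fun z => k z * (S z)⁻¹) (hkm.mul hSm.inv)
  have hSpos : ∀ᵐ z ∂(nuA α), S z ≠ 0 := hg0.mono fun z hz => by
    simp only [hS, ne_eq, ENNReal.ofReal_eq_zero, not_le]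
    exact Real.rpow_pos_of_pos (norm_pos_iff.2 hz) _
  have e1 : ∀ z, ∫⁻ w, posKernel (2 + α) z w * (k w * (S w)⁻¹) ∂((nuA α).withDensity S) =
      ∫⁻ w, posKernel (2 + α) z w * h w ∂(nuA α) := by
    intro z
    rw [lintegral_withDensity_eq_lintegral_mul _ hSm]
    swap
    · exact (measurable_posKernel_right _ _).mul (hkm.mul hSm.inv)
    refine lintegral_congr_ae ?_
    filter_upwards [hSpos, hhk] with w hw hwk
    simp only [Pi.mul_apply]
    rw [hwk]
    calc S w * (posKernel (2 + α) z w * (k w * (S w)⁻¹))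
        = posKernel (2 + α) z w * k w * (S w * (S w)⁻¹) := by ring
      _ = _ := by rw [ENNReal.mul_inv_cancel hw ENNReal.ofReal_ne_top, mul_one]
  have e2 : ∫⁻ w, (k w * (S w)⁻¹) ^ p ∂((nuA α).withDensity S) =
      ∫⁻ w, h w ^ p ∂(weighted α fun z => ‖f z‖ ^ p) := by
    have hhk' : h =ᵐ[weighted α fun z => ‖f z‖ ^ p] k := ae_weighted hhk
    have e3 : ∫⁻ w, h w ^ p ∂(weighted α fun z => ‖f z‖ ^ p) =
        ∫⁻ w, k w ^ p ∂(weighted α fun z => ‖f z‖ ^ p) :=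
      lintegral_congr_ae (hhk'.mono fun z hz => by simp only [hz])
    rw [e3, hω, lintegral_withDensity_eq_lintegral_mul _ hSm,
      lintegral_withDensity_eq_lintegral_mul _ hWm (hkm.pow_const _)]
    swap
    · exact (hkm.mul hSm.inv).pow_const _
    refine lintegral_congr_ae ?_
    filter_upwards [hSpos, hg0] with w hw hgw
    simp only [Pi.mul_apply]
    rw [ENNReal.mul_rpow_of_nonneg _ _ hp.le, mul_left_comm, mul_comm (k w ^ p)]
    congr 1
    have hgpos : 0 < ‖g w‖ := norm_pos_iff.2 hgw
    rw [ENNReal.inv_rpow, ← ENNReal.rpow_neg]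
    conv_lhs => rw [← ENNReal.rpow_one (S w)]
    rw [← ENNReal.rpow_mul, one_mul, ← ENNReal.rpow_add _ _ hw ENNReal.ofReal_ne_top]
    simp only [hS]
    rw [ENNReal.ofReal_rpow_of_pos (by positivity), ← Real.rpow_mul hgpos.le]
    congr 2
    have := hpq.mul_eq_add
    linarith
  rw [hs] at hbound
  simp_rw [e1] at hbound
  rw [e2] at hbound
  exact hbound

end Weights

/-! ### From (iii) to (iv), and the unweighted bound -/

lemma enorm_posIntegrand (α : ℝ) (h : ℂ → ℂ) (z w : ℂ) :
    ‖posIntegrand α h z w‖ₑ = posKernel (2 + α) z w * ‖h w‖ₑ := by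
  unfold posIntegrand posKernel
  rw [div_eq_mul_inv, enorm_mul, mul_comm]
  congr 1
  rw [← ofReal_norm, norm_inv, Complex.norm_real, Real.norm_eq_abs, abs_of_nonneg (by positivity)]

lemma measurable_posIntegrand_factor (α : ℝ) :
    Measurable fun x : ℂ × ℂ => (((‖1 - x.1 * conj x.2‖ ^ (2 + α) : ℝ) : ℂ))⁻¹ := by
  have h1 : Measurable fun x : ℂ × ℂ => ‖1 - x.1 * conj x.2‖ :=
    (measurable_const.sub (measurable_fst.mul
      (Complex.continuous_conj.measurable.comp measurable_snd))).norm
  exact (Complex.measurable_ofReal.comp (h1.pow_const (2 + α))).inv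

section

variable {α p q : ℝ} {f : ℂ → ℂ}

lemma nuA_absolutelyContinuous_weighted (hf0 : ∀ z ∈ disc, f z ≠ 0)
    (hf : AEStronglyMeasurable f (nuA α)) : nuA α ≪ weighted α fun z => ‖f z‖ ^ p := by
  refine withDensity_absolutelyContinuous' ?_ ?_
  · exact ENNReal.measurable_ofReal.comp_aemeasurable (hf.norm.aemeasurable.pow_const _)
  · filter_upwards [ae_mem_disc α] with z hz
    simp only [ne_eq, ENNReal.ofReal_eq_zero, not_le]
    exact Real.rpow_pos_of_pos (norm_pos_iff.2 (hf0 z hz)) _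

theorem posProjBounded_of_jointBB (hα : -1 < α) (hpq : p.HolderConjugate q)
    (hf0 : ∀ z ∈ disc, f z ≠ 0) (hf : MemLp f (ENNReal.ofReal p) (nuA α))
    (hfi : MemLp (fun z => (f z)⁻¹) (ENNReal.ofReal q) (nuA α))
    (hJ : jointBB p α (fun z => ‖f z‖ ^ (-q)) (fun z => ‖f z‖ ^ p) < ⊤) :
    PosProjBounded p α (fun z => ‖f z‖ ^ p) (fun z => ‖f z‖ ^ p) := by
  have hp := hpq.pos
  have : Fact (-1 < α) := ⟨hα⟩
  obtain ⟨C, hC, hCb⟩ := exists_lintegral_posKernel_weighted_le hα hpq hf0 hf hfi hJ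
  have hCp : C ^ (1 / p) ≠ ⊤ := ENNReal.rpow_ne_top_of_nonneg (by positivity) hC
  have fin1 := isFiniteMeasure_weighted hp hf
  refine ⟨(C ^ (1 / p)).toReal, fun h hh => ?_⟩
  have hac : nuA α ≪ weighted α fun z => ‖f z‖ ^ p := nuA_absolutelyContinuous_weighted hf0 hf.1
  have hhm : AEStronglyMeasurable h (nuA α) := hh.1.mono_ac hac
  have hb := hCb (fun w => ‖h w‖ₑ) hhm.enorm
  have hm2 : AEStronglyMeasurable (fun x : ℂ × ℂ => posIntegrand α h x.1 x.2)
      ((nuA α).prod (nuA α)) := by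
    unfold posIntegrand
    simp_rw [div_eq_mul_inv]
    exact hhm.comp_snd.mul (measurable_posIntegrand_factor α).aestronglyMeasurable
  have hm1 : ∀ z, AEStronglyMeasurable (posIntegrand α h z) (nuA α) := by
    intro z
    unfold posIntegrand
    simp_rw [div_eq_mul_inv]
    exact hhm.mul ((measurable_posIntegrand_factor α).comp
      measurable_prodMk_left).aestronglyMeasurable
  have hint : ∫⁻ w, ‖h w‖ₑ ^ p ∂(weighted α fun z => ‖f z‖ ^ p) ≠ ⊤ :=
    MemLp.lintegral_ne_top hp hh
  have hmeas : AEMeasurable (fun z => ∫⁻ w, posKernel (2 + α) z w * ‖h w‖ₑ ∂(nuA α)) (nuA α) := by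
    have := hm2.enorm.lintegral_prod_right'
    simpa only [enorm_posIntegrand] using this
  have hfin : ∀ᵐ z ∂(nuA α), ∫⁻ w, posKernel (2 + α) z w * ‖h w‖ₑ ∂(nuA α) < ⊤ := by
    apply hac.ae_le
    have := ae_lt_top' ((hmeas.mono_ac (withDensity_absolutelyContinuous _ _)).pow_const p)
      (ne_top_of_le_ne_top (ENNReal.mul_ne_top hC hint) hb)
    filter_upwards [this] with z hz
    rwa [ENNReal.rpow_lt_top_iff_of_pos hp] at hz
  have hle : eLpNorm (posProj α h) (ENNReal.ofReal p) (weighted α fun z => ‖f z‖ ^ p) ≤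
      ENNReal.ofReal (C ^ (1 / p)).toReal *
        eLpNorm h (ENNReal.ofReal p) (weighted α fun z => ‖f z‖ ^ p) := by
    rw [eLpNorm_ofReal hp, eLpNorm_ofReal hp, ENNReal.ofReal_toReal hCp,
      ← ENNReal.mul_rpow_of_nonneg _ _ (by positivity)]
    gcongr
    refine le_trans (lintegral_mono fun z => ?_) hb
    gcongr
    refine (enorm_integral_le_lintegral_enorm _).trans (le_of_eq ?_)
    simp_rw [enorm_posIntegrand]
  refine ⟨?_, ⟨?_, ?_⟩, hle⟩
  · filter_upwards [hfin] with z hz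
    refine ⟨hm1 z, ?_⟩
    rw [HasFiniteIntegral]
    simp_rw [enorm_posIntegrand]
    exact hz
  · exact (hm2.integral_prod_right').mono_ac (withDensity_absolutelyContinuous _ _)
  · exact hle.trans_lt (ENNReal.mul_lt_top ENNReal.ofReal_lt_top hh.eLpNorm_lt_top)

/-- Both weights are 1, so each numerator is the mass to the power 1 + (p - 1) and each quotient is
at most 1. -/
lemma jointBB_one_lt_top (hα : -1 < α) (hp : 1 < p) :
    jointBB p α (fun _ => 1) (fun _ => 1) < ⊤ := by
  have : Fact (-1 < α) := ⟨hα⟩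
  refine lt_of_le_of_lt (b := 1) ?_ ENNReal.one_lt_top
  unfold jointBB
  refine iSup_le fun a => iSup_le fun b => iSup_le fun hab => iSup_le fun hb => ?_
  apply ENNReal.div_le_of_le_mul
  rw [one_mul]
  conv_lhs => rw [← ENNReal.rpow_one (mass α (fun _ => 1) (carlesonBox a b))]
  rw [ENNReal.rpow_one, mass_one]
  conv_rhs => rw [show p = 1 + (p - 1) by ring]
  rw [ENNReal.rpow_add_of_nonneg _ _ zero_le_one (by linarith), ENNReal.rpow_one]

/-- The positive Bergman operator is bounded on `L^p(dν_α)`. -/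
theorem exists_lintegral_posKernel_nuA_le (hα : -1 < α) (hpq : p.HolderConjugate q) :
    ∃ C : ℝ≥0∞, C ≠ ⊤ ∧ ∀ h : ℂ → ℝ≥0∞, AEMeasurable h (nuA α) →
      ∫⁻ z, (∫⁻ w, posKernel (2 + α) z w * h w ∂(nuA α)) ^ p ∂(nuA α) ≤
        C * ∫⁻ w, h w ^ p ∂(nuA α) := by
  have : Fact (-1 < α) := ⟨hα⟩
  -- The case f = 1 of the weighted bound.
  have h := exists_lintegral_posKernel_weighted_le (f := fun _ => 1) hα hpq (by simp)
    (memLp_const _) (by simpa using memLp_const _)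
    (by simpa using jointBB_one_lt_top hα hpq.lt)
  simpa [weighted] using h

end

/-! ### The Bergman kernel -/

lemma norm_mul_conj_lt_one {z w : ℂ} (hz : z ∈ disc) (hw : w ∈ disc) : ‖z * conj w‖ < 1 := by
  rw [norm_mul, Complex.norm_conj]
  rw [mem_disc] at hz hw
  nlinarith [norm_nonneg z, norm_nonneg w]

lemma re_one_sub_pos {u : ℂ} (hu : ‖u‖ < 1) : 0 < (1 - u).re := by
  have := Complex.re_le_norm u
  simp only [Complex.sub_re, Complex.one_re]
  linarith

lemma one_sub_mem_slitPlane {u : ℂ} (hu : ‖u‖ < 1) : 1 - u ∈ Complex.slitPlane :=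
  Or.inl (re_one_sub_pos hu)

lemma one_sub_ne_zero {u : ℂ} (hu : ‖u‖ < 1) : 1 - u ≠ 0 :=
  Complex.slitPlane_ne_zero (one_sub_mem_slitPlane hu)

lemma norm_kernel (α : ℝ) (z w : ℂ) : ‖kernel α z w‖ = (‖1 - z * conj w‖ ^ (2 + α))⁻¹ := by
  unfold kernel
  rw [one_div, norm_inv, Complex.norm_cpow_real]

lemma enorm_kernel (α : ℝ) (z w : ℂ) : ‖kernel α z w‖ₑ = posKernel (2 + α) z w := by
  unfold posKernel
  rw [← norm_kernel, ofReal_norm]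

lemma kernel_ne_zero (α : ℝ) {z w : ℂ} (hz : z ∈ disc) (hw : w ∈ disc) : kernel α z w ≠ 0 := by
  unfold kernel
  apply one_div_ne_zero
  rw [Complex.cpow_ne_zero_iff]
  exact Or.inl (one_sub_ne_zero (norm_mul_conj_lt_one hz hw))

lemma conj_cpow_ofReal {x : ℂ} (hx : x ∈ Complex.slitPlane) (r : ℝ) :
    conj (x ^ (r : ℂ)) = conj x ^ (r : ℂ) := by
  rw [Complex.conj_cpow _ _ (Complex.mem_slitPlane_iff_arg.1 hx).1, Complex.conj_ofReal]

lemma conj_kernel (α : ℝ) {z w : ℂ} (hz : z ∈ disc) (hw : w ∈ disc) :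
    conj (kernel α z w) = kernel α w z := by
  unfold kernel
  rw [map_div₀, conj_cpow_ofReal (one_sub_mem_slitPlane (norm_mul_conj_lt_one hz hw))]
  simp [mul_comm]

lemma differentiableOn_kernel (α : ℝ) {w : ℂ} (hw : w ∈ disc) :
    DifferentiableOn ℂ (fun z => kernel α z w) disc := by
  intro z hz
  unfold kernel
  have h1 : 1 - z * conj w ∈ Complex.slitPlane :=
    one_sub_mem_slitPlane (norm_mul_conj_lt_one hz hw)
  have h2 : DifferentiableAt ℂ (fun z => (1 - z * conj w) ^ ((2 + α : ℝ) : ℂ)) z :=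
    DifferentiableAt.cpow_const (by fun_prop) h1
  refine ((differentiableAt_const _).div h2 ?_).differentiableWithinAt
  rw [Complex.cpow_ne_zero_iff]
  exact Or.inl (Complex.slitPlane_ne_zero h1)

lemma norm_kernel_le {α : ℝ} (hα : -1 < α) {z w : ℂ} (hz : z ∈ disc) (hw : w ∈ disc) :
    ‖kernel α z w‖ ≤ ((1 - ‖z‖) ^ (2 + α))⁻¹ := by
  rw [norm_kernel]
  rw [mem_disc] at hz hw
  have h1 : 1 - ‖z‖ ≤ ‖1 - z * conj w‖ := by
    have := norm_sub_norm_le (1 : ℂ) (z * conj w)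
    rw [norm_one, norm_mul, Complex.norm_conj] at this
    nlinarith [norm_nonneg z, norm_nonneg w]
  have h2 : 0 < 1 - ‖z‖ := by linarith
  gcongr
  linarith

lemma measurable_kernel (α : ℝ) : Measurable fun x : ℂ × ℂ => kernel α x.1 x.2 := by
  have h1 : Measurable fun x : ℂ × ℂ => 1 - x.1 * conj x.2 :=
    measurable_const.sub (measurable_fst.mul
      (Complex.continuous_conj.measurable.comp measurable_snd))
  exact measurable_const.div (h1.pow_const ((2 + α : ℝ) : ℂ))

lemma aestronglyMeasurable_of_continuousOn (α : ℝ) {F : ℂ → ℂ} (hF : ContinuousOn F disc) :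
    AEStronglyMeasurable F (nuA α) :=
  (hF.aestronglyMeasurable measurableSet_disc).mono_ac (nuA_absolutelyContinuous α)

/-! ### The mean value property -/

/-- The density of `ν_α` with respect to Lebesgue measure. -/
def rho (α : ℝ) (z : ℂ) : ℝ := 1 / Real.pi * ((α + 1) * (1 - ‖z‖ ^ 2) ^ α)

lemma rho_nonneg {α : ℝ} (hα : -1 < α) {z : ℂ} (hz : z ∈ disc) : 0 ≤ rho α z := by
  rw [mem_disc] at hz
  have h1 : 0 ≤ 1 - ‖z‖ ^ 2 := by nlinarith [norm_nonneg z]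
  have h2 : 0 ≤ (1 - ‖z‖ ^ 2) ^ α := Real.rpow_nonneg h1 _
  have h3 : 0 ≤ α + 1 := by linarith
  have := Real.pi_pos
  unfold rho
  positivity

lemma measurable_rho (α : ℝ) : Measurable (rho α) := by unfold rho; fun_prop

lemma measurable_ofReal_rho (α : ℝ) : Measurable fun z => ENNReal.ofReal (rho α z) :=
  ENNReal.measurable_ofReal.comp (measurable_rho α)

lemma nuA_eq_rho (α : ℝ) :
    nuA α = (volume.restrict disc).withDensity fun z => ENNReal.ofReal (rho α z) := by
  rw [nuA_eq]
  congr 1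
  ext z
  unfold rho
  rw [← ENNReal.ofReal_mul (by have := Real.pi_pos; positivity)]

lemma integral_nuA {α : ℝ} (hα : -1 < α) (F : ℂ → ℂ) :
    ∫ z, F z ∂(nuA α) = ∫ z in disc, rho α z • F z := by
  rw [nuA_eq_rho, integral_withDensity_eq_integral_toReal_smul
    (measurable_ofReal_rho α) (by simp)]
  refine setIntegral_congr_fun measurableSet_disc fun z hz => ?_
  rw [ENNReal.toReal_ofReal (rho_nonneg hα hz)]

lemma integrable_nuA_iff {α : ℝ} (hα : -1 < α) (F : ℂ → ℂ) :
    Integrable F (nuA α) ↔ IntegrableOn (fun z => rho α z • F z) disc := by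
  rw [nuA_eq_rho, integrable_withDensity_iff_integrable_smul'
    (measurable_ofReal_rho α) (by simp), IntegrableOn]
  refine integrable_congr ((ae_restrict_iff' measurableSet_disc).2
    (Filter.Eventually.of_forall fun z hz => ?_))
  simp only
  rw [ENNReal.toReal_ofReal (rho_nonneg hα hz)]

lemma measurePreserving_mul_nuA (α : ℝ) {c : ℂ} (hc : ‖c‖ = 1) :
    MeasurePreserving (fun z => c * z) (nuA α) (nuA α) := by
  have hm : Measurable fun z : ℂ => c * z := measurable_const_mul c
  refine ⟨hm, Measure.ext_of_lintegral _ fun F hF => ?_⟩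
  have hFc : Measurable fun z => F (c * z) := hF.comp hm
  rw [lintegral_map hF hm, lintegral_nuA α hFc, lintegral_nuA α hF,
    ← lintegral_indicator measurableSet_disc, ← lintegral_indicator measurableSet_disc]
  have hmp := (rotation ⟨c, by simpa [Submonoid.unitSphere] using hc⟩).measurePreserving
  conv_rhs => rw [← hmp.lintegral_comp (Measurable.indicator (by fun_prop) measurableSet_disc)]
  refine lintegral_congr fun z => ?_
  have e : (rotation ⟨c, by simpa [Submonoid.unitSphere] using hc⟩) z = c * z := rfl
  rw [e]
  have hn : ‖c * z‖ = ‖z‖ := by rw [norm_mul, hc, one_mul]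
  have hd : c * z ∈ disc ↔ z ∈ disc := by rw [mem_disc, mem_disc, hn]
  by_cases hz : z ∈ disc
  · rw [Set.indicator_of_mem hz, Set.indicator_of_mem (hd.2 hz), hn]
  · rw [Set.indicator_of_notMem hz, Set.indicator_of_notMem (fun h => hz (hd.1 h))]

/-- The mean value property with respect to `ν_α`. -/
theorem integral_nuA_eq_zero_value {α : ℝ} (hα : -1 < α) {F : ℂ → ℂ}
    (hF : DifferentiableOn ℂ F disc) (hFi : Integrable F (nuA α)) :
    ∫ z, F z ∂(nuA α) = F 0 := by
  classical
  have : Fact (-1 < α) := ⟨hα⟩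
  have hpi := Real.pi_pos
  -- Extension by 0 makes the function measurable on all of ℂ, as Fubini on the product with the
  -- circle needs.
  set G : ℂ → ℂ := disc.piecewise F 0 with hG
  have hGm : Measurable G :=
    hF.continuousOn.measurable_piecewise continuousOn_const measurableSet_disc
  have hGF : ∀ z ∈ disc, G z = F z := fun z hz => Set.piecewise_eq_of_mem _ _ _ hz
  have hae : G =ᵐ[nuA α] F := (ae_mem_disc α).mono fun z hz => hGF z hz
  have hGi : Integrable G (nuA α) := hFi.congr hae.symm
  have hc1 : ∀ θ : ℝ, ‖circleMap 0 1 θ‖ = 1 := fun θ => by simp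
  set μ := volume.restrict (Set.Ioc 0 (2 * Real.pi))
  have hmeas : Measurable fun x : ℝ × ℂ => G (circleMap 0 1 x.1 * x.2) := by
    refine hGm.comp (Measurable.mul ?_ measurable_snd)
    exact (continuous_circleMap 0 1).measurable.comp measurable_fst
  have hint : Integrable (Function.uncurry fun (θ : ℝ) (z : ℂ) => G (circleMap 0 1 θ * z))
      (μ.prod (nuA α)) := by
    refine (integrable_prod_iff hmeas.aestronglyMeasurable).2 ?_
    refine ⟨Filter.Eventually.of_forall fun θ => ?_, ?_⟩
    · exact ((measurePreserving_mul_nuA α (hc1 θ)).integrable_comp hGi.1).2 hGi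
    · have : ∀ θ : ℝ, ∫ z, ‖G (circleMap 0 1 θ * z)‖ ∂(nuA α) = ∫ z, ‖G z‖ ∂(nuA α) := fun θ =>
        (measurePreserving_mul_nuA α (hc1 θ)).integral_comp' (f := (MeasurableEquiv.mulLeft₀
          (circleMap 0 1 θ) (by rw [← norm_pos_iff, hc1]; exact one_pos))) (fun z => ‖G z‖)
      simp only [this]
      exact integrable_const _
  -- In one order, rotation invariance of ν_α gives 2π times the integral of F; in the other, the
  -- mean value on circles gives 2π F(0).
  have hswap := integral_integral_swap hint
  have h1 : ∀ θ : ℝ, ∫ z, G (circleMap 0 1 θ * z) ∂(nuA α) = ∫ z, F z ∂(nuA α) := fun θ => by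
    rw [← integral_congr_ae hae]
    exact (measurePreserving_mul_nuA α (hc1 θ)).integral_comp' (f := (MeasurableEquiv.mulLeft₀
          (circleMap 0 1 θ) (by rw [← norm_pos_iff, hc1]; exact one_pos))) G
  have h2 : ∀ z ∈ disc, ∫ θ, G (circleMap 0 1 θ * z) ∂μ = (2 * Real.pi : ℝ) • F 0 := by
    intro z hz
    have hd : ∀ u ∈ Metric.closedBall (0 : ℂ) 1, u * z ∈ disc := by
      intro u hu
      rw [mem_closedBall_zero_iff] at hu
      rw [mem_disc] at hz ⊢
      rw [norm_mul]
      nlinarith [norm_nonneg u, norm_nonneg z]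
    have hdiff : DifferentiableOn ℂ (fun u => F (u * z)) (Metric.closedBall 0 1) :=
      hF.comp (by fun_prop) hd
    have hcirc : Real.circleAverage (fun u => F (u * z)) 0 1 = F (0 * z) := by
      apply DiffContOnCl.circleAverage
      rw [abs_one]
      refine DifferentiableOn.diffContOnCl ?_
      rwa [closure_ball _ one_ne_zero]
    rw [Real.circleAverage, zero_mul, intervalIntegral.integral_of_le (by positivity)] at hcirc
    rw [← hcirc, smul_smul, mul_inv_cancel₀ (by positivity), one_smul]
    refine integral_congr_ae (Filter.Eventually.of_forall fun θ => ?_)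
    exact hGF _ (hd _ (by simp))
  simp only [h1] at hswap
  rw [integral_congr_ae ((ae_mem_disc α).mono h2)] at hswap
  simp only [integral_const] at hswap
  have hμ : μ.real Set.univ = 2 * Real.pi := by
    simp [μ, measureReal_def, hpi.le]
  rw [hμ, probReal_univ, one_smul] at hswap
  exact smul_right_injective _ (by positivity : (2 * Real.pi : ℝ) ≠ 0) hswap

/-! ### Disc automorphisms -/

/-- The involutive automorphism of the disc that exchanges `0` and `a`. -/
def phi (a u : ℂ) : ℂ := (a - u) / (1 - u * conj a)

section

variable {a u : ℂ}

lemma norm_sq_sub_norm_sq (a u : ℂ) :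
    ‖1 - u * conj a‖ ^ 2 - ‖a - u‖ ^ 2 = (1 - ‖a‖ ^ 2) * (1 - ‖u‖ ^ 2) := by
  simp only [Complex.sq_norm, Complex.normSq_apply, Complex.sub_re, Complex.sub_im, Complex.mul_re,
    Complex.mul_im, Complex.conj_re, Complex.conj_im, Complex.one_re, Complex.one_im]
  ring

lemma one_sub_norm_phi_sq (ha : a ∈ disc) (hu : u ∈ disc) :
    1 - ‖phi a u‖ ^ 2 = (1 - ‖a‖ ^ 2) * (1 - ‖u‖ ^ 2) / ‖1 - u * conj a‖ ^ 2 := by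
  have h : 0 < ‖1 - u * conj a‖ := norm_pos_iff.2 (one_sub_ne_zero (norm_mul_conj_lt_one hu ha))
  rw [← norm_sq_sub_norm_sq, phi, norm_div]
  field_simp

lemma one_sub_norm_sq_pos (ha : a ∈ disc) : 0 < 1 - ‖a‖ ^ 2 := by
  rw [mem_disc] at ha
  nlinarith [norm_nonneg a]

lemma phi_mem (ha : a ∈ disc) (hu : u ∈ disc) : phi a u ∈ disc := by
  have h : 0 < ‖1 - u * conj a‖ := norm_pos_iff.2 (one_sub_ne_zero (norm_mul_conj_lt_one hu ha))
  have h1 := one_sub_norm_phi_sq ha hu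
  have h2 : 0 < 1 - ‖phi a u‖ ^ 2 := by
    rw [h1]
    have := one_sub_norm_sq_pos ha
    have := one_sub_norm_sq_pos hu
    positivity
  rw [mem_disc]
  nlinarith [norm_nonneg (phi a u)]

lemma mul_conj_self_ne_one (ha : a ∈ disc) : 1 - a * conj a ≠ 0 :=
  one_sub_ne_zero (norm_mul_conj_lt_one ha ha)

lemma phi_phi (ha : a ∈ disc) (hu : u ∈ disc) : phi a (phi a u) = u := by
  have h1 : 1 - u * conj a ≠ 0 := one_sub_ne_zero (norm_mul_conj_lt_one hu ha)
  have h2 := mul_conj_self_ne_one ha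
  have h3 : 1 - phi a u * conj a ≠ 0 := one_sub_ne_zero (norm_mul_conj_lt_one (phi_mem ha hu) ha)
  have e1 : 1 - phi a u * conj a = (1 - a * conj a) / (1 - u * conj a) := by
    unfold phi
    field_simp
    ring
  have e2 : a - phi a u = u * (1 - a * conj a) / (1 - u * conj a) := by
    unfold phi
    field_simp
    ring
  rw [phi, e1, e2]
  field_simp

lemma hasDerivAt_phi (ha : a ∈ disc) (hu : u ∈ disc) :
    HasDerivAt (phi a) ((a * conj a - 1) / (1 - u * conj a) ^ 2) u := by
  have h1 : 1 - u * conj a ≠ 0 := one_sub_ne_zero (norm_mul_conj_lt_one hu ha)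
  have h := ((hasDerivAt_id u).const_sub a).div
    (((hasDerivAt_id u).mul_const (conj a)).const_sub 1) h1
  refine h.congr_deriv ?_
  simp only [id]
  congr 1
  ring

lemma det_smul_one (c : ℂ) : (c • (1 : ℂ →L[ℝ] ℂ)).det = ‖c‖ ^ 2 := by
  have e : ((c • (1 : ℂ →L[ℝ] ℂ) : ℂ →L[ℝ] ℂ) : ℂ →ₗ[ℝ] ℂ) =
      ((c • LinearMap.id : ℂ →ₗ[ℂ] ℂ)).restrictScalars ℝ := by
    ext
    simp
  rw [ContinuousLinearMap.det, e, LinearMap.det_restrictScalars]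
  simp [Algebra.norm_complex_eq, Complex.normSq_eq_norm_sq]

lemma norm_deriv_phi_sq (ha : a ∈ disc) :
    ‖(a * conj a - 1) / (1 - u * conj a) ^ 2‖ ^ 2 =
      (1 - ‖a‖ ^ 2) ^ 2 / ‖1 - u * conj a‖ ^ 4 := by
  rw [norm_div, norm_pow, div_pow, ← pow_mul]
  congr 2
  have : a * conj a - 1 = -((1 - ‖a‖ ^ 2 : ℝ) : ℂ) := by
    rw [Complex.mul_conj, Complex.normSq_eq_norm_sq]
    push_cast
    ring
  rw [this, norm_neg, Complex.norm_real, Real.norm_eq_abs, abs_of_pos (one_sub_norm_sq_pos ha)]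

lemma image_phi (ha : a ∈ disc) : phi a '' disc = disc := by
  ext z
  constructor
  · rintro ⟨u, hu, rfl⟩
    exact phi_mem ha hu
  · exact fun hz => ⟨phi a z, phi_mem ha hz, phi_phi ha hz⟩

lemma injOn_phi (ha : a ∈ disc) : Set.InjOn (phi a) disc := by
  intro x hx y hy hxy
  rw [← phi_phi ha hx, hxy, phi_phi ha hy]

/-- The Jacobian of `phi a` with respect to `ν_α`. -/
def jac (α : ℝ) (a w : ℂ) : ℝ := (1 - ‖a‖ ^ 2) ^ (2 + α) / ‖1 - w * conj a‖ ^ (2 * (2 + α))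

lemma rho_phi_mul (α : ℝ) (ha : a ∈ disc) (hu : u ∈ disc) :
    |(((a * conj a - 1) / (1 - u * conj a) ^ 2) • (1 : ℂ →L[ℝ] ℂ)).det| * rho α (phi a u) =
      rho α u * jac α a u := by
  have hD : 0 < ‖1 - u * conj a‖ := norm_pos_iff.2 (one_sub_ne_zero (norm_mul_conj_lt_one hu ha))
  have hA := one_sub_norm_sq_pos ha
  have hU := one_sub_norm_sq_pos hu
  rw [det_smul_one, abs_of_nonneg (by positivity), norm_deriv_phi_sq ha, rho, rho, jac,
    one_sub_norm_phi_sq ha hu, Real.div_rpow (by positivity) (by positivity),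
    Real.mul_rpow hA.le hU.le, Real.rpow_add hA, mul_add 2, Real.rpow_add hD]
  have e1 : (‖1 - u * conj a‖ ^ 2) ^ α = ‖1 - u * conj a‖ ^ (2 * α) := by
    rw [← Real.rpow_natCast, ← Real.rpow_mul hD.le]
    norm_num
  have e2 : ‖1 - u * conj a‖ ^ ((2 : ℝ) * 2) = ‖1 - u * conj a‖ ^ 4 := by
    rw [← Real.rpow_natCast]
    norm_num
  have e3 : (1 - ‖a‖ ^ 2) ^ (2 : ℝ) = (1 - ‖a‖ ^ 2) ^ 2 := by
    rw [← Real.rpow_natCast]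
    norm_num
  rw [e1, e2, e3]
  field_simp

/-- Change of variables by φ_a, which is its own inverse; |φ_a'|² times the density of ν_α at φ_a(u)
is `jac` times the density at u. -/
lemma integral_comp_phi {α : ℝ} (hα : -1 < α) (ha : a ∈ disc) (G : ℂ → ℂ) :
    ∫ u, G (phi a u) ∂(nuA α) = ∫ w, jac α a w • G w ∂(nuA α) := by
  rw [integral_nuA hα, integral_nuA hα]
  conv_lhs => rw [← image_phi ha]
  rw [integral_image_eq_integral_abs_det_fderiv_smul volume measurableSet_disc
    (fun u hu => (hasDerivAt_phi ha hu).complexToReal_fderiv.hasFDerivWithinAt) (injOn_phi ha)]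
  refine setIntegral_congr_fun measurableSet_disc fun u hu => ?_
  rw [smul_smul, rho_phi_mul α ha hu, phi_phi ha hu, smul_smul]

lemma integrable_comp_phi_iff {α : ℝ} (hα : -1 < α) (ha : a ∈ disc) (G : ℂ → ℂ) :
    Integrable (fun u => G (phi a u)) (nuA α) ↔ Integrable (fun w => jac α a w • G w) (nuA α) := by
  rw [integrable_nuA_iff hα, integrable_nuA_iff hα]
  conv_lhs => rw [← image_phi ha]
  rw [integrableOn_image_iff_integrableOn_abs_det_fderiv_smul volume measurableSet_disc
    (fun u hu => (hasDerivAt_phi ha hu).complexToReal_fderiv.hasFDerivWithinAt) (injOn_phi ha)]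
  refine integrableOn_congr_fun (fun u hu => ?_) measurableSet_disc
  rw [smul_smul, rho_phi_mul α ha hu, phi_phi ha hu, smul_smul]

lemma differentiableOn_phi (ha : a ∈ disc) : DifferentiableOn ℂ (phi a) disc := fun _ hu =>
  (hasDerivAt_phi ha hu).differentiableAt.differentiableWithinAt

end

/-! ### The reproducing property and the Bergman projection -/

lemma ae_norm_kernel_le {α : ℝ} (hα : -1 < α) {z : ℂ} (hz : z ∈ disc) :
    ∀ᵐ w ∂(nuA α), ‖kernel α z w‖ ≤ ((1 - ‖z‖) ^ (2 + α))⁻¹ :=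
  (ae_mem_disc α).mono fun _ hw => norm_kernel_le hα hz hw

lemma aestronglyMeasurable_kernel (α : ℝ) (z : ℂ) :
    AEStronglyMeasurable (fun w => kernel α z w) (nuA α) :=
  ((measurable_kernel α).of_uncurry_left (f := kernel α) (x := z)).aestronglyMeasurable

lemma integrable_mul_kernel {α : ℝ} (hα : -1 < α) {z : ℂ} (hz : z ∈ disc) {h : ℂ → ℂ}
    (hh : Integrable h (nuA α)) : Integrable (fun w => h w * kernel α z w) (nuA α) :=
  hh.mul_bdd (aestronglyMeasurable_kernel α z) (ae_norm_kernel_le hα hz)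

/-- The reproducing property of the Bergman projection. -/
theorem proj_eq_self {α : ℝ} (hα : -1 < α) {F : ℂ → ℂ} (hF : DifferentiableOn ℂ F disc)
    (hFi : Integrable F (nuA α)) {a : ℂ} (ha : a ∈ disc) : proj α F a = F a := by
  set β : ℝ := 2 + α with hβ
  have hA := one_sub_norm_sq_pos ha
  -- The power is chosen so that `jac` times H is (1-|a|²)^β F(w) K(a, w), whereas H ∘ φ_a takes the
  -- value F(a) (1-|a|²)^β at 0. The mean value property for H ∘ φ_a then gives the formula.
  set H : ℂ → ℂ := fun w => F w * (1 - w * conj a) ^ (β : ℂ) with hH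
  have hHd : DifferentiableOn ℂ H disc := by
    refine hF.mul fun w hw => ?_
    have h1 : DifferentiableAt ℂ (fun w => 1 - w * conj a) w := by fun_prop
    exact (h1.cpow_const
      (one_sub_mem_slitPlane (norm_mul_conj_lt_one hw ha))).differentiableWithinAt
  have hJ : ∀ w ∈ disc, jac α a w • H w =
      (((1 - ‖a‖ ^ 2) ^ β : ℝ) : ℂ) * (F w * kernel α a w) := by
    intro w hw
    have hD : 0 < ‖1 - w * conj a‖ := norm_pos_iff.2 (one_sub_ne_zero (norm_mul_conj_lt_one hw ha))
    have hk := conj_kernel α hw ha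
    rw [← hk]
    unfold jac kernel
    set x := (1 - w * conj a) ^ (β : ℂ) with hx
    have hxn : ‖x‖ = ‖1 - w * conj a‖ ^ β := by rw [hx, Complex.norm_cpow_real]
    have hx0 : x ≠ 0 := by
      rw [← norm_pos_iff, hxn]; positivity
    have e : ((‖1 - w * conj a‖ ^ (2 * (2 + α)) : ℝ) : ℂ) = x * conj x := by
      rw [Complex.mul_conj, Complex.normSq_eq_norm_sq, hxn, ← Real.rpow_natCast, ← Real.rpow_mul
        hD.le]
      congr 2
      push_cast
      ring
    have hcx : conj x ≠ 0 := by simpa using hx0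
    rw [Complex.real_smul, Complex.ofReal_div, e, hH]
    simp only [map_div₀, map_one]
    rw [← hx, ← hβ]
    field_simp
  have hint : Integrable (fun u => H (phi a u)) (nuA α) := by
    rw [integrable_comp_phi_iff hα ha]
    refine (integrable_congr ((ae_mem_disc α).mono hJ)).2 ?_
    exact (integrable_mul_kernel hα ha hFi).const_mul _
  have hmean := integral_nuA_eq_zero_value hα
    (hHd.comp (differentiableOn_phi ha) fun u hu => phi_mem ha hu) hint
  have h0 : (H ∘ phi a) 0 = F a * (((1 - ‖a‖ ^ 2) ^ β : ℝ) : ℂ) := by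
    simp only [Function.comp, phi, hH]
    simp only [sub_zero, zero_mul, div_one]
    rw [Complex.mul_conj, Complex.normSq_eq_norm_sq, Complex.ofReal_cpow hA.le]
    push_cast
    rfl
  rw [h0] at hmean
  have h1 : ∫ u, (H ∘ phi a) u ∂(nuA α) = (((1 - ‖a‖ ^ 2) ^ β : ℝ) : ℂ) * proj α F a := by
    have := integral_comp_phi hα ha H
    simp only [Function.comp]
    rw [this, integral_congr_ae ((ae_mem_disc α).mono hJ), integral_const_mul]
    rfl
  rw [h1, mul_comm (F a)] at hmean
  refine mul_left_cancel₀ ?_ hmean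
  rw [Complex.ofReal_ne_zero]
  positivity

lemma kernel_self {α : ℝ} {w : ℂ} (hw : w ∈ disc) :
    kernel α w w = (((1 - ‖w‖ ^ 2) ^ (2 + α))⁻¹ : ℝ) := by
  unfold kernel
  rw [Complex.mul_conj, Complex.normSq_eq_norm_sq, one_div, Complex.ofReal_inv,
    Complex.ofReal_cpow (one_sub_norm_sq_pos hw).le]
  push_cast
  rfl

lemma memLp_kernel {α : ℝ} (hα : -1 < α) {w : ℂ} (hw : w ∈ disc) (s : ℝ≥0∞) :
    MemLp (fun z => kernel α z w) s (nuA α) := by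
  have : Fact (-1 < α) := ⟨hα⟩
  refine MemLp.of_bound (aestronglyMeasurable_of_continuousOn α
    (differentiableOn_kernel α hw).continuousOn) ((1 - ‖w‖) ^ (2 + α))⁻¹ ?_
  filter_upwards [ae_mem_disc α] with z hz
  rw [← conj_kernel α hw hz, Complex.norm_conj]
  exact norm_kernel_le hα hw hz

/-- Since K(w, ζ) is the conjugate of K(ζ, w), the reproducing formula for K_w at w itself computes
the integral of |K_w|² as K(w, w). -/
lemma normA_two_kernel {α : ℝ} (hα : -1 < α) {w : ℂ} (hw : w ∈ disc) :
    (normA 2 α fun ζ => kernel α ζ w).toReal = (1 - ‖w‖ ^ 2) ^ (-((2 + α) / 2)) := by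
  have : Fact (-1 < α) := ⟨hα⟩
  have hA := one_sub_norm_sq_pos hw
  have hrep := proj_eq_self hα (differentiableOn_kernel α hw)
    (memLp_one_iff_integrable.1 (memLp_kernel hα hw 1)) hw
  rw [kernel_self hw] at hrep
  have h1 : ∀ ζ ∈ disc, kernel α ζ w * kernel α w ζ = ((‖kernel α ζ w‖ ^ 2 : ℝ) : ℂ) := by
    intro ζ hζ
    rw [← conj_kernel α hζ hw, Complex.mul_conj, Complex.normSq_eq_norm_sq]
  have h2 : ∫ ζ, ‖kernel α ζ w‖ ^ 2 ∂(nuA α) = ((1 - ‖w‖ ^ 2) ^ (2 + α))⁻¹ := by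
    unfold proj at hrep
    rw [integral_congr_ae ((ae_mem_disc α).mono h1)] at hrep
    have := integral_ofReal (μ := nuA α) (𝕜 := ℂ) (f := fun ζ => ‖kernel α ζ w‖ ^ 2)
    simp only [Complex.coe_algebraMap, RCLike.ofReal] at this
    rw [this] at hrep
    exact_mod_cast hrep
  unfold normA
  rw [(memLp_kernel hα hw _).eLpNorm_eq_integral_rpow_norm (by simp) (by simp),
    ENNReal.toReal_ofReal (by positivity), ENNReal.toReal_ofReal (by norm_num)]
  simp_rw [Real.rpow_two]
  rw [h2, ← Real.rpow_neg hA.le, ← Real.rpow_mul hA.le]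
  congr 1
  ring

lemma differentiableOn_proj {α : ℝ} (hα : -1 < α) {h : ℂ → ℂ} (hh : Integrable h (nuA α)) :
    DifferentiableOn ℂ (proj α h) disc := by
  intro z₀ hz₀
  have hz₀' := mem_disc.1 hz₀
  -- On the ball of radius r < 1, which contains z₀, |1 - z w̄| ≥ 1 - r; this dominates the
  -- derivative of the kernel uniformly in w.
  set r : ℝ := (1 + ‖z₀‖) / 2 with hr
  have hr1 : r < 1 := by rw [hr]; linarith
  have hr0 : ‖z₀‖ < r := by rw [hr]; linarith
  have hs : Metric.ball (0 : ℂ) r ∈ nhds z₀ := Metric.isOpen_ball.mem_nhds (by simpa using hr0)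
  have hsub : Metric.ball (0 : ℂ) r ⊆ disc := Metric.ball_subset_ball hr1.le
  have hder : ∀ z ∈ disc, ∀ w ∈ disc, HasDerivAt (fun z => kernel α z w)
      ((-((2 + α : ℝ) : ℂ)) * (1 - z * conj w) ^ (-((2 + α : ℝ) : ℂ) - 1) * (-(conj w))) z := by
    intro z hz w hw
    have h1 : 1 - z * conj w ∈ Complex.slitPlane :=
      one_sub_mem_slitPlane (norm_mul_conj_lt_one hz hw)
    have h2 : HasDerivAt (fun z => 1 - z * conj w) (-(conj w)) z := by
      simpa using ((hasDerivAt_id z).mul_const (conj w)).const_sub 1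
    have h3 := h2.cpow_const (c := -((2 + α : ℝ) : ℂ)) h1
    refine h3.congr_of_eventuallyEq (Filter.Eventually.of_forall fun x => ?_)
    simp only [kernel]
    rw [Complex.cpow_neg, one_div]
  have key := hasDerivAt_integral_of_dominated_loc_of_deriv_le (μ := nuA α) (x₀ := z₀)
    (F := fun z w => h w * kernel α z w)
    (F' := fun z w => h w * ((-((2 + α : ℝ) : ℂ)) *
      (1 - z * conj w) ^ (-((2 + α : ℝ) : ℂ) - 1) * (-(conj w))))
    (bound := fun w => ‖h w‖ * ((2 + α) * (1 - r) ^ (-(2 + α) - 1)))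
    hs ?_ (integrable_mul_kernel hα hz₀ hh) ?_ ?_ (hh.norm.mul_const _) ?_
  · exact key.2.differentiableAt.differentiableWithinAt
  · exact Filter.Eventually.of_forall fun z => hh.1.mul (aestronglyMeasurable_kernel α z)
  · refine hh.1.mul (Measurable.aestronglyMeasurable ?_)
    have hc : Measurable fun w : ℂ => conj w := Complex.continuous_conj.measurable
    exact (measurable_const.mul ((measurable_const.sub (hc.const_mul z₀)).pow_const _)).mul hc.neg
  · filter_upwards [ae_mem_disc α] with w hw z hz
    have hzr : ‖z‖ < r := by simpa using hz
    rw [mem_disc] at hw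
    rw [norm_mul]
    refine mul_le_mul_of_nonneg_left ?_ (norm_nonneg _)
    have e : (-((2 + α : ℝ) : ℂ) - 1) = ((-(2 + α) - 1 : ℝ) : ℂ) := by push_cast; ring
    rw [norm_mul, norm_mul, norm_neg, norm_neg, e, Complex.norm_cpow_real, Complex.norm_real,
      Real.norm_eq_abs, abs_of_pos (by linarith), Complex.norm_conj]
    have h1 : 1 - r ≤ ‖1 - z * conj w‖ := by
      have := norm_sub_norm_le (1 : ℂ) (z * conj w)
      rw [norm_one, norm_mul, Complex.norm_conj] at this
      nlinarith [norm_nonneg z, norm_nonneg w]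
    have h2 : ‖1 - z * conj w‖ ^ (-(2 + α) - 1) ≤ (1 - r) ^ (-(2 + α) - 1) :=
      Real.rpow_le_rpow_of_nonpos (by linarith) h1 (by linarith)
    have h3 : 0 ≤ (1 - r) ^ (-(2 + α) - 1) := Real.rpow_nonneg (by linarith) _
    have h4 : 0 < 2 + α := by linarith
    calc _ ≤ (2 + α) * (1 - r) ^ (-(2 + α) - 1) * 1 := by gcongr
      _ = _ := mul_one _
  · filter_upwards [ae_mem_disc α] with w hw z hz
    exact (hder z (hsub hz) w hw).const_mul _

/-! ### From (iv) to (i) -/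

section

variable {p q α : ℝ} {f : ℂ → ℂ}

lemma one_div_conj (x : ℂ) : 1 / conj x = conj x⁻¹ := by rw [one_div, map_inv₀]

lemma memLp_one_div_conj {s : ℝ≥0∞} (hfi : MemLp (fun z => (f z)⁻¹) s (nuA α)) :
    MemLp (fun z => 1 / conj (f z)) s (nuA α) := by
  simp_rw [one_div_conj]
  exact hfi.star

lemma weighted_absolutelyContinuous (α : ℝ) (ω : ℂ → ℝ) : weighted α ω ≪ nuA α :=
  withDensity_absolutelyContinuous _ _

lemma eLpNorm_weighted (hp : 0 < p) (hf : AEStronglyMeasurable f (nuA α)) (g : ℂ → ℂ) :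
    eLpNorm g (ENNReal.ofReal p) (weighted α fun z => ‖f z‖ ^ p) =
      eLpNorm (fun z => f z * g z) (ENNReal.ofReal p) (nuA α) := by
  rw [eLpNorm_ofReal hp, eLpNorm_ofReal hp, weighted,
    lintegral_withDensity_eq_lintegral_mul_non_measurable₀]
  · congr 1
    refine lintegral_congr fun z => ?_
    rw [Pi.mul_apply, ofReal_norm_rpow hp.le, enorm_mul, ENNReal.mul_rpow_of_nonneg _ _ hp.le]
  · exact (hf.norm.aemeasurable.pow_const p).ennreal_ofReal
  · exact Filter.Eventually.of_forall fun z => ENNReal.ofReal_lt_top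

lemma norm_proj_le_posProj (α : ℝ) (u : ℂ → ℂ) (z : ℂ) :
    ‖proj α u z‖ ≤ ‖posProj α (fun w => ((‖u w‖ : ℝ) : ℂ)) z‖ := by
  have h1 : posProj α (fun w => ((‖u w‖ : ℝ) : ℂ)) z =
      ((∫ w, ‖u w * kernel α z w‖ ∂(nuA α) : ℝ) : ℂ) := by
    rw [posProj, ← integral_complex_ofReal]
    refine integral_congr_ae (Filter.Eventually.of_forall fun w => ?_)
    simp only [posIntegrand, norm_mul, norm_kernel]
    push_cast
    rw [div_eq_mul_inv]
  rw [h1, Complex.norm_real, Real.norm_eq_abs]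
  exact (norm_integral_le_integral_norm _).trans (le_abs_self _)

lemma integrable_mul_of_memLp {u h : ℂ → ℂ} (hpq : p.HolderConjugate q)
    (hu : MemLp u (ENNReal.ofReal q) (nuA α)) (hh : MemLp h (ENNReal.ofReal p) (nuA α)) :
    Integrable (fun z => u z * h z) (nuA α) := by
  have := hpq.symm.ennrealOfReal
  exact MemLp.integrable_mul hu hh

lemma memLp_mul_toeplitz_of_posProjBounded (hα : -1 < α) (hpq : p.HolderConjugate q)
    (hf0 : ∀ z ∈ disc, f z ≠ 0) (hf : MemBergman p α f)
    (hfi : MemLp (fun z => (f z)⁻¹) (ENNReal.ofReal q) (nuA α))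
    (hB : PosProjBounded p α (fun z => ‖f z‖ ^ p) (fun z => ‖f z‖ ^ p)) :
    ∃ C : ℝ, ∀ h, MemLp h (ENNReal.ofReal p) (nuA α) →
      MemLp (fun z => f z * toeplitz α (fun z => 1 / conj (f z)) h z) (ENNReal.ofReal p) (nuA α) ∧
      eLpNorm (fun z => f z * toeplitz α (fun z => 1 / conj (f z)) h z) (ENNReal.ofReal p) (nuA α)
        ≤ ENNReal.ofReal C * eLpNorm h (ENNReal.ofReal p) (nuA α) := by
  obtain ⟨C, hC⟩ := hB
  refine ⟨C, fun h hh => ?_⟩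
  have hv := memLp_one_div_conj hfi
  have hvh := integrable_mul_of_memLp hpq hv hh
  -- Here |g| = |h|/|f|, so the norm of g in L^p(|f|^p dν_α) is the norm of h in L^p(dν_α).
  set g : ℂ → ℂ := fun w => ((‖1 / conj (f w) * h w‖ : ℝ) : ℂ) with hg
  have hgm : AEStronglyMeasurable g (nuA α) :=
    Complex.continuous_ofReal.comp_aestronglyMeasurable hvh.1.norm
  have hgn : eLpNorm g (ENNReal.ofReal p) (weighted α fun z => ‖f z‖ ^ p) =
      eLpNorm h (ENNReal.ofReal p) (nuA α) := by
    rw [eLpNorm_weighted hpq.pos hf.2.1]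
    refine eLpNorm_congr_norm_ae ?_
    filter_upwards [ae_mem_disc α] with z hz
    have := norm_ne_zero_iff.2 (hf0 z hz)
    simp only [hg, norm_mul, Complex.norm_real, norm_norm, norm_div, norm_one, RCLike.norm_conj]
    field_simp
  have hgL : MemLp g (ENNReal.ofReal p) (weighted α fun z => ‖f z‖ ^ p) :=
    ⟨hgm.mono_ac (weighted_absolutelyContinuous α _), hgn ▸ hh.2⟩
  obtain ⟨-, h2, h3⟩ := hC g hgL
  have hT : eLpNorm (fun z => f z * toeplitz α (fun z => 1 / conj (f z)) h z)
      (ENNReal.ofReal p) (nuA α) ≤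
      eLpNorm (posProj α g) (ENNReal.ofReal p) (weighted α fun z => ‖f z‖ ^ p) := by
    rw [eLpNorm_weighted hpq.pos hf.2.1]
    refine eLpNorm_mono fun z => ?_
    rw [norm_mul, norm_mul]
    exact mul_le_mul_of_nonneg_left (norm_proj_le_posProj α _ z) (norm_nonneg _)
  have hTm : AEStronglyMeasurable (fun z => f z * toeplitz α (fun z => 1 / conj (f z)) h z)
      (nuA α) :=
    hf.2.1.mul (aestronglyMeasurable_of_continuousOn α (differentiableOn_proj hα hvh).continuousOn)
  exact ⟨⟨hTm, hT.trans_lt h2.2⟩, (hT.trans h3).trans_eq (by rw [hgn])⟩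

/-- The product f T is holomorphic and integrable, so the projection reproduces it. -/
lemma toeplitz_eq_mul (hα : -1 < α) (hf : DifferentiableOn ℂ f disc)
    {T : ℂ → ℂ} (hT : DifferentiableOn ℂ T disc) (hfT : Integrable (fun z => f z * T z) (nuA α)) :
    ∀ z ∈ disc, toeplitz α f T z = f z * T z := fun _ hz =>
  proj_eq_self hα (hf.mul hT) hfT hz

lemma MemLp.integrable_nuA (hα : -1 < α) (hp : 1 < p) {h : ℂ → ℂ}
    (hh : MemLp h (ENNReal.ofReal p) (nuA α)) : Integrable h (nuA α) := by
  have : Fact (-1 < α) := ⟨hα⟩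
  exact hh.integrable (by rw [← ENNReal.ofReal_one]; exact ENNReal.ofReal_le_ofReal hp.le)

theorem toeplitzProductBounded_of_posProjBounded (hα : -1 < α) (hpq : p.HolderConjugate q)
    (hf0 : ∀ z ∈ disc, f z ≠ 0) (hf : MemBergman p α f)
    (hfi : MemBergman q α fun z => (f z)⁻¹)
    (hB : PosProjBounded p α (fun z => ‖f z‖ ^ p) (fun z => ‖f z‖ ^ p)) :
    ToeplitzProductBounded p α f fun z => 1 / conj (f z) := by
  obtain ⟨C, hC⟩ := memLp_mul_toeplitz_of_posProjBounded hα hpq hf0 hf hfi.2 hB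
  have hdom : ∀ h, MemBergman p α h → InProductDomain p α f (fun z => 1 / conj (f z)) h :=
    fun h hh => ⟨hh, integrable_mul_of_memLp hpq (memLp_one_div_conj hfi.2) hh.2,
      MemLp.integrable_nuA hα hpq.lt (hC h hh.2).1⟩
  -- The domain is all of A^p_α, so h approximates itself.
  refine ⟨fun h hh ε hε => ⟨h, hdom h hh, ?_⟩, C, fun h hh => ?_⟩
  · simpa [normA] using hε
  · have hdiff := differentiableOn_proj hα hh.2.1
    have heq := toeplitz_eq_mul hα hf.1 hdiff hh.2.2
    have hae : toeplitz α f (toeplitz α (fun z => 1 / conj (f z)) h) =ᵐ[nuA α]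
        fun z => f z * toeplitz α (fun z => 1 / conj (f z)) h z := by
      filter_upwards [ae_mem_disc α] with z hz using heq z hz
    obtain ⟨h1, h2⟩ := hC h hh.1.2
    refine ⟨⟨differentiableOn_proj hα hh.2.2, h1.ae_eq hae.symm⟩, ?_⟩
    rw [normA, eLpNorm_congr_ae hae]
    exact h2

end

/-! ### Expansion of the rank one kernels -/

/-- The Taylor coefficients of `(1 - x) ^ β`. -/
def binCoeff (β : ℝ) (j : ℕ) : ℝ := (-1) ^ j * Ring.choose β j

lemma choose_succ_mul (β : ℝ) (j : ℕ) :
    Ring.choose β (j + 1) * (j + 1) = Ring.choose β j * (β - j) := by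
  rw [Ring.choose_eq_smul, Ring.choose_eq_smul, descPochhammer_succ_right]
  have := Nat.factorial_pos j
  simp only [Nat.factorial_succ, Polynomial.smeval_mul, Polynomial.smeval_sub, Polynomial.smeval_X,
    Polynomial.smeval_natCast, smul_eq_mul, pow_one, pow_zero, nsmul_eq_mul, mul_one]
  push_cast
  field_simp

lemma binCoeff_succ (β : ℝ) (j : ℕ) :
    binCoeff β (j + 1) * (j + 1) = binCoeff β j * (j - β) := by
  have := choose_succ_mul β j
  simp only [binCoeff, pow_succ]
  linear_combination -(-1) ^ j * this

lemma hasSum_binCoeff (β : ℝ) {x : ℂ} (hx : ‖x‖ < 1) :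
    HasSum (fun j => (binCoeff β j : ℂ) * x ^ j) ((1 - x) ^ (β : ℂ)) := by
  have h := (Complex.one_add_cpow_hasFPowerSeriesOnBall_zero (a := (β : ℂ))).hasSum (y := -x)
    (by simpa [← ofReal_norm] using hx)
  simp only [binomialSeries_apply] at h
  rw [zero_add, ← sub_eq_add_neg] at h
  have e : (fun j => (binCoeff β j : ℂ) * x ^ j) =
      fun n => Ring.choose (β : ℂ) n • (List.ofFn fun _ : Fin n => -x).prod := by
    funext j
    simp only [binCoeff, List.ofFn_const, List.prod_replicate, smul_eq_mul, neg_pow x]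
    push_cast
    ring
  rw [e]
  exact h

/-- For j > β the recursion gives β|c_j| = j|c_j| - (j+1)|c_{j+1}|, so the partial sums telescope.
-/
lemma summable_abs_binCoeff {β : ℝ} (hβ : 0 < β) : Summable fun j => |binCoeff β j| := by
  obtain ⟨N, hN⟩ := exists_nat_gt β
  rw [← summable_nat_add_iff N]
  have hdec : ∀ j : ℕ, β * |binCoeff β (j + N)| =
      (j + N : ℕ) * |binCoeff β (j + N)| - (j + 1 + N : ℕ) * |binCoeff β (j + 1 + N)| := by
    intro j
    have h1 := congrArg abs (binCoeff_succ β (j + N))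
    rw [abs_mul, abs_mul, abs_of_nonneg (by positivity : (0 : ℝ) ≤ ((j + N : ℕ) : ℝ) + 1),
      abs_of_nonneg (by push_cast; linarith [(Nat.cast_nonneg j : (0:ℝ) ≤ j)] :
        (0 : ℝ) ≤ ((j + N : ℕ) : ℝ) - β)] at h1
    rw [show j + 1 + N = j + N + 1 by ring]
    rw [Nat.cast_add_one]
    linarith
  refine summable_of_sum_range_le (c := N * |binCoeff β N| / β) (fun _ => abs_nonneg _) fun n => ?_
  rw [le_div_iff₀' hβ, Finset.mul_sum, Finset.sum_congr rfl fun j _ => hdec j]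
  rw [Finset.sum_range_sub' (fun j => ((j + N : ℕ) : ℝ) * |binCoeff β (j + N)|)]
  simp only [zero_add]
  have : 0 ≤ ((n + N : ℕ) : ℝ) * |binCoeff β (n + N)| := by positivity
  linarith

lemma one_sub_phi_mul_conj_phi {z w ζ : ℂ} (hz : z ∈ disc) (hw : w ∈ disc) (hζ : ζ ∈ disc) :
    (1 - phi w z * conj (phi w ζ)) * (1 - z * conj w) * (1 - w * conj ζ) =
      ((1 - ‖w‖ ^ 2 : ℝ) : ℂ) * (1 - z * conj ζ) := by
  have h1 := one_sub_ne_zero (norm_mul_conj_lt_one hz hw)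
  have h2 := one_sub_ne_zero (norm_mul_conj_lt_one hw hζ)
  have h3 : ((‖w‖ : ℂ)) ^ 2 = w * conj w := by rw [Complex.mul_conj, Complex.normSq_eq_norm_sq]; push_cast; rfl
  have h4 : 1 - conj ζ * w ≠ 0 := by rwa [mul_comm]
  simp only [phi, map_div₀, map_sub, map_one, map_mul, Complex.conj_conj]
  push_cast
  rw [h3]
  field_simp
  ring

lemma abs_arg_one_sub_lt {u : ℂ} (hu : ‖u‖ < 1) : |(1 - u).arg| < Real.pi / 2 :=
  Complex.abs_arg_lt_pi_div_two_iff.2 (Or.inl (re_one_sub_pos hu))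

/-- The principal logarithms of the two sides of h agree up to 2πin. All four arguments lie in
(-π/2, π/2), so the imaginary parts differ by less than 2π and n = 0; hence the identity survives
real powers. -/
lemma cpow_identity {A β : ℝ} (hA : 0 < A) {x a b c : ℂ} (hx : ‖x‖ < 1) (ha : ‖a‖ < 1)
    (hb : ‖b‖ < 1) (hc : ‖c‖ < 1) (h : (1 - x) * (1 - a) * (1 - b) = A * (1 - c)) :
    (1 - x) ^ (β : ℂ) * (1 - a) ^ (β : ℂ) * (1 - b) ^ (β : ℂ) =
      ((A ^ β : ℝ) : ℂ) * (1 - c) ^ (β : ℂ) := by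
  have hx0 := one_sub_ne_zero hx
  have ha0 := one_sub_ne_zero ha
  have hb0 := one_sub_ne_zero hb
  have hc0 := one_sub_ne_zero hc
  have hlog : Complex.log (1 - x) + Complex.log (1 - a) + Complex.log (1 - b) =
      (Real.log A : ℂ) + Complex.log (1 - c) := by
    have he : Complex.exp (Complex.log (1 - x) + Complex.log (1 - a) + Complex.log (1 - b)) =
        Complex.exp ((Real.log A : ℂ) + Complex.log (1 - c)) := by
      rw [Complex.exp_add, Complex.exp_add, Complex.exp_add, Complex.exp_log hx0,
        Complex.exp_log ha0, Complex.exp_log hb0, Complex.exp_log hc0, ← Complex.ofReal_exp,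
        Real.exp_log hA, h]
    obtain ⟨n, hn⟩ := Complex.exp_eq_exp_iff_exists_int.1 he
    have him := congrArg Complex.im hn
    simp only [Complex.add_im, Complex.log_im, Complex.ofReal_im, zero_add] at him
    have e : (((n : ℂ) * (2 * Real.pi * Complex.I))).im = n * (2 * Real.pi) := by simp
    rw [e] at him
    have b1 := abs_lt.1 (abs_arg_one_sub_lt hx)
    have b2 := abs_lt.1 (abs_arg_one_sub_lt ha)
    have b3 := abs_lt.1 (abs_arg_one_sub_lt hb)
    have b4 := abs_lt.1 (abs_arg_one_sub_lt hc)
    have hpi := Real.pi_pos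
    have n1 : (n : ℝ) < 1 := by nlinarith
    have n2 : (-1 : ℝ) < n := by nlinarith
    have n1' : n < 1 := by exact_mod_cast n1
    have n2' : -1 < n := by exact_mod_cast n2
    obtain rfl : n = 0 := by omega
    simpa using hn
  rw [Complex.cpow_def_of_ne_zero hx0, Complex.cpow_def_of_ne_zero ha0,
    Complex.cpow_def_of_ne_zero hb0, Complex.cpow_def_of_ne_zero hc0, Real.rpow_def_of_pos hA,
    Complex.ofReal_exp, ← Complex.exp_add, ← Complex.exp_add, ← Complex.exp_add]
  congr 1
  push_cast
  linear_combination (β : ℂ) * hlog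

lemma norm_phi_lt_one {w z : ℂ} (hw : w ∈ disc) (hz : z ∈ disc) : ‖phi w z‖ < 1 :=
  mem_disc.1 (phi_mem hw hz)

/-- Expansion of a rank one kernel in the functions `φ_w ^ j`. -/
lemma hasSum_binCoeff_kernel (α : ℝ) {z w ζ : ℂ} (hz : z ∈ disc) (hw : w ∈ disc) (hζ : ζ ∈ disc) :
    HasSum (fun j => (binCoeff (2 + α) j : ℂ) * (phi w z * conj (phi w ζ)) ^ j * kernel α z ζ)
      (((1 - ‖w‖ ^ 2) ^ (2 + α) : ℝ) * (kernel α z w * kernel α w ζ)) := by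
  have hx : ‖phi w z * conj (phi w ζ)‖ < 1 := norm_mul_conj_lt_one (phi_mem hw hz) (phi_mem hw hζ)
  have h := cpow_identity (β := 2 + α) (one_sub_norm_sq_pos hw) hx (norm_mul_conj_lt_one hz hw)
    (norm_mul_conj_lt_one hw hζ) (norm_mul_conj_lt_one hz hζ) (one_sub_phi_mul_conj_phi hz hw hζ)
  have e : (((1 - ‖w‖ ^ 2) ^ (2 + α) : ℝ) : ℂ) * (kernel α z w * kernel α w ζ) =
      (1 - phi w z * conj (phi w ζ)) ^ ((2 + α : ℝ) : ℂ) * kernel α z ζ := by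
    have h1 := kernel_ne_zero α hz hw
    have h2 := kernel_ne_zero α hw hζ
    have h3 := kernel_ne_zero α hz hζ
    simp only [kernel, one_div, ne_eq, inv_eq_zero] at h1 h2 h3 ⊢
    field_simp
    linear_combination -h
  rw [e]
  exact (hasSum_binCoeff (2 + α) hx).mul_right (kernel α z ζ)

/-! ### Extension of the Toeplitz bound to A^p_α and to L^p -/

section

variable {p q α : ℝ} {f : ℂ → ℂ}

lemma lintegral_enorm_mul_le (hpq : p.HolderConjugate q) {u h : ℂ → ℂ}
    (hu : AEStronglyMeasurable u (nuA α)) (hh : AEStronglyMeasurable h (nuA α)) :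
    ∫⁻ w, ‖u w‖ₑ * ‖h w‖ₑ ∂(nuA α) ≤
      eLpNorm u (ENNReal.ofReal q) (nuA α) * eLpNorm h (ENNReal.ofReal p) (nuA α) := by
  rw [eLpNorm_ofReal hpq.pos, eLpNorm_ofReal hpq.symm.pos]
  exact ENNReal.lintegral_mul_le_Lp_mul_Lq _ hpq.symm hu.enorm hh.enorm

lemma ae_enorm_kernel_le (hα : -1 < α) {z : ℂ} (hz : z ∈ disc) :
    ∀ᵐ w ∂(nuA α), ‖kernel α z w‖ₑ ≤ ENNReal.ofReal ((1 - ‖z‖) ^ (2 + α))⁻¹ := by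
  filter_upwards [ae_mem_disc α] with w hw
  rw [← ofReal_norm]
  exact ENNReal.ofReal_le_ofReal (norm_kernel_le hα hz hw)

lemma enorm_toeplitz_le (hα : -1 < α) (hpq : p.HolderConjugate q) {v h : ℂ → ℂ}
    (hv : AEStronglyMeasurable v (nuA α)) (hh : AEStronglyMeasurable h (nuA α)) {z : ℂ}
    (hz : z ∈ disc) :
    ‖toeplitz α v h z‖ₑ ≤ ENNReal.ofReal ((1 - ‖z‖) ^ (2 + α))⁻¹ *
      (eLpNorm v (ENNReal.ofReal q) (nuA α) * eLpNorm h (ENNReal.ofReal p) (nuA α)) := by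
  refine (enorm_integral_le_lintegral_enorm _).trans ?_
  calc ∫⁻ w, ‖v w * h w * kernel α z w‖ₑ ∂(nuA α)
      ≤ ∫⁻ w, ENNReal.ofReal ((1 - ‖z‖) ^ (2 + α))⁻¹ * (‖v w‖ₑ * ‖h w‖ₑ) ∂(nuA α) := by
        refine lintegral_mono_ae ?_
        filter_upwards [ae_enorm_kernel_le hα hz] with w hw
        rw [enorm_mul, enorm_mul, mul_comm]
        exact mul_le_mul_left hw _
    _ ≤ _ := by
        rw [lintegral_const_mul' _ _ ENNReal.ofReal_ne_top]
        exact mul_le_mul_right (lintegral_enorm_mul_le hpq hv hh) _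

lemma toeplitz_sub (hα : -1 < α) {v h k : ℂ → ℂ} {z : ℂ} (hz : z ∈ disc)
    (hh : Integrable (fun w => v w * h w) (nuA α)) (hk : Integrable (fun w => v w * k w) (nuA α)) :
    toeplitz α v (fun w => h w - k w) z = toeplitz α v h z - toeplitz α v k z := by
  simp only [toeplitz, proj]
  rw [← integral_sub (integrable_mul_kernel hα hz hh) (integrable_mul_kernel hα hz hk)]
  congr 1
  funext w
  ring

/-- On the domain the outer operator is multiplication by f. Domain elements tending to h in norm
have T_v-images converging pointwise to T_v h, since K(z, ·) is bounded for fixed z; Fatou then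
passes the bound to h, which need not be in the domain. -/
lemma exists_eLpNorm_mul_toeplitz_le (hα : -1 < α) (hpq : p.HolderConjugate q)
    (hf : MemBergman p α f) {v : ℂ → ℂ} (hv : MemLp v (ENNReal.ofReal q) (nuA α))
    (hT : ToeplitzProductBounded p α f v) :
    ∃ C : ℝ, ∀ h, MemBergman p α h →
      eLpNorm (fun z => f z * toeplitz α v h z) (ENNReal.ofReal p) (nuA α) ≤
        ENNReal.ofReal C * eLpNorm h (ENNReal.ofReal p) (nuA α) := by
  obtain ⟨hdense, C, hC⟩ := hT
  have hdom : ∀ h, InProductDomain p α f v h →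
      eLpNorm (fun z => f z * toeplitz α v h z) (ENNReal.ofReal p) (nuA α) ≤
        ENNReal.ofReal C * eLpNorm h (ENNReal.ofReal p) (nuA α) := by
    intro h hh
    refine le_trans (le_of_eq (eLpNorm_congr_ae ?_)) (hC h hh).2
    filter_upwards [ae_mem_disc α] with z hz
    exact (toeplitz_eq_mul hα hf.1 (differentiableOn_proj hα hh.2.1) hh.2.2 z hz).symm
  refine ⟨C, fun h hh => ?_⟩
  choose k hk hkn using fun n : ℕ => hdense h hh ((n : ℝ≥0∞) + 1)⁻¹ (by simp)
  have hp1 : 1 ≤ ENNReal.ofReal p := by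
    rw [← ENNReal.ofReal_one]; exact ENNReal.ofReal_le_ofReal hpq.lt.le
  have hinv : Filter.Tendsto (fun n : ℕ => ((n : ℝ≥0∞) + 1)⁻¹) Filter.atTop (nhds 0) := by
    have := (Filter.tendsto_add_atTop_iff_nat 1).2 ENNReal.tendsto_inv_nat_nhds_zero
    simpa using this
  have hsub : ∀ n, eLpNorm (fun z => h z - k n z) (ENNReal.ofReal p) (nuA α) ≤
      ((n : ℝ≥0∞) + 1)⁻¹ := fun n => (hkn n).le
  have hlim : ∀ᵐ z ∂(nuA α), Filter.Tendsto (fun n => f z * toeplitz α v (k n) z) Filter.atTop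
      (nhds (f z * toeplitz α v h z)) := by
    filter_upwards [ae_mem_disc α] with z hz
    refine Filter.Tendsto.const_mul _ ?_
    rw [tendsto_iff_edist_tendsto_0]
    set A : ℝ≥0∞ := ENNReal.ofReal ((1 - ‖z‖) ^ (2 + α))⁻¹ *
      eLpNorm v (ENNReal.ofReal q) (nuA α) with hA
    have hA' : A ≠ ⊤ := ENNReal.mul_ne_top ENNReal.ofReal_ne_top hv.2.ne
    have h0 : Filter.Tendsto (fun n : ℕ => A * ((n : ℝ≥0∞) + 1)⁻¹) Filter.atTop (nhds 0) := by
      simpa using ENNReal.Tendsto.const_mul hinv (Or.inr hA')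
    refine tendsto_of_tendsto_of_tendsto_of_le_of_le tendsto_const_nhds h0
      (fun _ => zero_le) fun n => ?_
    simp only
    rw [edist_comm, edist_eq_enorm_sub, ← toeplitz_sub hα hz
      (integrable_mul_of_memLp hpq hv hh.2) (integrable_mul_of_memLp hpq hv (hk n).1.2)]
    refine (enorm_toeplitz_le hα hpq hv.1 (hh.2.1.sub (hk n).1.2.1) hz).trans ?_
    rw [← mul_assoc]
    exact mul_le_mul_right (hsub n) _
  refine (Lp.eLpNorm_lim_le_liminf_eLpNorm (fun n => ?_) _ hlim).trans ?_
  · exact hf.2.1.mul (aestronglyMeasurable_of_continuousOn α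
      (differentiableOn_proj hα (hk n).2.1).continuousOn)
  · have hr : Filter.Tendsto (fun n : ℕ => ENNReal.ofReal C *
        (eLpNorm h (ENNReal.ofReal p) (nuA α) + ((n : ℝ≥0∞) + 1)⁻¹)) Filter.atTop
        (nhds (ENNReal.ofReal C * eLpNorm h (ENNReal.ofReal p) (nuA α))) := by
      refine ENNReal.Tendsto.const_mul ?_ (Or.inr ENNReal.ofReal_ne_top)
      simpa using tendsto_const_nhds.add hinv
    rw [← hr.liminf_eq]
    refine Filter.liminf_le_liminf (Filter.Eventually.of_forall fun n => ?_)
    refine (hdom _ (hk n)).trans (mul_le_mul_right ?_ _)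
    have e : k n = h - fun z => h z - k n z := by funext z; simp
    calc eLpNorm (k n) (ENNReal.ofReal p) (nuA α)
        = eLpNorm (h - fun z => h z - k n z) (ENNReal.ofReal p) (nuA α) := by rw [← e]
      _ ≤ _ := (eLpNorm_sub_le hh.2.1 (hh.2.1.sub (hk n).1.2.1) hp1).trans
          (add_le_add_right (hsub n) _)

lemma exists_lintegral_posKernel_rpow_le (hα : -1 < α) (hpq : p.HolderConjugate q) :
    ∃ C : ℝ≥0∞, C ≠ ⊤ ∧ ∀ H : ℂ → ℂ, AEStronglyMeasurable H (nuA α) →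
      (∫⁻ z, (∫⁻ w, posKernel (2 + α) z w * ‖H w‖ₑ ∂(nuA α)) ^ p ∂(nuA α)) ^ (1 / p) ≤
        C * eLpNorm H (ENNReal.ofReal p) (nuA α) := by
  obtain ⟨C, hC, hCh⟩ := exists_lintegral_posKernel_nuA_le hα hpq
  refine ⟨C ^ (1 / p), ENNReal.rpow_ne_top_of_nonneg (by simpa using hpq.nonneg) hC,
    fun H hH => ?_⟩
  rw [eLpNorm_ofReal hpq.pos, ← ENNReal.mul_rpow_of_nonneg _ _ (by simpa using hpq.nonneg)]
  exact ENNReal.rpow_le_rpow (hCh _ hH.enorm) (by simpa using hpq.nonneg)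

lemma exists_proj_bounded (hα : -1 < α) (hpq : p.HolderConjugate q) :
    ∃ C : ℝ≥0∞, C ≠ ⊤ ∧ ∀ H : ℂ → ℂ, MemLp H (ENNReal.ofReal p) (nuA α) →
      MemBergman p α (proj α H) ∧ eLpNorm (proj α H) (ENNReal.ofReal p) (nuA α) ≤
        C * eLpNorm H (ENNReal.ofReal p) (nuA α) := by
  obtain ⟨C, hC, hCh⟩ := exists_lintegral_posKernel_rpow_le hα hpq
  refine ⟨C, hC, fun H hH => ?_⟩
  have hd := differentiableOn_proj hα (MemLp.integrable_nuA hα hpq.lt hH)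
  have hle : eLpNorm (proj α H) (ENNReal.ofReal p) (nuA α) ≤
      C * eLpNorm H (ENNReal.ofReal p) (nuA α) := by
    refine le_trans ?_ (hCh H hH.1)
    rw [eLpNorm_ofReal hpq.pos]
    refine ENNReal.rpow_le_rpow (lintegral_mono fun z => ENNReal.rpow_le_rpow ?_ hpq.nonneg)
      (by simpa using hpq.nonneg)
    refine (enorm_integral_le_lintegral_enorm _).trans (lintegral_mono fun w => ?_)
    rw [enorm_mul, enorm_kernel, mul_comm]
  exact ⟨⟨hd, aestronglyMeasurable_of_continuousOn α hd.continuousOn,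
    hle.trans_lt (ENNReal.mul_lt_top hC.lt_top hH.2)⟩, hle⟩

lemma aestronglyMeasurable_kernel_prod (α : ℝ) :
    AEStronglyMeasurable (fun x : ℂ × ℂ => kernel α x.1 x.2) ((nuA α).prod (nuA α)) :=
  (measurable_kernel α).aestronglyMeasurable

/-- Justifies Fubini in `toeplitz_proj`: K(z, ·) is bounded, and Hölder pairs v in L^q with P⁺|H|,
which is in L^p by the unweighted bound. -/
lemma integrable_prod_kernel (hα : -1 < α) (hpq : p.HolderConjugate q) {v H : ℂ → ℂ}
    (hv : MemLp v (ENNReal.ofReal q) (nuA α)) (hH : MemLp H (ENNReal.ofReal p) (nuA α)) {z : ℂ}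
    (hz : z ∈ disc) :
    Integrable (fun x : ℂ × ℂ => v x.1 * (H x.2 * kernel α x.1 x.2) * kernel α z x.1)
      ((nuA α).prod (nuA α)) := by
  have : Fact (-1 < α) := ⟨hα⟩
  have hm : AEStronglyMeasurable
      (fun x : ℂ × ℂ => v x.1 * (H x.2 * kernel α x.1 x.2) * kernel α z x.1)
      ((nuA α).prod (nuA α)) :=
    (hv.1.comp_fst.mul (hH.1.comp_snd.mul (aestronglyMeasurable_kernel_prod α))).mul
      (aestronglyMeasurable_kernel α z).comp_fst
  obtain ⟨C, hC, hCh⟩ := exists_lintegral_posKernel_rpow_le hα hpq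
  have hPm : Measurable (fun w : ℂ × ℂ => posKernel (2 + α) w.1 w.2) := by
    simp_rw [← enorm_kernel]; exact (measurable_kernel α).enorm
  have hPHm : AEMeasurable (fun w => ∫⁻ ζ, posKernel (2 + α) w ζ * ‖H ζ‖ₑ ∂(nuA α)) (nuA α) :=
    (hPm.aemeasurable.mul hH.1.comp_snd.enorm).lintegral_prod_right'
  refine ⟨hm, ?_⟩
  rw [HasFiniteIntegral, lintegral_prod _ hm.enorm]
  calc ∫⁻ w, ∫⁻ ζ, ‖v w * (H ζ * kernel α w ζ) * kernel α z w‖ₑ ∂(nuA α) ∂(nuA α)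
      ≤ ∫⁻ w, ENNReal.ofReal ((1 - ‖z‖) ^ (2 + α))⁻¹ *
          (‖v w‖ₑ * ∫⁻ ζ, posKernel (2 + α) w ζ * ‖H ζ‖ₑ ∂(nuA α)) ∂(nuA α) := by
        refine lintegral_mono_ae ?_
        filter_upwards [ae_enorm_kernel_le hα hz] with w hw
        rw [← mul_assoc, ← lintegral_const_mul']
        · refine lintegral_mono fun ζ => ?_
          rw [enorm_mul, enorm_mul, enorm_mul, enorm_kernel α w]
          calc _ = ‖kernel α z w‖ₑ * ‖v w‖ₑ * (posKernel (2 + α) w ζ * ‖H ζ‖ₑ) := by ring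
            _ ≤ _ := mul_le_mul_left (mul_le_mul_left hw _) _
        · exact ENNReal.mul_ne_top ENNReal.ofReal_ne_top enorm_ne_top
    _ ≤ ENNReal.ofReal ((1 - ‖z‖) ^ (2 + α))⁻¹ * (eLpNorm v (ENNReal.ofReal q) (nuA α) *
          (C * eLpNorm H (ENNReal.ofReal p) (nuA α))) := by
        rw [lintegral_const_mul' _ _ ENNReal.ofReal_ne_top]
        refine mul_le_mul_right ?_ _
        refine (ENNReal.lintegral_mul_le_Lp_mul_Lq _ hpq.symm hv.1.enorm hPHm).trans ?_
        rw [eLpNorm_ofReal hpq.symm.pos]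
        exact mul_le_mul_right (hCh H hH.1) _
    _ < ⊤ := ENNReal.mul_lt_top ENNReal.ofReal_lt_top
        (ENNReal.mul_lt_top hv.2 (ENNReal.mul_lt_top hC.lt_top hH.2))

/-- Adjointness: the projection may be dropped inside a Toeplitz operator with antiholomorphic
symbol. -/
lemma toeplitz_proj (hα : -1 < α) (hpq : p.HolderConjugate q) {g H : ℂ → ℂ}
    (hg : MemBergman q α g) (hH : MemLp H (ENNReal.ofReal p) (nuA α)) {z : ℂ} (hz : z ∈ disc) :
    toeplitz α (fun w => conj (g w)) (proj α H) z = toeplitz α (fun w => conj (g w)) H z := by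
  have : Fact (-1 < α) := ⟨hα⟩
  have hint := integrable_prod_kernel hα hpq hg.2.star hH hz
  -- The conjugate of the reproducing formula at ζ for the holomorphic function g K(·, z).
  have hrep : ∀ ζ ∈ disc, ∫ w, conj (g w) * kernel α w ζ * kernel α z w ∂(nuA α) =
      conj (g ζ) * kernel α z ζ := by
    intro ζ hζ
    have hgi := MemLp.integrable_nuA hα hpq.symm.lt hg.2
    have hGi : Integrable (fun w => g w * kernel α w z) (nuA α) := by
      refine (integrable_mul_kernel hα hz hgi).congr' ?_ ?_
      · exact hgi.1.mul (memLp_kernel hα hz 1).1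
      · filter_upwards [ae_mem_disc α] with w hw
        rw [norm_mul, norm_mul, ← conj_kernel α hz hw, RCLike.norm_conj]
    have h1 := proj_eq_self hα (hg.1.mul (differentiableOn_kernel α hz)) hGi hζ
    have h2 := congrArg conj h1
    rw [proj, ← integral_conj] at h2
    simp only [Pi.mul_apply, map_mul] at h2
    rw [conj_kernel α hζ hz] at h2
    rw [← h2]
    refine integral_congr_ae ?_
    filter_upwards [ae_mem_disc α] with w hw
    rw [conj_kernel α hw hz, conj_kernel α hζ hw]
    ring
  calc toeplitz α (fun w => conj (g w)) (proj α H) z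
      = ∫ w, ∫ ζ, conj (g w) * (H ζ * kernel α w ζ) * kernel α z w ∂(nuA α) ∂(nuA α) := by
        simp only [toeplitz, proj]
        refine integral_congr_ae (Filter.Eventually.of_forall fun w => ?_)
        simp only
        rw [integral_mul_const, integral_const_mul]
    _ = ∫ ζ, ∫ w, conj (g w) * (H ζ * kernel α w ζ) * kernel α z w ∂(nuA α) ∂(nuA α) :=
        integral_integral_swap hint
    _ = toeplitz α (fun w => conj (g w)) H z := by
        refine integral_congr_ae ?_
        filter_upwards [ae_mem_disc α] with ζ hζ
        have e : ∀ w, conj (g w) * (H ζ * kernel α w ζ) * kernel α z w =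
          H ζ * (conj (g w) * kernel α w ζ * kernel α z w) := fun w => by ring
        simp_rw [e]
        rw [integral_const_mul, hrep ζ hζ]
        ring

/-- If the Toeplitz product is bounded on the Bergman space, then it is bounded on `L^p`. -/
lemma exists_eLpNorm_mul_toeplitz_le_of_memLp (hα : -1 < α) (hpq : p.HolderConjugate q)
    (hf : MemBergman p α f) {g : ℂ → ℂ} (hg : MemBergman q α g)
    (hT : ToeplitzProductBounded p α f fun z => conj (g z)) :
    ∃ C : ℝ≥0∞, C ≠ ⊤ ∧ ∀ H, MemLp H (ENNReal.ofReal p) (nuA α) →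
      eLpNorm (fun z => f z * toeplitz α (fun z => conj (g z)) H z) (ENNReal.ofReal p) (nuA α) ≤
        C * eLpNorm H (ENNReal.ofReal p) (nuA α) := by
  obtain ⟨C, hC⟩ := exists_eLpNorm_mul_toeplitz_le hα hpq hf hg.2.star hT
  obtain ⟨D, hD, hDH⟩ := exists_proj_bounded hα hpq
  refine ⟨ENNReal.ofReal C * D, ENNReal.mul_ne_top ENNReal.ofReal_ne_top hD, fun H hH => ?_⟩
  obtain ⟨h1, h2⟩ := hDH H hH
  have e : eLpNorm (fun z => f z * toeplitz α (fun z => conj (g z)) H z) (ENNReal.ofReal p) (nuA α)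
      = eLpNorm (fun z => f z * toeplitz α (fun z => conj (g z)) (proj α H) z)
        (ENNReal.ofReal p) (nuA α) := by
    refine eLpNorm_congr_ae ?_
    filter_upwards [ae_mem_disc α] with z hz
    rw [toeplitz_proj hα hpq hg hH hz]
  rw [e, mul_assoc]
  exact (hC _ h1).trans (mul_le_mul_right h2 _)

end

/-! ### From (i) to (ii) -/

section

variable {p q α : ℝ} {f : ℂ → ℂ}

lemma normA_mul_normKernel (hα : -1 < α) {w : ℂ} (hw : w ∈ disc) (s : ℝ) (g : ℂ → ℂ) :
    normA s α (fun z => g z * normKernel α w z) =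
      ENNReal.ofReal ((1 - ‖w‖ ^ 2) ^ ((2 + α) / 2)) *
        normA s α fun z => g z * kernel α z w := by
  have hA := one_sub_norm_sq_pos hw
  have e : (fun z => g z * normKernel α w z) =
      (((1 - ‖w‖ ^ 2) ^ ((2 + α) / 2) : ℝ) : ℂ) • fun z => g z * kernel α z w := by
    funext z
    rw [normKernel, normA_two_kernel hα hw, Real.rpow_neg hA.le, Complex.ofReal_inv, div_inv_eq_mul]
    simp only [Pi.smul_apply, smul_eq_mul]
    ring
  rw [normA, e, eLpNorm_const_smul, normA, ← ofReal_norm, Complex.norm_real, Real.norm_eq_abs,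
    abs_of_pos (Real.rpow_pos_of_pos hA _)]

lemma aestronglyMeasurable_phi (α : ℝ) {w : ℂ} (hw : w ∈ disc) :
    AEStronglyMeasurable (phi w) (nuA α) :=
  aestronglyMeasurable_of_continuousOn α (differentiableOn_phi hw).continuousOn

lemma ae_norm_phi_pow_le_one (α : ℝ) {w : ℂ} (hw : w ∈ disc) (j : ℕ) :
    ∀ᵐ z ∂(nuA α), ‖phi w z ^ j‖ ≤ 1 := by
  filter_upwards [ae_mem_disc α] with z hz
  rw [norm_pow]
  exact pow_le_one₀ (norm_nonneg _) (norm_phi_lt_one hw hz).le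

lemma memLp_mul_conj_phi_pow {w : ℂ} (hw : w ∈ disc) {s : ℝ≥0∞} {H : ℂ → ℂ}
    (hH : MemLp H s (nuA α)) (j : ℕ) :
    MemLp (fun ζ => H ζ * conj (phi w ζ) ^ j) s (nuA α) ∧
      eLpNorm (fun ζ => H ζ * conj (phi w ζ) ^ j) s (nuA α) ≤ eLpNorm H s (nuA α) := by
  have hle : ∀ᵐ ζ ∂(nuA α), ‖H ζ * conj (phi w ζ) ^ j‖ ≤ ‖H ζ‖ := by
    filter_upwards [ae_norm_phi_pow_le_one α hw j] with ζ h
    rw [norm_mul, ← map_pow, RCLike.norm_conj]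
    exact mul_le_of_le_one_right (norm_nonneg _) h
  have hm : AEStronglyMeasurable (fun ζ => H ζ * conj (phi w ζ) ^ j) (nuA α) :=
    hH.1.mul ((aestronglyMeasurable_phi α hw).star.pow j)
  exact ⟨hH.of_le hm hle, eLpNorm_mono_ae hle⟩

/-- Termwise integration of `hasSum_binCoeff_kernel` against v H; |φ_w| < 1 and the summability of
the coefficients supply the dominating series. -/
lemma hasSum_phi_pow_mul_toeplitz (hα : -1 < α) {v H : ℂ → ℂ}
    (hvH : Integrable (fun ζ => v ζ * H ζ) (nuA α)) {z w : ℂ} (hz : z ∈ disc) (hw : w ∈ disc) :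
    HasSum (fun j => (binCoeff (2 + α) j : ℂ) * phi w z ^ j *
        toeplitz α v (fun ζ => H ζ * conj (phi w ζ) ^ j) z)
      (((1 - ‖w‖ ^ 2) ^ (2 + α) : ℝ) * kernel α z w * toeplitz α v H w) := by
  have hsum := summable_abs_binCoeff (β := 2 + α) (by linarith)
  have hint := integrable_mul_kernel hα hz hvH
  have hphi := norm_phi_lt_one hw hz
  have key := hasSum_integral_of_dominated_convergence (μ := nuA α)
    (F := fun j ζ => v ζ * H ζ * ((binCoeff (2 + α) j : ℂ) * (phi w z * conj (phi w ζ)) ^ j *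
      kernel α z ζ))
    (f := fun ζ => v ζ * H ζ * ((((1 - ‖w‖ ^ 2) ^ (2 + α) : ℝ) : ℂ) *
      (kernel α z w * kernel α w ζ)))
    (fun j ζ => |binCoeff (2 + α) j| * ‖v ζ * H ζ * kernel α z ζ‖) ?_ ?_ ?_ ?_ ?_
  · have e1 : ∫ ζ, v ζ * H ζ * ((((1 - ‖w‖ ^ 2) ^ (2 + α) : ℝ) : ℂ) *
        (kernel α z w * kernel α w ζ)) ∂(nuA α) =
        ((1 - ‖w‖ ^ 2) ^ (2 + α) : ℝ) * kernel α z w * toeplitz α v H w := by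
      rw [toeplitz, proj, ← integral_const_mul]
      congr 1
      funext ζ
      ring
    have e2 : ∀ j : ℕ, ∫ ζ, v ζ * H ζ * ((binCoeff (2 + α) j : ℂ) *
        (phi w z * conj (phi w ζ)) ^ j * kernel α z ζ) ∂(nuA α) =
        (binCoeff (2 + α) j : ℂ) * phi w z ^ j *
        toeplitz α v (fun ζ => H ζ * conj (phi w ζ) ^ j) z := by
      intro j
      rw [toeplitz, proj, ← integral_const_mul]
      congr 1
      funext ζ
      ring
    rw [e1] at key
    simpa only [e2] using key
  · intro j
    refine hvH.1.mul ((AEStronglyMeasurable.const_mul ?_ _).mul (aestronglyMeasurable_kernel α z))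
    exact (((aestronglyMeasurable_phi α hw).star).const_mul _).pow j
  · intro j
    filter_upwards [ae_norm_phi_pow_le_one α hw j] with ζ h
    simp only [norm_mul, norm_pow, RCLike.norm_conj, Complex.norm_real, Real.norm_eq_abs,
      mul_pow] at h ⊢
    have h2 : ‖phi w z‖ ^ j ≤ 1 := pow_le_one₀ (norm_nonneg _) hphi.le
    have h3 : ‖phi w z‖ ^ j * ‖phi w ζ‖ ^ j ≤ 1 := mul_le_one₀ h2 (by positivity) h
    calc _ = |binCoeff (2 + α) j| * (‖v ζ‖ * ‖H ζ‖ * ‖kernel α z ζ‖) *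
          (‖phi w z‖ ^ j * ‖phi w ζ‖ ^ j) := by ring
      _ ≤ _ := mul_le_of_le_one_right (by positivity) h3
  · exact Filter.Eventually.of_forall fun ζ => hsum.mul_right _
  · simp_rw [tsum_mul_right]
    exact hint.norm.const_mul _
  · filter_upwards [ae_mem_disc α] with ζ hζ
    exact (hasSum_binCoeff_kernel α hz hw hζ).mul_left _

/-- The left side is the norm of a rank one operator applied to H. The operator is a series of
copies of f T_v multiplied on both sides by contractions φ_w^j and conj φ_w^j, with coefficients
c_j, so the triangle inequality for partial sums and Fatou give the factor Σ|c_j|. -/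
lemma enorm_toeplitz_mul_eLpNorm_kernel_le (hα : -1 < α) (hpq : p.HolderConjugate q)
    (hf : AEStronglyMeasurable f (nuA α)) {v : ℂ → ℂ} (hv : MemLp v (ENNReal.ofReal q) (nuA α))
    {C : ℝ≥0∞} (hC : ∀ H, MemLp H (ENNReal.ofReal p) (nuA α) →
      eLpNorm (fun z => f z * toeplitz α v H z) (ENNReal.ofReal p) (nuA α) ≤
        C * eLpNorm H (ENNReal.ofReal p) (nuA α))
    {w : ℂ} (hw : w ∈ disc) {H : ℂ → ℂ} (hH : MemLp H (ENNReal.ofReal p) (nuA α)) :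
    ENNReal.ofReal ((1 - ‖w‖ ^ 2) ^ (2 + α)) * ‖toeplitz α v H w‖ₑ *
      eLpNorm (fun z => f z * kernel α z w) (ENNReal.ofReal p) (nuA α) ≤
      (∑' j, ENNReal.ofReal |binCoeff (2 + α) j|) * C *
        eLpNorm H (ENNReal.ofReal p) (nuA α) := by
  have hA := one_sub_norm_sq_pos hw
  have hp1 : 1 ≤ ENNReal.ofReal p := by
    rw [← ENNReal.ofReal_one]; exact ENNReal.ofReal_le_ofReal hpq.lt.le
  set Hj : ℕ → ℂ → ℂ := fun j ζ => H ζ * conj (phi w ζ) ^ j with hHj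
  set t : ℕ → ℂ → ℂ := fun j z =>
    (binCoeff (2 + α) j : ℂ) * phi w z ^ j * (f z * toeplitz α v (Hj j) z) with ht
  have hTm : ∀ j, AEStronglyMeasurable (fun z => f z * toeplitz α v (Hj j) z) (nuA α) := fun j =>
    hf.mul (aestronglyMeasurable_of_continuousOn α (differentiableOn_proj hα
      (integrable_mul_of_memLp hpq hv (memLp_mul_conj_phi_pow hw hH j).1)).continuousOn)
  have htm : ∀ j, AEStronglyMeasurable (t j) (nuA α) := fun j =>
    (((aestronglyMeasurable_phi α hw).pow j).const_mul _).mul (hTm j)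
  have htn : ∀ j, eLpNorm (t j) (ENNReal.ofReal p) (nuA α) ≤
      ENNReal.ofReal |binCoeff (2 + α) j| * (C * eLpNorm H (ENNReal.ofReal p) (nuA α)) := by
    intro j
    calc eLpNorm (t j) (ENNReal.ofReal p) (nuA α)
        ≤ eLpNorm ((binCoeff (2 + α) j : ℂ) • fun z => f z * toeplitz α v (Hj j) z)
          (ENNReal.ofReal p) (nuA α) := by
          refine eLpNorm_mono_ae ?_
          filter_upwards [ae_norm_phi_pow_le_one α hw j] with z h
          simp only [ht, Pi.smul_apply, smul_eq_mul]
          rw [norm_mul, norm_mul, norm_mul (binCoeff (2 + α) j : ℂ) (f z * _)]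
          exact mul_le_mul_of_nonneg_right (mul_le_of_le_one_right (norm_nonneg _) h)
            (norm_nonneg _)
      _ = ENNReal.ofReal |binCoeff (2 + α) j| *
          eLpNorm (fun z => f z * toeplitz α v (Hj j) z) (ENNReal.ofReal p) (nuA α) := by
          rw [eLpNorm_const_smul, ← ofReal_norm, Complex.norm_real, Real.norm_eq_abs]
      _ ≤ _ := mul_le_mul_right ((hC _ (memLp_mul_conj_phi_pow hw hH j).1).trans
          (mul_le_mul_right (memLp_mul_conj_phi_pow hw hH j).2 _)) _
  have hlim : ∀ᵐ z ∂(nuA α), Filter.Tendsto (fun n => (∑ j ∈ Finset.range n, t j) z) Filter.atTop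
      (nhds (((((1 - ‖w‖ ^ 2) ^ (2 + α) : ℝ) : ℂ) * toeplitz α v H w) *
        (f z * kernel α z w))) := by
    filter_upwards [ae_mem_disc α] with z hz
    have h := ((hasSum_phi_pow_mul_toeplitz hα (integrable_mul_of_memLp hpq hv hH) hz hw).mul_left
      (f z)).tendsto_sum_nat
    simp only [Finset.sum_apply]
    convert h using 1
    · funext n
      exact Finset.sum_congr rfl fun j _ => by simp only [ht]; ring
    · congr 1
      ring
  have hn : ∀ n, eLpNorm (∑ j ∈ Finset.range n, t j) (ENNReal.ofReal p) (nuA α) ≤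
      (∑' j, ENNReal.ofReal |binCoeff (2 + α) j|) * C * eLpNorm H (ENNReal.ofReal p) (nuA α) := by
    intro n
    refine (eLpNorm_sum_le (fun j _ => htm j) hp1).trans ?_
    refine (Finset.sum_le_sum fun j _ => htn j).trans ?_
    rw [← Finset.sum_mul, mul_assoc]
    exact mul_le_mul_left (ENNReal.sum_le_tsum _) _
  have hfin := (Lp.eLpNorm_lim_le_liminf_eLpNorm (p := ENNReal.ofReal p)
    (fun n => (Finset.range n).aestronglyMeasurable_sum fun j _ => htm j) _ hlim).trans
    (Filter.liminf_le_of_le (by isBoundedDefault) fun b hb => by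
      obtain ⟨n, h⟩ := hb.exists
      exact h.trans (hn n))
  refine le_trans (le_of_eq ?_) hfin
  have e := eLpNorm_const_smul (((((1 - ‖w‖ ^ 2) ^ (2 + α) : ℝ) : ℂ) * toeplitz α v H w))
    (fun z => f z * kernel α z w) (ENNReal.ofReal p) (nuA α)
  rw [enorm_mul, ← ofReal_norm (((1 - ‖w‖ ^ 2) ^ (2 + α) : ℝ) : ℂ), Complex.norm_real,
    Real.norm_eq_abs, abs_of_pos (Real.rpow_pos_of_pos hA _)] at e
  exact e.symm

/-- The extremal function in Hölder's inequality. -/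
lemma exists_dual_function (hpq : p.HolderConjugate q) {u : ℂ → ℂ}
    (hu : MemLp u (ENNReal.ofReal q) (nuA α)) :
    ∃ H : ℂ → ℂ, MemLp H (ENNReal.ofReal p) (nuA α) ∧
      eLpNorm H (ENNReal.ofReal p) (nuA α) = (∫⁻ ζ, ‖u ζ‖ₑ ^ q ∂(nuA α)) ^ (1 / p) ∧
      ‖∫ ζ, u ζ * H ζ ∂(nuA α)‖ₑ = ∫⁻ ζ, ‖u ζ‖ₑ ^ q ∂(nuA α) := by
  have hq := hpq.symm.lt
  have hXt := MemLp.lintegral_ne_top hpq.symm.pos hu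
  -- For q < 2 the real power takes a default value at a zero of u; the factor conj (u ζ) vanishes
  -- there, so the value is immaterial.
  set H : ℂ → ℂ := fun ζ => conj (u ζ) * ((‖u ζ‖ ^ (q - 2) : ℝ) : ℂ) with hH
  have hHm : AEStronglyMeasurable H (nuA α) := by
    refine hu.1.star.mul (Complex.continuous_ofReal.comp_aestronglyMeasurable ?_)
    exact (hu.1.norm.aemeasurable.pow_const _).aestronglyMeasurable
  have hHn : ∀ ζ, ‖H ζ‖ = ‖u ζ‖ ^ (q - 1) := by
    intro ζ
    rw [hH, norm_mul, RCLike.norm_conj, Complex.norm_real, Real.norm_eq_abs,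
      abs_of_nonneg (Real.rpow_nonneg (norm_nonneg _) _)]
    rcases eq_or_ne (u ζ) 0 with h | h
    · rw [h, norm_zero, zero_mul, Real.zero_rpow (by linarith)]
    · nth_rewrite 1 [← Real.rpow_one ‖u ζ‖]
      rw [← Real.rpow_add (norm_pos_iff.2 h)]
      ring_nf
  have huH : ∀ ζ, u ζ * H ζ = ((‖u ζ‖ ^ q : ℝ) : ℂ) := by
    intro ζ
    rw [hH, ← mul_assoc, Complex.mul_conj, Complex.normSq_eq_norm_sq, ← Complex.ofReal_mul]
    congr 1
    rcases eq_or_ne (u ζ) 0 with h | h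
    · rw [h, norm_zero, Real.zero_rpow hpq.symm.ne_zero]; simp
    · rw [← Real.rpow_two, ← Real.rpow_add (norm_pos_iff.2 h)]
      ring_nf
  have hHp : ∀ ζ, ‖H ζ‖ₑ ^ p = ‖u ζ‖ₑ ^ q := by
    intro ζ
    rw [← ofReal_norm_rpow hpq.nonneg, ← ofReal_norm_rpow hpq.symm.nonneg, hHn,
      ← Real.rpow_mul (norm_nonneg _)]
    congr 2
    have := hpq.symm.sub_one_mul_conj
    linarith
  have hHe : eLpNorm H (ENNReal.ofReal p) (nuA α) = (∫⁻ ζ, ‖u ζ‖ₑ ^ q ∂(nuA α)) ^ (1 / p) := by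
    rw [eLpNorm_ofReal hpq.pos]
    simp_rw [hHp]
  refine ⟨H, ⟨hHm, ?_⟩, hHe, ?_⟩
  · rw [hHe]
    exact ENNReal.rpow_lt_top_of_nonneg (by simpa using hpq.nonneg) hXt
  · simp_rw [huH]
    rw [integral_complex_ofReal, ← ofReal_norm, Complex.norm_real, Real.norm_eq_abs,
      abs_of_nonneg (integral_nonneg fun ζ => Real.rpow_nonneg (norm_nonneg _) _),
      ofReal_integral_eq_lintegral_ofReal]
    · simp_rw [ofReal_norm_rpow hpq.symm.nonneg]
    · have := hu.integrable_norm_rpow (by simpa using hpq.symm.pos) ENNReal.ofReal_ne_top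
      rwa [ENNReal.toReal_ofReal hpq.symm.nonneg] at this
    · exact Filter.Eventually.of_forall fun ζ => Real.rpow_nonneg (norm_nonneg _) _

/-- The rank one bound is tested on the Hölder extremal H of u = conj g · K(w, ·), for which
T_{ḡ}H(w) is the integral of u H. The factor (1-|w|²)^(2+α) splits evenly between the two normalized
kernels. -/
theorem iSup_normKernel_lt_top_of_toeplitzProductBounded (hα : -1 < α) (hpq : p.HolderConjugate q)
    (hf : MemBergman p α f) {g : ℂ → ℂ} (hg : MemBergman q α g)
    (hT : ToeplitzProductBounded p α f fun z => conj (g z)) :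
    (⨆ w ∈ disc, normA p α (fun z => f z * normKernel α w z) *
      normA q α (fun z => g z * normKernel α w z)) < ⊤ := by
  obtain ⟨C, hC, hCH⟩ := exists_eLpNorm_mul_toeplitz_le_of_memLp hα hpq hf hg hT
  set S : ℝ≥0∞ := ∑' j, ENNReal.ofReal |binCoeff (2 + α) j| with hS
  have hSt : S ≠ ⊤ := (summable_abs_binCoeff (by linarith)).tsum_ofReal_ne_top
  refine lt_of_le_of_lt (iSup₂_le fun w hw => ?_) (ENNReal.mul_lt_top hSt.lt_top hC.lt_top)
  have hA := one_sub_norm_sq_pos hw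
  set u : ℂ → ℂ := fun ζ => conj (g ζ) * kernel α w ζ with hu
  have huL : MemLp u (ENNReal.ofReal q) (nuA α) := by
    refine hg.2.of_le_mul (c := ((1 - ‖w‖) ^ (2 + α))⁻¹)
      (hg.2.star.1.mul (aestronglyMeasurable_kernel α w)) ?_
    filter_upwards [ae_norm_kernel_le hα hw] with ζ h
    rw [norm_mul, RCLike.norm_conj, mul_comm]
    exact mul_le_mul_of_nonneg_right h (norm_nonneg _)
  obtain ⟨H, hH, hHn, hHu⟩ := exists_dual_function hpq huL
  set X : ℝ≥0∞ := ∫⁻ ζ, ‖u ζ‖ₑ ^ q ∂(nuA α) with hX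
  have hXt : X ≠ ⊤ := MemLp.lintegral_ne_top hpq.symm.pos huL
  have hb := enorm_toeplitz_mul_eLpNorm_kernel_le hα hpq hf.2.1 hg.2.star hCH hw hH
  have hTw : toeplitz α (fun z => conj (g z)) H w = ∫ ζ, u ζ * H ζ ∂(nuA α) := by
    rw [toeplitz, proj]
    congr 1
    funext ζ
    simp only [hu]
    ring
  have hgn : normA q α (fun z => g z * kernel α z w) = X ^ (1 / q) := by
    rw [normA, eLpNorm_ofReal hpq.symm.pos]
    congr 1
    refine lintegral_congr_ae ?_
    filter_upwards [ae_mem_disc α] with z hz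
    congr 1
    simp only [hu]
    rw [← conj_kernel α hz hw, ← map_mul, ← ofReal_norm, ← ofReal_norm, RCLike.norm_conj]
  rw [normA_mul_normKernel hα hw, normA_mul_normKernel hα hw, hgn]
  change _ * ‖toeplitz α (fun z => conj (g z)) H w‖ₑ * _ ≤ _ at hb
  rw [hTw, hHu, hHn] at hb
  have hAA : ENNReal.ofReal ((1 - ‖w‖ ^ 2) ^ ((2 + α) / 2)) *
      ENNReal.ofReal ((1 - ‖w‖ ^ 2) ^ ((2 + α) / 2)) =
      ENNReal.ofReal ((1 - ‖w‖ ^ 2) ^ (2 + α)) := by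
    rw [← ENNReal.ofReal_mul (Real.rpow_nonneg hA.le _), ← Real.rpow_add hA]
    ring_nf
  calc _ = ENNReal.ofReal ((1 - ‖w‖ ^ 2) ^ (2 + α)) *
        normA p α (fun z => f z * kernel α z w) * X ^ (1 / q) := by rw [← hAA]; ring
    _ ≤ S * C := ?_
  -- For X ≠ 0 the norm X^(1/p) of H cancels from both sides; for X = 0 the left side is 0.
  rcases eq_or_ne X 0 with h0 | h0
  · rw [h0, ENNReal.zero_rpow_of_pos (by simpa using hpq.symm.pos), mul_zero]
    exact zero_le
  · have hX1 : X = X ^ (1 / q) * X ^ (1 / p) := by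
      rw [← ENNReal.rpow_add _ _ h0 hXt, one_div, one_div, hpq.symm.inv_add_inv_eq_one,
        ENNReal.rpow_one]
    have hXp0 : X ^ (1 / p) ≠ 0 := by
      simp [ENNReal.rpow_eq_zero_iff, h0, hXt]
    have hXpt : X ^ (1 / p) ≠ ⊤ :=
      ENNReal.rpow_ne_top_of_nonneg (by simpa using hpq.nonneg) hXt
    refine (ENNReal.mul_le_mul_iff_left hXp0 hXpt).1 ?_
    refine le_trans (le_of_eq ?_) hb
    nth_rewrite 3 [hX1]
    rw [normA]
    ring

end

/-! ### From (ii) to (iii) -/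

section

variable {p q α : ℝ} {f : ℂ → ℂ}

/-- The reference point of the Carleson box over an arc that starts at `e ^ {ia}` and has
normalized length `δ`. -/
def boxPoint (a δ : ℝ) : ℂ := ((1 - δ : ℝ) : ℂ) * Complex.exp (a * Complex.I)

lemma norm_boxPoint (a : ℝ) {δ : ℝ} (h1 : δ ≤ 1) : ‖boxPoint a δ‖ = 1 - δ := by
  rw [boxPoint, norm_mul, Complex.norm_exp_ofReal_mul_I, Complex.norm_real, Real.norm_eq_abs,
    abs_of_nonneg (by linarith), mul_one]

/-- Radially 1 - r(1 - δ) ≤ 2δ, and the angle θ - a is at most 2πδ < 6.3δ; 9 is a round upper bound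
for the sum. -/
lemma norm_one_sub_mul_conj_boxPoint_le {a b δ : ℝ} (hδ : (b - a) / (2 * Real.pi) = δ)
    (h1 : δ ≤ 1) {z : ℂ} (hz : z ∈ carlesonBox a b) :
    ‖1 - z * conj (boxPoint a δ)‖ ≤ 9 * δ := by
  obtain ⟨r, θ, hr, hr1, ha, hb, rfl⟩ := hz
  rw [hδ] at hr
  have hpi := Real.pi_pos
  have hba : b - a = 2 * Real.pi * δ := by rw [← hδ]; field_simp
  have hr0 : 0 < r := by linarith
  have hc : conj (boxPoint a δ) = ((1 - δ : ℝ) : ℂ) * Complex.exp (-(a * Complex.I)) := by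
    rw [boxPoint, map_mul, Complex.conj_ofReal, ← Complex.exp_conj, map_mul, Complex.conj_ofReal,
      Complex.conj_I, mul_neg]
  have e : 1 - r * Complex.exp (θ * Complex.I) * conj (boxPoint a δ) =
      ((1 - r * (1 - δ) : ℝ) : ℂ) -
        ((r * (1 - δ) : ℝ) : ℂ) * (Complex.exp (Complex.I * ((θ - a : ℝ) : ℂ)) - 1) := by
    have h : Complex.exp (Complex.I * ((θ - a : ℝ) : ℂ)) =
        Complex.exp (θ * Complex.I) * Complex.exp (-(a * Complex.I)) := by
      rw [← Complex.exp_add]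
      congr 1
      push_cast
      ring
    rw [hc, h]
    push_cast
    ring
  rw [e]
  have hm : r * (1 - δ) ≤ 1 := by nlinarith
  have hm0 : 0 ≤ r * (1 - δ) := mul_nonneg hr0.le (by linarith)
  have h3 : ‖Complex.exp (Complex.I * ((θ - a : ℝ) : ℂ)) - 1‖ ≤ θ - a :=
    Real.norm_exp_I_mul_ofReal_sub_one_le.trans_eq
      (by rw [Real.norm_eq_abs, abs_of_nonneg (by linarith)])
  refine (norm_sub_le _ _).trans ?_
  rw [norm_mul, Complex.norm_real, Complex.norm_real, Real.norm_eq_abs, Real.norm_eq_abs,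
    abs_of_nonneg (by linarith), abs_of_nonneg hm0]
  have hpi4 := Real.pi_lt_d2
  have h4 : r * (1 - δ) * ‖Complex.exp (Complex.I * ((θ - a : ℝ) : ℂ)) - 1‖ ≤ 1 * (θ - a) :=
    mul_le_mul hm h3 (norm_nonneg _) zero_le_one
  have hδ0 : 0 < δ := by linarith
  nlinarith

/-- On the box |K_w| ≥ (9δ)^(-(2+α)) at the reference point w, so |g| ≤ (9δ)^(2+α) |g K_w| there. -/
lemma mass_carlesonBox_le {s : ℝ} (hs : 0 < s) (hα : -1 < α) {a b δ : ℝ}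
    (hab : a < b) (hb : b ≤ a + 2 * Real.pi)
    (hδ : (b - a) / (2 * Real.pi) = δ) (h0 : 0 < δ) (h1 : δ ≤ 1) (g : ℂ → ℂ) :
    mass α (fun z => ‖g z‖ ^ s) (carlesonBox a b) ≤
      (ENNReal.ofReal ((9 * δ) ^ (2 + α)) *
        normA s α fun z => g z * kernel α z (boxPoint a δ)) ^ s := by
  have hw : boxPoint a δ ∈ disc := by rw [mem_disc, norm_boxPoint a h1]; linarith
  rw [normA, eLpNorm_ofReal hs, ENNReal.mul_rpow_of_nonneg _ _ hs.le, ← ENNReal.rpow_mul,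
    one_div_mul_cancel hs.ne', ENNReal.rpow_one, mass, ← lintegral_const_mul' _ _
    (ENNReal.rpow_ne_top_of_nonneg hs.le ENNReal.ofReal_ne_top)]
  refine le_trans (setLIntegral_mono_ae' (measurableSet_carlesonBox hab hb) ?_)
    (setLIntegral_le_lintegral (carlesonBox a b) _)
  filter_upwards [ae_mem_disc α] with z hzd hz
  rw [ofReal_norm_rpow hs.le, ← ENNReal.mul_rpow_of_nonneg _ _ hs.le]
  refine ENNReal.rpow_le_rpow ?_ hs.le
  rw [← ofReal_norm, ← ofReal_norm, ← ENNReal.ofReal_mul (by positivity)]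
  refine ENNReal.ofReal_le_ofReal ?_
  have hne := norm_pos_iff.2 (one_sub_ne_zero (norm_mul_conj_lt_one hzd hw))
  have hle := Real.rpow_le_rpow hne.le (norm_one_sub_mul_conj_boxPoint_le hδ h1 hz)
    (by linarith : 0 ≤ 2 + α)
  have hpos := Real.rpow_pos_of_pos hne (2 + α)
  rw [norm_mul, norm_kernel]
  calc ‖g z‖ = ‖1 - z * conj (boxPoint a δ)‖ ^ (2 + α) *
        (‖g z‖ * (‖1 - z * conj (boxPoint a δ)‖ ^ (2 + α))⁻¹) := by field_simp
    _ ≤ _ := mul_le_mul_of_nonneg_right hle (by positivity)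

lemma nuA_carlesonBox_ge (hα : -1 < α) {a b δ : ℝ} (hab : a < b) (hb : b ≤ a + 2 * Real.pi)
    (hδ : (b - a) / (2 * Real.pi) = δ) (h0 : 0 < δ) (h1 : δ ≤ 1) :
    ENNReal.ofReal (1 - (3 / 4) ^ (α + 1)) * ENNReal.ofReal (δ ^ (2 + α)) ≤
      nuA α (carlesonBox a b) := by
  have h34 : (3 / 4 : ℝ) ^ (α + 1) ≤ 1 := Real.rpow_le_one (by norm_num) (by norm_num) (by linarith)
  rw [← ENNReal.ofReal_mul (by linarith), add_comm 2 α]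
  refine (nuA_topHalf_ge hα (a / (2 * Real.pi)) h0 h1).trans (measure_mono ?_)
  have := box_subset_carlesonBox' hab hb
  rw [hδ] at this
  exact Set.sdiff_subset.trans this

/-- At the reference point 1 - |w|² = 2δ - δ² ≥ δ, which absorbs one of the two powers δ^(2+α) from
the mass bounds into the supremum; the other is comparable with the measure of the box. Since q(p -
1) = p, both masses enter as p-th powers. -/
theorem jointBB_lt_top_of_iSup_normKernel_lt_top (hα : -1 < α) (hpq : p.HolderConjugate q)
    (hS : (⨆ w ∈ disc, normA p α (fun z => f z * normKernel α w z) *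
      normA q α (fun z => (f z)⁻¹ * normKernel α w z)) < ⊤) :
    jointBB p α (fun z => ‖f z‖ ^ (-q)) (fun z => ‖f z‖ ^ p) < ⊤ := by
  set S := ⨆ w ∈ disc, normA p α (fun z => f z * normKernel α w z) *
    normA q α (fun z => (f z)⁻¹ * normKernel α w z) with hSdef
  set c : ℝ≥0∞ := ENNReal.ofReal (9 ^ (2 + α)) with hc
  set k : ℝ≥0∞ := ENNReal.ofReal (1 - (3 / 4) ^ (α + 1)) with hk
  have hk0 : k ≠ 0 := by
    rw [hk, Ne, ENNReal.ofReal_eq_zero, not_le, sub_pos]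
    exact Real.rpow_lt_one (by norm_num) (by norm_num) (by linarith)
  have hkt : k ≠ ⊤ := ENNReal.ofReal_ne_top
  have hfin : (c * c * S * k⁻¹) ^ p < ⊤ := by
    refine ENNReal.rpow_lt_top_of_nonneg hpq.nonneg ?_
    exact ENNReal.mul_ne_top (ENNReal.mul_ne_top (ENNReal.mul_ne_top ENNReal.ofReal_ne_top
      ENNReal.ofReal_ne_top) hS.ne) (ENNReal.inv_ne_top.2 hk0)
  refine lt_of_le_of_lt (iSup_le fun a => iSup_le fun b => iSup_le fun hab => iSup_le fun hb =>
    ENNReal.div_le_of_le_mul ?_) hfin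
  have hpi := Real.pi_pos
  obtain ⟨δ, hδ⟩ : ∃ δ, (b - a) / (2 * Real.pi) = δ := ⟨_, rfl⟩
  have h0 : 0 < δ := by rw [← hδ]; apply div_pos <;> linarith
  have h1 : δ ≤ 1 := by rw [← hδ, div_le_one (by positivity)]; linarith
  have hw : boxPoint a δ ∈ disc := by rw [mem_disc, norm_boxPoint a h1]; linarith
  set Δ : ℝ≥0∞ := ENNReal.ofReal (δ ^ (2 + α)) with hΔ
  set F := normA p α fun z => f z * kernel α z (boxPoint a δ) with hF
  set G := normA q α fun z => (f z)⁻¹ * kernel α z (boxPoint a δ) with hG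
  have hD : ENNReal.ofReal ((9 * δ) ^ (2 + α)) = c * Δ := by
    rw [Real.mul_rpow (by norm_num) h0.le, ENNReal.ofReal_mul (by positivity)]
  have m1 := mass_carlesonBox_le hpq.pos hα hab hb hδ h0 h1 f
  have m2 := mass_carlesonBox_le hpq.symm.pos hα hab hb hδ h0 h1 fun z => (f z)⁻¹
  rw [hD] at m1 m2
  have hFG : Δ * (F * G) ≤ S := by
    have h : normA p α (fun z => f z * normKernel α (boxPoint a δ) z) *
        normA q α (fun z => (f z)⁻¹ * normKernel α (boxPoint a δ) z) ≤ S :=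
      le_iSup₂ (f := fun w (_ : w ∈ disc) => normA p α (fun z => f z * normKernel α w z) *
        normA q α (fun z => (f z)⁻¹ * normKernel α w z)) (boxPoint a δ) hw
    rw [normA_mul_normKernel hα hw, normA_mul_normKernel hα hw] at h
    refine le_trans ?_ h
    have hA := one_sub_norm_sq_pos hw
    calc Δ * (F * G) ≤ ENNReal.ofReal ((1 - ‖boxPoint a δ‖ ^ 2) ^ (2 + α)) * (F * G) := by
          refine mul_le_mul_left (ENNReal.ofReal_le_ofReal (Real.rpow_le_rpow h0.le ?_
            (by linarith))) _
          rw [norm_boxPoint a h1]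
          nlinarith
      _ = ENNReal.ofReal ((1 - ‖boxPoint a δ‖ ^ 2) ^ ((2 + α) / 2)) *
          ENNReal.ofReal ((1 - ‖boxPoint a δ‖ ^ 2) ^ ((2 + α) / 2)) * (F * G) := by
          rw [← ENNReal.ofReal_mul (Real.rpow_nonneg hA.le _), ← Real.rpow_add hA, add_halves]
      _ = _ := by ring
  have hQ : Δ ≤ k⁻¹ * nuA α (carlesonBox a b) := by
    have h := mul_le_mul_right (nuA_carlesonBox_ge hα hab hb hδ h0 h1) k⁻¹
    rwa [← mul_assoc, ENNReal.inv_mul_cancel hk0 hkt, one_mul] at h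
  simp_rw [norm_rpow_neg q]
  rw [mass_one]
  have hexp : q * (p - 1) = p := by
    have := hpq.sub_one_mul_conj
    linarith
  calc mass α (fun z => ‖f z‖ ^ p) (carlesonBox a b) *
        mass α (fun z => ‖(f z)⁻¹‖ ^ q) (carlesonBox a b) ^ (p - 1)
      ≤ (c * Δ * F) ^ p * ((c * Δ * G) ^ q) ^ (p - 1) :=
        mul_le_mul' m1 (ENNReal.rpow_le_rpow m2 hpq.sub_one_pos.le)
    _ = (c * c * (Δ * (F * G)) * Δ) ^ p := by
        rw [← ENNReal.rpow_mul, hexp, ← ENNReal.mul_rpow_of_nonneg _ _ hpq.nonneg]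
        congr 1
        ring
    _ ≤ (c * c * S * (k⁻¹ * nuA α (carlesonBox a b))) ^ p :=
        ENNReal.rpow_le_rpow (mul_le_mul' (mul_le_mul_right hFG _) hQ) hpq.nonneg
    _ = (c * c * S * k⁻¹) ^ p * nuA α (carlesonBox a b) ^ p := by
        rw [← ENNReal.mul_rpow_of_nonneg _ _ hpq.nonneg]
        congr 1
        ring

end

end BergmanDisc

end

theorem mainTheorem10 (p q α : ℝ) (hp : 1 < p) (hpq : p * q = p + q) (hα : -1 < α)
    (f : ℂ → ℂ) (hf0 : ∀ z ∈ BergmanDisc.disc, f z ≠ 0)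
    (hf : BergmanDisc.MemBergman p α f)
    (hfinv : BergmanDisc.MemBergman q α (fun z => (f z)⁻¹)) :
    List.TFAE [
      BergmanDisc.ToeplitzProductBounded p α f (fun z => 1 / conj (f z)),
      (⨆ w ∈ BergmanDisc.disc,
        BergmanDisc.normA p α (fun z => f z * BergmanDisc.normKernel α w z) *
          BergmanDisc.normA q α (fun z => (f z)⁻¹ * BergmanDisc.normKernel α w z)) < ∞,
      BergmanDisc.jointBB p α (fun z => ‖f z‖ ^ (-q)) (fun z => ‖f z‖ ^ p) < ∞,
      BergmanDisc.PosProjBounded p α (fun z => ‖f z‖ ^ p) (fun z => ‖f z‖ ^ p)] := by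
  have hq0 : q ≠ 0 := by
    rintro rfl
    linarith
  have hc : p.HolderConjugate q := by
    rw [Real.holderConjugate_iff]
    refine ⟨hp, ?_⟩
    have hp0 : p ≠ 0 := by linarith
    field_simp
    linarith
  tfae_have 1 → 2 := fun h => by
    simp_rw [BergmanDisc.one_div_conj] at h
    exact BergmanDisc.iSup_normKernel_lt_top_of_toeplitzProductBounded hα hc hf hfinv h
  tfae_have 2 → 3 := BergmanDisc.jointBB_lt_top_of_iSup_normKernel_lt_top hα hc
  tfae_have 3 → 4 := BergmanDisc.posProjBounded_of_jointBB hα hc hf0 hf.2 hfinv.2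
  tfae_have 4 → 1 := BergmanDisc.toeplitzProductBounded_of_posProjBounded hα hc hf0 hf hfinv
  tfae_finish
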